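/- **Conventions.** $X$ is a simplicial graph; a subgraph always means an induced subgraph, and it is identified with its vertex set. For $Y\subseteq X$, the link $lk(Y)$ is the set of vertices adjacent to every vertex of $Y$. Connected graphs are regarded as geodesic metric spaces (edges of length one) with their path metrics. For a subset $A$ of a metric space, $N_r(A)$ is its $r$-neighbourhood. A geodesic space is $\delta$-hyperbolic if $d(x,z)+d(y,w)\le\max\{d(x,y)+d(z,w),\,d(y,z)+d(x,w)\}+2\delta$ for all points $x,y,z,w$. **Graph factor systems.** A graph factor system of $X$ with complexity constant $n$ is a set $\mathfrak F$ of non-empty subgraphs of $X$ (the domains) such that $X\in\mathfrak F$; $lk(v)\in\mathfrak F$ for every vertex $v$ with $lk(v)\neq\emptyset$; $F_1\cap F_2\in\mathfrak F$ whenever $F_1,F_2\in\mathfrak F$ and $F_1\cap F_2\ne\emptyset$; and $k<n$ for every chain $F_1\subsetneq\dots\subsetneq F_k$ in $\mathfrak F$. An $F$-graph is a graph whose vertices are the maximal cliques of $F$. Let $W$ be an $X$-graph. **Augmented graphs.** Introduce a new vertex $b_F$ for each domain $F\ne X$. The augmented graph $CX$ has vertex set $V(X)\cup\{b_F\mid F\in\mathfrak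 F,\ F\neq X\}$. Two distinct vertices $v,w$ of $X$ are adjacent in $CX$ if they are adjacent in $X$ or if there are $W$-adjacent maximal cliques $x\ni v$, $y\ni w$; and $b_F$ is adjacent exactly to the vertices of $F$. For $F\in\mathfrak F$, $CF$ is the subgraph of $CX$ induced on $V(F)\cup\{b_H\mid H\in\mathfrak F,\ H\subsetneq F\}$. Put $$PF=lk(F)\cup\{b_H\mid H\subseteq lk(F)\}\cup\{b_H\mid F\subseteq H\ne X\}\qquad(H\in\mathfrak F),$$ and let $Y_F$ be the subgraph of $CX$ induced on $V(CX)\setminus PF$; it contains $CF$. The same construction applied to a domain $F$ with the system $\{F'\in\mathfrak F\mid F'\subseteq F\}$ and an $F$-graph $W^F$ gives augmented graphs $C_FF'$ for the domains $F'\subseteq F$. **CHHF.** $(X,W,\mathfrak F)$ is a CHHF triple with constants $n,\delta$ if $\mathfrak F$ is a graph factor system of $X$ with complexity constant $n$ and the following hold. * ($\delta$-hyperbolicity condition) $\delta>0$, and for each $F\in\mathfrak F$ the graph $CF$ is $\delta$-hyperbolic and the inclusion $CF\to Y_F$ is a $(\delta,\delta)$-quasi-isometric embedding. * (Hierarchy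 condition) There are $F$-graphs $W^F$ ($F\in\mathfrak F$), with $W^X=W$, such that for all domains $F'\subseteq F$: $C_FF'=CF'$; and for each (possibly empty) maximal clique $x$ of $lk(F')\cap F$ there is a graph homomorphism $W^{F'}\to W^F$ sending each maximal clique $w$ of $F'$ to a maximal clique of $F$ that contains $x\cup w$. **Proto-hierarchy structures.** Let $E>0$ and let $\mathcal X$ be a quasi-geodesic space. An $E$-proto-hierarchy structure on $\mathcal X$ consists of an index set $\mathfrak S$, geodesic spaces $CU$ ($U\in\mathfrak S$), and the following. 1. (Projections) Maps $\pi_U$ from $\mathcal X$ to the non-empty subsets of $CU$ of diameter at most $E$, with $d(a,b)\le E\,d(x,y)+E$ for $a\in\pi_U(x)$, $b\in\pi_U(y)$, and $CU\subseteq N_E\big(\bigcup_x\pi_U(x)\big)$. 2. (Nesting) A partial order $\sqsubseteq$ on $\mathfrak S$ which, unless $\mathfrak S=\emptyset$, has a unique maximal element. For $U\sqsubsetneq V$, a non-empty set $\rho^U_V\subseteq CV$ of diameter at most $E$, and a map $\rho^V_U$ from $CV\setminus N_E(\rho^U_V)$ to non-empty subsets of $CU$. 3. (Orthogonality) A symmetric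 irreflexive relation $\perp$ on $\mathfrak S$ such that $U\sqsubseteq V$ and $V\perp W$ imply $U\perp W$, and such that orthogonal elements are not $\sqsubseteq$-comparable. 4. (Transversality) If $U,V$ are neither orthogonal nor $\sqsubseteq$-comparable, non-empty sets $\rho^U_V\subseteq CV$ and $\rho^V_U\subseteq CU$, each of diameter at most $E$. **Lemma 3.17.** For all $n$ and $\delta$ there is a constant $E=E(n,\delta)>0$ such that for every CHHF triple $(X,W,\mathfrak F)$ with constants $n,\delta$ the following data form an $E$-proto-hierarchy structure on the graph $W$ (in particular, $W$ is connected). The index set is $\mathfrak F$, and the space of $F\in\mathfrak F$ is the augmented graph $CF$. For $F\in\mathfrak F$ and points $x$ of $Y_F$, let $$p_F(x)=\{y\in CF\mid d_{Y_F}(x,y)\le d_{Y_F}(x,CF)+1\}$$ be the coarse closest-point projection; for a set $A$ of points of $Y_F$, $p_F(A)=\bigcup_{a\in A}p_F(a)$. * For a vertex $w$ of $W$, i.e. a maximal clique of $X$, $\pi_X(w)=w\subseteq CX$, and $\pi_F(w)=p_F(w\cap Y_F)$ for $F\neq X$ (with $w$ regarded as a set of vertices); for an interior point $e$ of an edge of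 $W$ with endpoints $w,w'$, $\pi_F(e)=\pi_F(w)\cup\pi_F(w')$. * $F\sqsubseteq F'$ if and only if $F\subseteq F'$. * $F\perp F'$ if and only if $F'\subseteq lk(F)$. * If $F\sqsubsetneq F'$, or if $F,F'$ are transverse, $\rho^F_{F'}=p_{F'}(PF\cap Y_{F'})$, where $PF$ is regarded as a set of vertices. * If $F\sqsubsetneq F'$, $\rho^{F'}_F(x)=p_F(x)$ for $x\in CF'\cap Y_F$, and $\rho^{F'}_F(x)=\emptyset$ for all other $x\in CF'$. -/

import Mathlib

namespace CHHF

/-! ## Metric notions, for an explicitly given real-valued distance function -/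

/-- `d` is a metric on `C`. -/
structure IsMetric {C : Type*} (d : C → C → ℝ) : Prop where
  eq_zero_iff : ∀ x y, d x y = 0 ↔ x = y
  symm : ∀ x y, d x y = d y x
  triangle : ∀ x y z, d x z ≤ d x y + d y z

/-- `(C, d)` is a geodesic metric space: any two points are joined by an isometrically
embedded interval of length equal to their distance. -/
structure IsGeodesicSpace {C : Type*} (d : C → C → ℝ) : Prop where
  isMetric : IsMetric d
  exists_geodesic : ∀ x y, ∃ γ : ℝ → C, γ 0 = x ∧ γ (d x y) = y ∧
    ∀ s ∈ Set.Icc 0 (d x y), ∀ t ∈ Set.Icc 0 (d x y), d (γ s) (γ t) = |s - t|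

/-- `(C, d)` is a quasi-geodesic metric space: for some `K ≥ 1` any two points are joined by a
`(K, K)`-quasi-geodesic. -/
structure IsQuasiGeodesicSpace {C : Type*} (d : C → C → ℝ) : Prop where
  isMetric : IsMetric d
  exists_quasigeodesic : ∃ K : ℝ, 1 ≤ K ∧ ∀ x y, ∃ (L : ℝ) (γ : ℝ → C),
    0 ≤ L ∧ γ 0 = x ∧ γ L = y ∧
      ∀ s ∈ Set.Icc 0 L, ∀ t ∈ Set.Icc 0 L,
        |s - t| / K - K ≤ d (γ s) (γ t) ∧ d (γ s) (γ t) ≤ K * |s - t| + K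

/-- `(C, d)` is a `δ`-hyperbolic geodesic metric space (Gromov's four-point condition). -/
structure IsHyperbolic {C : Type*} (δ : ℝ) (d : C → C → ℝ) : Prop where
  isGeodesicSpace : IsGeodesicSpace d
  four_point : ∀ x y z w, d x z + d y w ≤ max (d x y + d z w) (d y z + d x w) + 2 * δ

/-- The set `s` has diameter at most `r`. -/
def DiamLE {C : Type*} (d : C → C → ℝ) (s : Set C) (r : ℝ) : Prop :=
  ∀ x ∈ s, ∀ y ∈ s, d x y ≤ r

/-- The `r`-neighbourhood `N_r(s)`. -/
def nbhd {C : Type*} (d : C → C → ℝ) (r : ℝ) (s : Set C) : Set C :=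
  {x | ∃ a ∈ s, d x a ≤ r}

/-! ## Proto-hierarchy structures -/

/-- The data of a proto-hierarchy structure on `X`: an index set `S` with spaces `C U`, projections
`π_U`, relations `⊑` and `⊥`, sets `ρ^U_V ⊆ C V` (meaningful if `U ⊏ V` or `U ⋔ V`) and, for
`U ⊏ V`, maps `ρ^V_U` from `C V` to subsets of `C U` (meaningful away from a neighbourhood of
`ρ^U_V`). -/
structure ProtoData (X : Type*) (S : Type*) (C : S → Type*) where
  /-- the distance of `X` -/
  dX : X → X → ℝ
  /-- the distance of `C U` -/
  dC : ∀ U, C U → C U → ℝ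
  /-- the projection `π_U` -/
  proj : ∀ U, X → Set (C U)
  /-- `nest U V` is `U ⊑ V` -/
  nest : S → S → Prop
  /-- `orth U V` is `U ⊥ V` -/
  orth : S → S → Prop
  /-- `rel U V` is the set `ρ^U_V ⊆ C V`, for `U ⊏ V` or `U ⋔ V` -/
  rel : ∀ _ V : S, Set (C V)
  /-- `relMap V U` is the map `ρ^V_U`, for `U ⊏ V` -/
  relMap : ∀ V U : S, C V → Set (C U)

/-- Proper nesting `U ⊏ V`. -/
def ProtoData.pnest {X S : Type*} {C : S → Type*} (P : ProtoData X S C) (U V : S) : Prop :=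
  P.nest U V ∧ U ≠ V

/-- Transversality `U ⋔ V`: not orthogonal, and neither is nested in the other. -/
def ProtoData.trans {X S : Type*} {C : S → Type*} (P : ProtoData X S C) (U V : S) : Prop :=
  ¬ P.orth U V ∧ ¬ P.nest U V ∧ ¬ P.nest V U

/-- The data `P` form an `E`-proto-hierarchy structure. -/
structure IsProtoHierarchy {X S : Type*} {C : S → Type*} (E : ℝ) (P : ProtoData X S C) : Prop where
  E_pos : 0 < E
  quasiGeodesic : IsQuasiGeodesicSpace P.dX
  geodesic : ∀ U, IsGeodesicSpace (P.dC U)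
  -- projections
  proj_nonempty : ∀ U x, (P.proj U x).Nonempty
  proj_diam : ∀ U x, DiamLE (P.dC U) (P.proj U x) E
  proj_lipschitz : ∀ U x y, ∀ a ∈ P.proj U x, ∀ b ∈ P.proj U y, P.dC U a b ≤ E * P.dX x y + E
  proj_coarsely_onto : ∀ U c, c ∈ nbhd (P.dC U) E (⋃ x, P.proj U x)
  -- nesting
  nest_refl : ∀ U, P.nest U U
  nest_trans : ∀ U V W, P.nest U V → P.nest V W → P.nest U W
  nest_antisymm : ∀ U V, P.nest U V → P.nest V U → U = V
  maximal : IsEmpty S ∨ ∃! M : S, ∀ U, P.nest M U → U = M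
  rel_nest_nonempty : ∀ U V, P.pnest U V → (P.rel U V).Nonempty
  rel_nest_diam : ∀ U V, P.pnest U V → DiamLE (P.dC V) (P.rel U V) E
  relMap_nonempty : ∀ U V, P.pnest U V → ∀ x, x ∉ nbhd (P.dC V) E (P.rel U V) →
    (P.relMap V U x).Nonempty
  -- orthogonality
  orth_symm : ∀ U V, P.orth U V → P.orth V U
  orth_irrefl : ∀ U, ¬ P.orth U U
  orth_of_nest : ∀ U V W, P.nest U V → P.orth V W → P.orth U W
  orth_not_comparable : ∀ U V, P.orth U V → ¬ P.nest U V ∧ ¬ P.nest V U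
  -- transversality
  rel_trans : ∀ U V, P.trans U V →
    ((P.rel U V).Nonempty ∧ DiamLE (P.dC V) (P.rel U V) E) ∧
    ((P.rel V U).Nonempty ∧ DiamLE (P.dC U) (P.rel V U) E)

/-! ## Geometric realizations of graphs

The realization of a graph on `U` consists of the functions `U → ℝ` that are barycentric
coordinates of a point of a vertex or an edge. Thus the realization of an induced subgraph is a
subset of the realization of the whole graph, but carries its own path metric. -/

/-- The vertex `u`, as a point of a realization. -/
noncomputable def vertexPoint {U : Type*} (u : U) : U → ℝ :=
  open Classical in Pi.single u 1

/-- The realization of the subgraph of `H` induced on the vertex set `S`, all edges having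
length one. -/
def realization {U : Type*} (H : SimpleGraph U) (S : Set U) : Set (U → ℝ) :=
  {p | ∃ u ∈ S, ∃ v ∈ S, (u = v ∨ H.Adj u v) ∧
    ∃ t ∈ Set.Icc (0 : ℝ) 1, p = (1 - t) • vertexPoint u + t • vertexPoint v}

/-- The path metric of the realization of the subgraph of `H` induced on `S`, when that subgraph is
connected. Two points of one closed edge are at their distance along this edge; otherwise a
shortest path leaves `p` through a vertex `u` of the support of `p` (which is at distance `1 - p u`
from `p`), runs along edges, and reaches `q` through a vertex of the support of `q`. -/
noncomputable def realizationDist {U : Type*} (H : SimpleGraph U) (S : Set U) (p q : U → ℝ) : ℝ :=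
  open Classical in
  if ∃ u v, (u = v ∨ H.Adj u v) ∧ Function.support p ⊆ {u, v} ∧ Function.support q ⊆ {u, v} then
    ⨆ u, |p u - q u|
  else
    ⨅ a : Function.support p × Function.support q,
      (1 - p a.1) + ((H.induce S).spanningCoe.dist (a.1 : U) (a.2 : U) : ℝ) + (1 - q a.2)

/-! ## Graph factor systems and `X`-graphs

`X` is a simplicial graph `G` on the vertex type `V`; an induced subgraph is given by its set of
vertices, and `X` itself by `Set.univ`. -/

variable {V : Type*}

/-- The vertices of the link `lk(Y)`: those adjacent to all vertices of `Y`. -/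
def link (G : SimpleGraph V) (Y : Set V) : Set V := {v | ∀ y ∈ Y, G.Adj y v}

/-- `𝔉` is a graph factor system of `G` whose chains of domains all have length less than `n`.
Domains are non-empty. -/
structure IsFactorSystem (n : ℕ) (G : SimpleGraph V) (𝔉 : Set (Set V)) : Prop where
  nonempty : ∀ F ∈ 𝔉, F.Nonempty
  univ_mem : Set.univ ∈ 𝔉
  link_mem : ∀ v, (link G {v}).Nonempty → link G {v} ∈ 𝔉
  inter_mem : ∀ F₁ ∈ 𝔉, ∀ F₂ ∈ 𝔉, (F₁ ∩ F₂).Nonempty → F₁ ∩ F₂ ∈ 𝔉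
  complexity : ∀ (k : ℕ) (c : Fin k → Set V), StrictMono c → (∀ i, c i ∈ 𝔉) → k < n

/-- The maximal cliques of the subgraph of `G` induced on `A` (if `A` is empty, the only one is the
empty clique). An `A`-graph is a `SimpleGraph (MaxClique G A)`. -/
def MaxClique (G : SimpleGraph V) (A : Set V) : Type _ :=
  {w : Set V // Maximal (fun s => s ⊆ A ∧ G.IsClique s) w}

/-- Vertices of augmented graphs: vertices of `X` and projection vertices `b_F`. -/
inductive AugVertex (V : Type*) : Type _
  | vert : V → AugVertex V
  | proj : Set V → AugVertex V

/-- The vertices of `CF`: those of `F`, and `b_H` for the domains `H` properly contained in `F`. -/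
def augVerts (𝔉 : Set (Set V)) (F : Set V) : Set (AugVertex V) :=
  {a | match a with
    | .vert v => v ∈ F
    | .proj H => H ∈ 𝔉 ∧ H ⊂ F}

/-- The adjacency of the augmented graph of the subgraph of `G` induced on `A` that carries the
`A`-graph `WA`: edges of `G`, additional edges between vertices of `WA`-adjacent maximal cliques of
`A`, and edges from `b_H` to the vertices of `H`. The augmented graph of `A`, and those of the
domains contained in `A`, are induced subgraphs of this graph on sets `augVerts 𝔉 F`. -/
def augGraph (G : SimpleGraph V) {A : Set V} (WA : SimpleGraph (MaxClique G A)) :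
    SimpleGraph (AugVertex V) :=
  SimpleGraph.fromRel fun a b =>
    match a, b with
    | .vert v, .vert w => G.Adj v w ∨ ∃ x y : MaxClique G A, WA.Adj x y ∧ v ∈ x.1 ∧ w ∈ y.1
    | .vert v, .proj H => v ∈ H
    | _, _ => False

/-- The projection part `PF`: the vertices of `F^⊥ = lk(F)`, the `b_H` with `H ⊆ F^⊥`, and
the `b_H` with `F ⊆ H ≠ X`. -/
def projPart (G : SimpleGraph V) (𝔉 : Set (Set V)) (F : Set V) : Set (AugVertex V) :=
  {a | match a with
    | .vert v => v ∈ link G F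
    | .proj H => H ∈ 𝔉 ∧ (H ⊆ link G F ∨ (F ⊆ H ∧ H ≠ Set.univ))}

/-- The vertices of the complement graph `Y_F`: those of `CX` outside `PF`. -/
def compVerts (G : SimpleGraph V) (𝔉 : Set (Set V)) (F : Set V) : Set (AugVertex V) :=
  augVerts 𝔉 Set.univ \ projPart G 𝔉 F

section Triple

variable (G : SimpleGraph V) (W : SimpleGraph (MaxClique G Set.univ)) (𝔉 : Set (Set V))

/-- The augmented graph `CF` of a domain, as a space. -/
abbrev AugSpace (F : Set V) : Type _ := ↥(realization (augGraph G W) (augVerts 𝔉 F))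

/-- The path metric of `CF`. -/
noncomputable def augDist (F : Set V) (x y : AugSpace G W 𝔉 F) : ℝ :=
  realizationDist (augGraph G W) (augVerts 𝔉 F) x.1 y.1

/-- The path metric of `Y_F`. -/
noncomputable def compDist (F : Set V) (x y : AugVertex V → ℝ) : ℝ :=
  realizationDist (augGraph G W) (compVerts G 𝔉 F) x y

/-- The `δ`-hyperbolicity condition: each `CF` is `δ`-hyperbolic, and its inclusion into `Y_F`
is a `(δ, δ)`-quasi-isometric embedding. -/
structure HyperbolicityCondition (δ : ℝ) : Prop where
  pos : 0 < δ
  hyperbolic : ∀ F ∈ 𝔉, IsHyperbolic δ (augDist G W 𝔉 F)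
  qi_embedded : ∀ F ∈ 𝔉, ∀ x y : AugSpace G W 𝔉 F,
    augDist G W 𝔉 F x y / δ - δ ≤ compDist G W 𝔉 F x.1 y.1 ∧
      compDist G W 𝔉 F x.1 y.1 ≤ δ * augDist G W 𝔉 F x y + δ

/-- The hierarchy condition. The domains carry graphs `W^F`, with `W^X = W`, such that for domains
`F' ⊆ F` the augmented graphs of `F'` computed in `F` and in `X` coincide, and for each maximal
clique `x` of `lk(F') ∩ F` some choice of maximal cliques of `F` containing `x * w`, for the maximal
cliques `w` of `F'`, is a graph map from `W^F'` to `W^F`. -/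
def HierarchyCondition : Prop :=
  ∃ Wf : ∀ F : Set V, SimpleGraph (MaxClique G F), Wf Set.univ = W ∧
    ∀ F ∈ 𝔉, ∀ F' ∈ 𝔉, F' ⊆ F →
      (augGraph G (Wf F)).induce (augVerts 𝔉 F') = (augGraph G W).induce (augVerts 𝔉 F') ∧
      ∀ x : MaxClique G (link G F' ∩ F), ∃ f : Wf F' →g Wf F,
        ∀ w : MaxClique G F', x.1 ∪ w.1 ⊆ (f w).1

/-- `(X, W, 𝔉)` is a combinatorial HHS with factor system, with constants `n` and `δ`. -/
structure IsCHHF (n : ℕ) (δ : ℝ) : Prop where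
  factorSystem : IsFactorSystem n G 𝔉
  hyperbolicity : HyperbolicityCondition G W 𝔉 δ
  hierarchy : HierarchyCondition G W 𝔉

/-- The coarse closest point projection `p_F` from `Y_F` to `CF`,
`p_F(x) = {y ∈ CF | d_{Y_F}(x, y) ≤ d_{Y_F}(x, CF) + 1}`. -/
def closestPoint (F : Set V) (x : AugVertex V → ℝ) : Set (AugSpace G W 𝔉 F) :=
  {y | compDist G W 𝔉 F x y.1 ≤ (⨅ z : AugSpace G W 𝔉 F, compDist G W 𝔉 F x z.1) + 1}

/-- `p_F` of a set of vertices. -/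
def closestPointVerts (F : Set V) (A : Set (AugVertex V)) : Set (AugSpace G W 𝔉 F) :=
  ⋃ a ∈ A, closestPoint G W 𝔉 F (vertexPoint a)

/-- The projection `π_F` of a maximal clique `w`: the vertices of `w` if `F = X`, and
`p_F(w ∩ Y_F)` otherwise. -/
def cliqueProj (F : Set V) (w : MaxClique G Set.univ) : Set (AugSpace G W 𝔉 F) :=
  {y | (F = Set.univ ∧ ∃ v ∈ w.1, y.1 = vertexPoint (AugVertex.vert v)) ∨
    (F ≠ Set.univ ∧
      y ∈ closestPointVerts G W 𝔉 F (AugVertex.vert '' w.1 ∩ compVerts G 𝔉 F))}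

/-- The proto-hierarchy data of `(W, 𝔉)`. The space is the realization of `W`; the projection of an
interior point of an edge is the union of the projections of the endpoints. -/
noncomputable def protoData : ProtoData ↥(realization W Set.univ) ↥𝔉 (fun F => AugSpace G W 𝔉 F.1) where
  dX p q := realizationDist W Set.univ p.1 q.1
  dC F := augDist G W 𝔉 F.1
  proj F p := ⋃ w ∈ Function.support p.1, cliqueProj G W 𝔉 F.1 w
  nest F F' := F.1 ⊆ F'.1
  orth F F' := F'.1 ⊆ link G F.1
  rel F F' := closestPointVerts G W 𝔉 F'.1 (projPart G 𝔉 F.1 ∩ compVerts G 𝔉 F'.1)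
  relMap _ F x := {y | x.1 ∈ realization (augGraph G W) (compVerts G 𝔉 F.1) ∧
    y ∈ closestPoint G W 𝔉 F.1 x.1}

end Triple

end CHHF

/-!
Only a metric statement needs work: for each domain `F` the closest-point projection from `Y_F` to
`CF` is coarsely Lipschitz, with constants that depend on `n` and `δ` only. Everything else then
follows from short paths in `CX` and `W`.

If `Y_F` together with the vertex `b_F` coning off `F` is hyperbolic, then the closest points of `x`
in `CF` are, coarsely, the points at which geodesics from `x` to `b_F` enter `CF`. By
hyperbolicity adjacent vertices of `Y_F` have entry points within a bounded distance in `CF`, so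
the projection is coarsely Lipschitz.

That hyperbolicity comes from `CX` by deleting the part of `PF` in the link and then the vertices
`b_L` with `F ⊆ L`, one rank of `L` after the other, the largest first. Domains of the same rank are
incomparable, so the deleted vertices are independent, and the base of the cone at `b_L` is `CL`
without its part in the link; it is hyperbolic and quasi-isometrically embedded. Replacing the
passages of a geodesic through the deleted cone vertices by geodesics of the bases gives paths that
satisfy the guessing-geodesics criterion, so the graph stays hyperbolic.
-/

namespace CHHF

universe u

/-! ## Distances and hyperbolicity in induced subgraphs -/

section InducedDistance

variable {U : Type u} {H : SimpleGraph U} {S T : Set U} {x y z : U} {k l : ℕ}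

/-- The path distance of the subgraph of `H` induced on `S`. As for `SimpleGraph.dist`, it is `0`
between vertices that no path in `S` joins. -/
noncomputable def distOn (H : SimpleGraph U) (S : Set U) (x y : U) : ℕ :=
  (H.induce S).spanningCoe.dist x y

/-- `x` and `y` are joined by a path of length at most `k` in the subgraph induced on `S`. Unlike
`distOn H S x y ≤ k`, this also says that the two vertices lie in one component. -/
def JoinedWithin (H : SimpleGraph U) (S : Set U) (k : ℕ) (x y : U) : Prop :=
  (H.induce S).spanningCoe.Reachable x y ∧ distOn H S x y ≤ k

/-- The subgraph of `H` induced on `S` is connected or empty; the paths are taken in the spanning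
subgraph that `distOn` refers to. -/
def ConnectedOn (H : SimpleGraph U) (S : Set U) : Prop :=
  ∀ x ∈ S, ∀ y ∈ S, (H.induce S).spanningCoe.Reachable x y

/-- `m` lies on a geodesic from `x` to `y` in the subgraph induced on `S`. -/
def OnGeodesic (H : SimpleGraph U) (S : Set U) (x m y : U) : Prop :=
  m ∈ S ∧ distOn H S x m + distOn H S m y = distOn H S x y

/-- `γ` is a geodesic from `x` to `y` in the subgraph induced on `S`, parametrized by the integers
up to the distance of its endpoints; its later values are only required to lie in `S`. -/
structure IsGeodesic (H : SimpleGraph U) (S : Set U) (γ : ℕ → U) (x y : U) : Prop where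
  source : γ 0 = x
  target : γ (distOn H S x y) = y
  mem : ∀ i, γ i ∈ S
  dist_eq : ∀ {i j}, i ≤ j → j ≤ distOn H S x y → distOn H S (γ i) (γ j) = j - i

theorem spanningCoe_induce_adj : (H.induce S).spanningCoe.Adj x y ↔ x ∈ S ∧ y ∈ S ∧ H.Adj x y := by
  simp only [SimpleGraph.spanningCoe, SimpleGraph.map_adj, SimpleGraph.comap_adj,
    Function.Embedding.subtype_apply]
  constructor
  · rintro ⟨a, b, h, rfl, rfl⟩
    exact ⟨a.2, b.2, h⟩
  · rintro ⟨hx, hy, h⟩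
    exact ⟨⟨x, hx⟩, ⟨y, hy⟩, h, rfl, rfl⟩

theorem spanningCoe_induce_mono (h : S ⊆ T) :
    (H.induce S).spanningCoe ≤ (H.induce T).spanningCoe := by
  intro x y hxy
  obtain ⟨hx, hy, hxy⟩ := spanningCoe_induce_adj.1 hxy
  exact spanningCoe_induce_adj.2 ⟨h hx, h hy, hxy⟩

@[simp] theorem distOn_self (x : U) : distOn H S x x = 0 := SimpleGraph.dist_self

theorem distOn_comm (x y : U) : distOn H S x y = distOn H S y x := SimpleGraph.dist_comm

theorem distOn_eq_one (hx : x ∈ S) (hy : y ∈ S) (h : H.Adj x y) : distOn H S x y = 1 :=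
  SimpleGraph.dist_eq_one_iff_adj.2 (spanningCoe_induce_adj.2 ⟨hx, hy, h⟩)

theorem adj_of_distOn_eq_one (h : distOn H S x y = 1) : H.Adj x y :=
  (spanningCoe_induce_adj.1 (SimpleGraph.dist_eq_one_iff_adj.1 h)).2.2

theorem distOn_le_one (hx : x ∈ S) (hy : y ∈ S) (h : x = y ∨ H.Adj x y) : distOn H S x y ≤ 1 := by
  rcases h with rfl | h
  · simp only [distOn_self, zero_le]
  · exact (distOn_eq_one hx hy h).le

theorem JoinedWithin.refl (x : U) : JoinedWithin H S 0 x x :=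
  ⟨SimpleGraph.Reachable.refl x, (distOn_self x).le⟩

theorem JoinedWithin.symm (h : JoinedWithin H S k x y) : JoinedWithin H S k y x :=
  ⟨h.1.symm, (distOn_comm y x).trans_le h.2⟩

theorem JoinedWithin.trans (h : JoinedWithin H S k x y) (h' : JoinedWithin H S l y z) :
    JoinedWithin H S (k + l) x z :=
  ⟨h.1.trans h'.1, (h.1.dist_triangle_left z).trans (Nat.add_le_add h.2 h'.2)⟩

theorem JoinedWithin.mono (h : JoinedWithin H S k x y) (hkl : k ≤ l) : JoinedWithin H S l x y :=
  ⟨h.1, h.2.trans hkl⟩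

theorem joinedWithin_one (hx : x ∈ S) (hy : y ∈ S) (h : x = y ∨ H.Adj x y) :
    JoinedWithin H S 1 x y := by
  refine ⟨?_, distOn_le_one hx hy h⟩
  rcases h with rfl | h
  · exact SimpleGraph.Reachable.refl _
  · exact (spanningCoe_induce_adj.2 ⟨hx, hy, h⟩).reachable

theorem joinedWithin_of_path {γ : ℕ → U} {n : ℕ} (hS : ∀ i ≤ n, γ i ∈ S)
    (hadj : ∀ i < n, γ i = γ (i + 1) ∨ H.Adj (γ i) (γ (i + 1))) :
    JoinedWithin H S n (γ 0) (γ n) := by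
  induction n with
  | zero => exact .refl _
  | succ n ih =>
    exact (ih (fun i hi => hS i (by omega)) fun i hi => hadj i (by omega)).trans
      (joinedWithin_one (hS n (by omega)) (hS (n + 1) le_rfl) (hadj n (by omega)))

theorem ConnectedOn.triangle (hc : ConnectedOn H S) (hx : x ∈ S) (hy : y ∈ S) (z : U) :
    distOn H S x z ≤ distOn H S x y + distOn H S y z :=
  (hc x hx y hy).dist_triangle_left z

theorem ConnectedOn.eq_of_distOn_eq_zero (hc : ConnectedOn H S) (hx : x ∈ S) (hy : y ∈ S)
    (h : distOn H S x y = 0) : x = y :=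
  (hc x hx y hy).dist_eq_zero_iff.1 h

theorem ConnectedOn.distOn_anti (hc : ConnectedOn H S) (h : S ⊆ T) (hx : x ∈ S) (hy : y ∈ S) :
    distOn H T x y ≤ distOn H S x y :=
  SimpleGraph.Reachable.dist_anti (spanningCoe_induce_mono h) (hc x hx y hy)

theorem ConnectedOn.exists_isGeodesic (hc : ConnectedOn H S) (hx : x ∈ S) (hy : y ∈ S) :
    ∃ γ, IsGeodesic H S γ x y := by
  obtain ⟨p, hp⟩ := (hc x hx y hy).exists_walk_length_eq_dist
  change p.length = distOn H S x y at hp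
  have hadj : ∀ i < distOn H S x y,
      (H.induce S).spanningCoe.Adj (p.getVert i) (p.getVert (i + 1)) :=
    fun i hi => p.adj_getVert_succ (by omega)
  have hend : p.getVert (distOn H S x y) = y := hp ▸ p.getVert_length
  have hS : ∀ i, p.getVert i ∈ S := by
    intro i
    rcases lt_or_ge i (distOn H S x y) with h | h
    · exact (spanningCoe_induce_adj.1 (hadj i h)).1
    · rwa [p.getVert_of_length_le (by omega)]
  have hle : ∀ i j, i ≤ j → j ≤ distOn H S x y →
      distOn H S (p.getVert i) (p.getVert j) ≤ j - i := by
    intro i j hij hj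
    have := (joinedWithin_of_path (H := H) (γ := fun k => p.getVert (i + k)) (n := j - i)
      (fun k _ => hS _)
      (fun k hk => Or.inr (spanningCoe_induce_adj.1 (hadj (i + k) (by omega))).2.2)).2
    simpa only [Nat.add_zero, Nat.add_sub_cancel' hij] using this
  refine ⟨p.getVert, p.getVert_zero, hend, hS, fun {i j} hij hj => (hle i j hij hj).antisymm ?_⟩
  -- A shortcut between two points of the walk would shorten the whole walk.
  have hi := hle 0 i (by omega) (by omega)
  have hj' := hle j _ hj le_rfl
  rw [p.getVert_zero] at hi
  rw [hend] at hj'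
  have := hc.triangle hx (hS i) y
  have := hc.triangle (hS i) (hS j) y
  omega

namespace IsGeodesic

variable {γ : ℕ → U} {i : ℕ}

theorem dist_source (h : IsGeodesic H S γ x y) (hi : i ≤ distOn H S x y) :
    distOn H S x (γ i) = i := by
  simpa only [h.source, Nat.sub_zero] using h.dist_eq i.zero_le hi

theorem dist_target (h : IsGeodesic H S γ x y) (hi : i ≤ distOn H S x y) :
    distOn H S (γ i) y = distOn H S x y - i := by
  simpa only [h.target] using h.dist_eq hi le_rfl

theorem onGeodesic (h : IsGeodesic H S γ x y) (hi : i ≤ distOn H S x y) :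
    OnGeodesic H S x (γ i) y :=
  ⟨h.mem i, by rw [h.dist_source hi, h.dist_target hi]; omega⟩

theorem adj (h : IsGeodesic H S γ x y) (hi : i < distOn H S x y) : H.Adj (γ i) (γ (i + 1)) :=
  adj_of_distOn_eq_one (by rw [h.dist_eq (i.le_add_right 1) hi]; omega)

theorem joinedWithin (h : IsGeodesic H S γ x y) (hT : ∀ i ≤ distOn H S x y, γ i ∈ T) :
    JoinedWithin H T (distOn H S x y) x y := by
  have := joinedWithin_of_path hT fun i hi => Or.inr (h.adj hi)
  rwa [h.source, h.target] at this

end IsGeodesic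

theorem ConnectedOn.exists_onGeodesic (hc : ConnectedOn H S) (hx : x ∈ S) (hy : y ∈ S)
    (hk : k ≤ distOn H S x y) :
    ∃ m ∈ S, distOn H S x m = k ∧ distOn H S m y = distOn H S x y - k := by
  obtain ⟨γ, hγ⟩ := hc.exists_isGeodesic hx hy
  exact ⟨γ k, hγ.mem k, hγ.dist_source hk, hγ.dist_target hk⟩

theorem ConnectedOn.joinedWithin_diff_singleton (hc : ConnectedOn H S) (hx : x ∈ S) (hy : y ∈ S)
    {b : U} (h : distOn H S x y < distOn H S x b + distOn H S b y) :
    JoinedWithin H (S \ {b}) (distOn H S x y) x y := by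
  obtain ⟨γ, hγ⟩ := hc.exists_isGeodesic hx hy
  refine hγ.joinedWithin fun i hi => ⟨hγ.mem i, ?_⟩
  rintro rfl
  exact h.ne' (hγ.onGeodesic hi).2

theorem ConnectedOn.le_mul_distOn (hc : ConnectedOn H S) {f : U → U → ℕ} {K : ℕ}
    (hself : ∀ x ∈ S, f x x = 0)
    (htri : ∀ x ∈ S, ∀ y ∈ S, ∀ z ∈ S, f x z ≤ f x y + f y z)
    (hadj : ∀ x ∈ S, ∀ y ∈ S, H.Adj x y → f x y ≤ K) (hx : x ∈ S) (hy : y ∈ S) :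
    f x y ≤ K * distOn H S x y := by
  obtain ⟨γ, hγ⟩ := hc.exists_isGeodesic hx hy
  suffices ∀ i ≤ distOn H S x y, f x (γ i) ≤ K * i by simpa only [hγ.target] using this _ le_rfl
  intro i hi
  induction i with
  | zero => rw [hγ.source, hself x hx]; exact Nat.zero_le _
  | succ i ih =>
    calc f x (γ (i + 1)) ≤ f x (γ i) + f (γ i) (γ (i + 1)) :=
          htri x hx _ (hγ.mem i) _ (hγ.mem (i + 1))
      _ ≤ K * i + K :=
          Nat.add_le_add (ih (by omega)) (hadj _ (hγ.mem i) _ (hγ.mem (i + 1)) (hγ.adj hi))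
      _ = K * (i + 1) := (Nat.mul_succ K i).symm

theorem exists_and_not_succ {P : ℕ → Prop} {n : ℕ} (h0 : P 0) (hn : ¬ P n) :
    ∃ i < n, P i ∧ ¬ P (i + 1) := by
  by_contra! h
  have hP : ∀ i ≤ n, P i := by
    intro i
    induction i with
    | zero => exact fun _ => h0
    | succ i ih => exact fun hi => h i (by omega) (ih (by omega))
  exact hn (hP n le_rfl)

namespace OnGeodesic

variable {a m : U}

theorem left (hx : x ∈ S) (y : U) : OnGeodesic H S x x y :=
  ⟨hx, by rw [distOn_self, Nat.zero_add]⟩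

theorem right (x : U) (hy : y ∈ S) : OnGeodesic H S x y y := ⟨hy, by rw [distOn_self, Nat.add_zero]⟩

theorem symm (h : OnGeodesic H S x m y) : OnGeodesic H S y m x :=
  ⟨h.1, by rw [distOn_comm y m, distOn_comm m x, distOn_comm y x, Nat.add_comm, h.2]⟩

theorem trans_left (h : OnGeodesic H S x m y) (hc : ConnectedOn H S) (hx : x ∈ S)
    (h' : OnGeodesic H S x a m) : OnGeodesic H S x a y := by
  refine ⟨h'.1, le_antisymm ?_ (hc.triangle hx h'.1 y)⟩
  have := hc.triangle h'.1 h.1 y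
  have := h.2
  have := h'.2
  omega

theorem trans_right (h : OnGeodesic H S x m y) (hc : ConnectedOn H S) (hx : x ∈ S)
    (h' : OnGeodesic H S m a y) : OnGeodesic H S x a y := by
  refine ⟨h'.1, le_antisymm ?_ (hc.triangle hx h'.1 y)⟩
  have := hc.triangle hx h.1 a
  have := h.2
  have := h'.2
  omega

theorem tail (h : OnGeodesic H S x m y) (hc : ConnectedOn H S) (hx : x ∈ S)
    (h' : OnGeodesic H S x a m) : OnGeodesic H S a m y := by
  refine ⟨h.1, le_antisymm ?_ (hc.triangle h'.1 h.1 y)⟩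
  have := hc.triangle hx h'.1 y
  have := h.2
  have := h'.2
  omega

theorem add_le_of_near (h : OnGeodesic H S x m y) (hc : ConnectedOn H S) (hx : x ∈ S) (ha : a ∈ S)
    (ham : distOn H S a m ≤ k) : distOn H S x a + distOn H S a y ≤ distOn H S x y + 2 * k := by
  have := hc.triangle hx h.1 a
  have := hc.triangle ha h.1 y
  have := distOn_comm (H := H) (S := S) m a
  have := h.2
  omega

end OnGeodesic

end InducedDistance

section Hyperbolic

variable {U : Type u} {H : SimpleGraph U} {S : Set U} {δ : ℕ}

/-- The subgraph of `H` induced on `S` is connected, and its vertices satisfy Gromov's four-point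
condition; `δ` plays the role of the constant `2δ` of `IsHyperbolic`. -/
structure HyperbolicOn (H : SimpleGraph U) (S : Set U) (δ : ℕ) : Prop where
  conn : ConnectedOn H S
  four_point : ∀ x ∈ S, ∀ y ∈ S, ∀ z ∈ S, ∀ w ∈ S, distOn H S x z + distOn H S y w ≤
    max (distOn H S x y + distOn H S z w) (distOn H S y z + distOn H S x w) + δ

/-- The subgraph of `H` induced on `S` is connected, and in its geodesic triangles each side is in
the `δ`-neighbourhood of the union of the others, up to the choice of the other sides. -/
structure SlimOn (H : SimpleGraph U) (S : Set U) (δ : ℕ) : Prop where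
  conn : ConnectedOn H S
  slim : ∀ x ∈ S, ∀ y ∈ S, ∀ z ∈ S, ∀ p, OnGeodesic H S x p y →
    ∃ q, (OnGeodesic H S x q z ∨ OnGeodesic H S z q y) ∧ distOn H S p q ≤ δ

theorem HyperbolicOn.mono {δ' : ℕ} (h : HyperbolicOn H S δ) (hδ : δ ≤ δ') : HyperbolicOn H S δ' :=
  ⟨h.conn, fun x hx y hy z hz w hw => (h.four_point x hx y hy z hz w hw).trans (by omega)⟩

theorem HyperbolicOn.slimOn (h : HyperbolicOn H S δ) : SlimOn H S (2 * δ) := by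
  refine ⟨h.conn, fun x hx y hy z hz p hp => ?_⟩
  -- The side that the four-point condition for `p` selects contains the point `q` at the distance
  -- `d(x, p)` from `x`.
  have near_side : ∀ x ∈ S, ∀ y, OnGeodesic H S x p y →
      distOn H S p z + distOn H S x p ≤ distOn H S x z + δ →
      ∃ q, OnGeodesic H S x q z ∧ distOn H S p q ≤ 2 * δ := by
    intro x hx y hp hle
    obtain ⟨q, hq, hxq, hqz⟩ := h.conn.exists_onGeodesic hx hz
      (k := min (distOn H S x p) (distOn H S x z)) (min_le_right _ _)
    refine ⟨q, ⟨hq, by omega⟩, ?_⟩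
    have := h.four_point p hp.1 x hx q hq z hz
    rw [distOn_comm p x] at this
    omega
  have hpx := distOn_comm (H := H) (S := S) p x
  have hpxzy := h.four_point p hp.1 x hx z hz y hy
  have hp2 := hp.2
  rcases le_total (distOn H S x p + distOn H S z y) (distOn H S x z + distOn H S p y) with hle | hle
  · obtain ⟨q, hq, hpq⟩ := near_side x hx y hp (by omega)
    exact ⟨q, Or.inl hq, hpq⟩
  · obtain ⟨q, hq, hpq⟩ := near_side y hy x hp.symm
      (by rw [distOn_comm y p, distOn_comm y z]; omega)
    exact ⟨q, Or.inr hq.symm, hpq⟩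

theorem SlimOn.exists_center (h : SlimOn H S δ) {x y z : U} (hx : x ∈ S) (hy : y ∈ S)
    (hz : z ∈ S) {γ : ℕ → U} (hγ : IsGeodesic H S γ x z) :
    ∃ i ≤ distOn H S x z,
      distOn H S x (γ i) + distOn H S (γ i) y ≤ distOn H S x y + 2 * (δ + 1) ∧
      distOn H S y (γ i) + distOn H S (γ i) z ≤ distOn H S y z + 2 * (δ + 1) := by
  let NearFirstSide (i : ℕ) : Prop := ∃ q, OnGeodesic H S x q y ∧ distOn H S (γ i) q ≤ δ
  by_cases hall : NearFirstSide (distOn H S x z)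
  · obtain ⟨q, hq, hle⟩ := hall
    refine ⟨_, le_rfl, hq.add_le_of_near h.conn hx (hγ.mem _) (by omega), ?_⟩
    rw [hγ.target, distOn_self]
    omega
  obtain ⟨i, hi, ⟨q, hq, hqd⟩, hn⟩ := exists_and_not_succ (P := NearFirstSide)
    ⟨x, .left hx y, by rw [hγ.source, distOn_self]; omega⟩ hall
  refine ⟨i, hi.le, hq.add_le_of_near h.conn hx (hγ.mem _) (by omega), ?_⟩
  obtain ⟨q', hq' | hq', hqd' : distOn H S (γ (i + 1)) q' ≤ δ⟩ :=
    h.slim x hx z hz y hy _ (hγ.onGeodesic hi)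
  · exact absurd ⟨q', hq', hqd'⟩ hn
  · refine hq'.add_le_of_near h.conn hy (hγ.mem _) ?_
    have := h.conn.triangle (hγ.mem i) (hγ.mem (i + 1)) q'
    have := hγ.dist_eq (i.le_add_right 1) hi
    omega

theorem SlimOn.hyperbolicOn (h : SlimOn H S δ) : HyperbolicOn H S (4 * δ + 4) := by
  refine ⟨h.conn, fun x hx y hy z hz w hw => ?_⟩
  obtain ⟨γ, hγ⟩ := h.conn.exists_isGeodesic hx hz
  obtain ⟨i, hi, hxy, hyz⟩ := h.exists_center hx hy hz hγ
  obtain ⟨j, hj, hxw, hwz⟩ := h.exists_center hx hw hz hγ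
  have := (hγ.onGeodesic hi).2
  have := (hγ.onGeodesic hj).2
  have := hγ.dist_source hi
  have := hγ.dist_source hj
  have hyiw := h.conn.triangle hy (hγ.mem i) w
  have := h.conn.triangle hy (hγ.mem j) w
  have hiw := h.conn.triangle (hγ.mem i) (hγ.mem j) w
  have := h.conn.triangle hy (hγ.mem i) (γ j)
  have := distOn_comm (H := H) (S := S) y (γ i)
  have := distOn_comm (H := H) (S := S) w (γ j)
  have := distOn_comm (H := H) (S := S) w z
  have := distOn_comm (H := H) (S := S) (γ i) (γ j)
  rcases le_total i j with hij | hij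
  · have := hγ.dist_eq hij hj
    omega
  · have := hγ.dist_eq hij hi
    omega

end Hyperbolic

/-! ## The guessing-geodesics criterion -/

section Guessing

theorem mul_succ_le_two_pow {C k : ℕ} (hk : 2 * C ≤ k) : C * (k + 1) ≤ 2 ^ k := by
  have base : C * (2 * C + 1) ≤ 2 ^ (2 * C) := by
    induction C with
    | zero => exact Nat.zero_le _
    | succ C ih =>
      rcases Nat.eq_zero_or_pos C with rfl | hC
      · norm_num
      · have := ih (by omega)
        rw [show 2 * (C + 1) = 2 * C + 2 by ring, pow_add]
        nlinarith
  induction k, hk using Nat.le_induction with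
  | base => exact base
  | succ k hk ih =>
    rw [pow_succ]
    nlinarith

-- For `t > T` a suitable `k` is about `t / (2 * (h + 1))`, so `2 ^ k` outgrows multiples of `t`.
theorem exists_log_bound (h : ℕ) :
    ∃ T, ∀ t > T, ∃ k, 2 * (T + 2 * h + t + 1) ≤ 2 ^ k ∧ 2 * h + h * (k + 1) < t := by
  set C := 12 * (h + 1) with hC
  refine ⟨2 * (h + 1) * (2 * C) + 6 * h, fun t ht => ⟨t / (2 * (h + 1)), ?_, ?_⟩⟩
  · set k := t / (2 * (h + 1)) with hk
    have hCk : 2 * C ≤ k := by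
      rw [hk, Nat.le_div_iff_mul_le (by omega)]
      nlinarith
    have hpow := mul_succ_le_two_pow hCk
    have htk : t < 2 * (h + 1) * (k + 1) := Nat.lt_mul_div_succ t (by omega)
    have : C * (k + 1) = 6 * (2 * (h + 1) * (k + 1)) := by rw [hC]; ring
    omega
  · have hdiv : 2 * (h + 1) * (t / (2 * (h + 1))) ≤ t := Nat.mul_div_le _ _
    have : 2 * (h * (t / (2 * (h + 1)))) ≤ 2 * (h + 1) * (t / (2 * (h + 1))) := by
      rw [← mul_assoc]; exact Nat.mul_le_mul_right _ (by omega)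
    rw [mul_add]
    omega

/-- The sets `L x y` are candidates for neighbourhoods of geodesics from `x` to `y` in the subgraph
induced on `S`: they form `h`-slim triangles, they are small if `x` and `y` are equal or adjacent,
and they are coarsely connected, which is expressed by crossing every separation of `x` from `y`. -/
structure GuessesGeodesics (H : SimpleGraph U) (S : Set U) (L : U → U → Set U) (h : ℕ) : Prop where
  subset : ∀ x ∈ S, ∀ y ∈ S, L x y ⊆ S
  right_mem : ∀ x ∈ S, ∀ y ∈ S, y ∈ L x y
  slim : ∀ x ∈ S, ∀ y ∈ S, ∀ z ∈ S, ∀ p ∈ L x y,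
    ∃ q, (q ∈ L x z ∨ q ∈ L z y) ∧ distOn H S p q ≤ h
  near : ∀ x ∈ S, ∀ y ∈ S, distOn H S x y ≤ 1 → ∀ p ∈ L x y, distOn H S x p ≤ h
  crosses : ∀ x ∈ S, ∀ y ∈ S, ∀ A : Set U, x ∈ A → y ∉ A →
    ∃ p ∈ L x y, ∃ q ∈ L x y, p ∈ A ∧ q ∉ A ∧ distOn H S p q ≤ 1

variable {U : Type u} {H : SimpleGraph U} {S : Set U} {L : U → U → Set U} {h T : ℕ}

-- Halving a geodesic `k` times costs `h` for each halving.
theorem GuessesGeodesics.log_close (hL : GuessesGeodesics H S L h) (hc : ConnectedOn H S) (k : ℕ) :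
    ∀ x ∈ S, ∀ y ∈ S, distOn H S x y ≤ 2 ^ k → ∀ p ∈ L x y,
      ∃ q, OnGeodesic H S x q y ∧ distOn H S p q ≤ h * (k + 1) := by
  induction k with
  | zero =>
    intro x hx y hy hd p hp
    exact ⟨x, .left hx y, by simpa [distOn_comm] using hL.near x hx y hy hd p hp⟩
  | succ k ih =>
    intro x hx y hy hd p hp
    obtain ⟨m, hm, hxm, hmy⟩ := hc.exists_onGeodesic hx hy (k := min (2 ^ k) (distOn H S x y))
      (min_le_right _ _)
    rw [pow_succ] at hd
    have hgeo : OnGeodesic H S x m y := ⟨hm, by omega⟩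
    have hpS := hL.subset x hx y hy hp
    rw [Nat.mul_succ h (k + 1)]
    obtain ⟨p', hp' | hp', hpp⟩ := hL.slim x hx y hy m hm p hp
    · obtain ⟨q, hq, hqd⟩ := ih x hx m hm (by omega) p' hp'
      have := hc.triangle hpS (hL.subset x hx m hm hp') q
      exact ⟨q, hgeo.trans_left hc hx hq, by omega⟩
    · obtain ⟨q, hq, hqd⟩ := ih m hm y hy (by omega) p' hp'
      have := hc.triangle hpS (hL.subset m hm y hy hp') q
      exact ⟨q, hgeo.trans_right hc hx hq, by omega⟩

theorem ConnectedOn.two_mul_lt_distOn_of_far (hc : ConnectedOn H S) {x x' q p p' : U} {t : ℕ}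
    (hx : x ∈ S) (hp : p ∈ S) (hp' : p' ∈ S) (hx' : OnGeodesic H S x x' q)
    (hpq : distOn H S p q = t) (hpx : 3 * h < distOn H S p x)
    (hx'q : distOn H S x' q = min (T + 2 * h + t + 1) (distOn H S x q))
    (hnear : x = x' → distOn H S x p' ≤ h)
    (hclose : T + 2 * h + t + 1 < distOn H S x q →
      ∃ q', OnGeodesic H S x q' x' ∧ distOn H S p' q' ≤ T) :
    2 * h < distOn H S p p' := by
  by_contra! hpp
  by_cases hR : T + 2 * h + t + 1 < distOn H S x q
  · obtain ⟨q', hq', hqd'⟩ := hclose hR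
    have := hc.triangle hp hp' q'
    have := hc.triangle hq'.1 hp q
    have := hc.triangle hx hq'.1 q
    have := distOn_comm (H := H) (S := S) q' p
    have := hq'.2
    have := hx'.2
    omega
  · have := hx'.2
    have := hnear (hc.eq_of_distOn_eq_zero hx hx'.1 (by omega))
    have := hc.triangle hp hp' x
    have := distOn_comm (H := H) (S := S) p' x
    omega

theorem GuessesGeodesics.exists_close_of_far (hL : GuessesGeodesics H S L h)
    (hc : ConnectedOn H S) {x x' y' y p : U} {k : ℕ} (hx : x ∈ S) (hx' : x' ∈ S) (hy' : y' ∈ S)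
    (hy : y ∈ S) (hk : distOn H S x' y' ≤ 2 ^ k) (hp : p ∈ L x y)
    (far_left : ∀ p' ∈ L x x', 2 * h < distOn H S p p')
    (far_right : ∀ p' ∈ L y' y, 2 * h < distOn H S p p') :
    ∃ q, OnGeodesic H S x' q y' ∧ distOn H S p q ≤ 2 * h + h * (k + 1) := by
  have hpS := hL.subset x hx y hy hp
  obtain ⟨p₁, hp₁ | hp₁, hpp₁⟩ := hL.slim x hx y hy x' hx' p hp
  · exact absurd (far_left p₁ hp₁) (by omega)
  obtain ⟨p₂, hp₂ | hp₂, hpp₂⟩ := hL.slim x' hx' y hy y' hy' p₁ hp₁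
  all_goals have := hc.triangle hpS (hL.subset x' hx' y hy hp₁) p₂
  · obtain ⟨q, hq, hp₂q⟩ := hL.log_close hc k x' hx' y' hy' hk p₂ hp₂
    have := hc.triangle hpS (hL.subset x' hx' y' hy' hp₂) q
    exact ⟨q, hq, by omega⟩
  · exact absurd (far_right p₂ hp₂) (by omega)

-- Let `q` be the point of a geodesic closest to `p ∈ L x y`, and cut the geodesic at a distance
-- comparable to `t = d(p, q)` on both sides of `q`. By induction `p` is far from the outer parts,
-- so it is close to the guess for the middle part, which is within `O(log t)` of the geodesic.
theorem GuessesGeodesics.close (hL : GuessesGeodesics H S L h) (hc : ConnectedOn H S)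
    (hT : ∀ t > T, ∃ k, 2 * (T + 2 * h + t + 1) ≤ 2 ^ k ∧ 2 * h + h * (k + 1) < t) (N : ℕ) :
    ∀ x ∈ S, ∀ y ∈ S, distOn H S x y = N → ∀ p ∈ L x y,
      ∃ q, OnGeodesic H S x q y ∧ distOn H S p q ≤ T := by
  induction N using Nat.strong_induction_on with
  | _ N ih =>
  intro x hx y hy hN p hp
  obtain ⟨q, hq, hmin⟩ := exists_minimalFor_of_wellFoundedLT (fun q => OnGeodesic H S x q y)
    (distOn H S p) ⟨x, .left hx y⟩
  replace hmin : ∀ q', OnGeodesic H S x q' y → distOn H S p q ≤ distOn H S p q' :=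
    fun q' hq' => (le_total _ _).elim (hmin hq') id
  refine ⟨q, hq, ?_⟩
  by_contra! ht
  obtain ⟨k, hk, hkt⟩ := hT _ ht
  set t := distOn H S p q
  have hh : h ≤ h * (k + 1) := Nat.le_mul_of_pos_right _ (by omega)
  have := hq.2
  obtain ⟨x', hx', hxx', hx'q⟩ := hc.exists_onGeodesic hx hq.1
    (k := distOn H S x q - min (T + 2 * h + t + 1) (distOn H S x q)) (by omega)
  obtain ⟨y', hy', hqy', hy'y⟩ := hc.exists_onGeodesic hq.1 hy
    (k := min (T + 2 * h + t + 1) (distOn H S q y)) (by omega)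
  have gx' : OnGeodesic H S x x' q := ⟨hx', by omega⟩
  have gy' : OnGeodesic H S q y' y := ⟨hy', by omega⟩
  have := hc.triangle hx' hq.1 y'
  have hpS := hL.subset x hx y hy hp
  have far_left : ∀ p' ∈ L x x', 2 * h < distOn H S p p' := fun p' hp' =>
    hc.two_mul_lt_distOn_of_far (T := T) (t := t) hx hpS (hL.subset x hx x' hx' hp') gx' rfl
      (by have := hmin x (.left hx y); omega) (by omega)
      (fun e => hL.near x hx x' hx' (by rw [← e, distOn_self]; omega) p' hp')
      fun hR => ih _ (by omega) x hx x' hx' rfl p' hp'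
  have far_right : ∀ p' ∈ L y' y, 2 * h < distOn H S p p' := fun p' hp' =>
    hc.two_mul_lt_distOn_of_far (T := T) (t := t) hy hpS (hL.subset y' hy' y hy hp') gy'.symm
      rfl (by have := hmin y (.right x hy); omega)
      (by rw [distOn_comm y' q, distOn_comm y q]; omega)
      (fun e => e ▸ hL.near y' hy' y hy (by rw [← e, distOn_self]; omega) p' hp')
      fun hR => (ih _ (by rw [distOn_comm y q] at hR; omega) y' hy' y hy rfl p' hp').imp
        fun _ h => ⟨h.1.symm, h.2⟩
  obtain ⟨q', hq', hpq'⟩ :=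
    hL.exists_close_of_far hc hx hx' hy' hy (k := k) (by omega) hp far_left far_right
  have := hmin q' ((hq.trans_left hc hx gx').trans_right hc hx
    (((hq.tail hc hx gx').trans_right hc hx' gy').trans_left hc hx' hq'))
  omega

theorem exists_guess_close (h : ℕ) : ∃ T, ∀ {U : Type u} {H : SimpleGraph U} {S : Set U}
    {L : U → U → Set U}, GuessesGeodesics H S L h → ConnectedOn H S → ∀ x ∈ S, ∀ y ∈ S,
      ∀ p ∈ L x y, ∃ q, OnGeodesic H S x q y ∧ distOn H S p q ≤ T := by
  obtain ⟨T, hT⟩ := exists_log_bound h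
  exact ⟨T, fun hL hc x hx y hy => hL.close hc hT _ x hx y hy rfl⟩

-- The guess for `x, y` passes from the neighbourhood of a geodesic from `x` to `m` to that of a
-- geodesic from `m` to `y`, and does so close to `m`.
theorem GuessesGeodesics.exists_near (hL : GuessesGeodesics H S L h) (hc : ConnectedOn H S)
    (close : ∀ x ∈ S, ∀ y ∈ S, ∀ p ∈ L x y, ∃ q, OnGeodesic H S x q y ∧ distOn H S p q ≤ T)
    {x y m : U} (hx : x ∈ S) (hy : y ∈ S) (hm : OnGeodesic H S x m y) :
    ∃ p ∈ L x y, distOn H S m p ≤ 3 * (T + h) + 1 := by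
  have near_half : ∀ p ∈ L x y, (∃ a, OnGeodesic H S x a m ∧ distOn H S p a ≤ T + h) ∨
      ∃ a, OnGeodesic H S m a y ∧ distOn H S p a ≤ T + h := by
    intro p hp
    have hpS := hL.subset x hx y hy hp
    obtain ⟨q, hq | hq, hd⟩ := hL.slim x hx y hy m hm.1 p hp
    · obtain ⟨a, ha, had⟩ := close x hx m hm.1 q hq
      have := hc.triangle hpS (hL.subset x hx m hm.1 hq) a
      exact Or.inl ⟨a, ha, by omega⟩
    · obtain ⟨a, ha, had⟩ := close m hm.1 y hy q hq
      have := hc.triangle hpS (hL.subset m hm.1 y hy hq) a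
      exact Or.inr ⟨a, ha, by omega⟩
  have hmd := hm.2
  by_cases hy' : ∃ a, OnGeodesic H S x a m ∧ distOn H S y a ≤ T + h
  · obtain ⟨a, ha, had⟩ := hy'
    refine ⟨y, hL.right_mem x hx y hy, ?_⟩
    have := hc.triangle hx ha.1 y
    have := ha.2
    have := distOn_comm (H := H) (S := S) y a
    omega
  obtain ⟨p, hp, p', hp', ⟨a, ha, had⟩, hpA', hpp⟩ := hL.crosses x hx y hy
    {p | ∃ a, OnGeodesic H S x a m ∧ distOn H S p a ≤ T + h}
    ⟨x, .left hx m, by rw [distOn_self]; omega⟩ hy'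
  obtain ⟨a', ha', had'⟩ := (near_half p' hp').resolve_left hpA'
  refine ⟨p, hp, ?_⟩
  have hpS := hL.subset x hx y hy hp
  have := hc.triangle ha.1 hpS a'
  have := hc.triangle hpS (hL.subset x hx y hy hp') a'
  have := hc.triangle hx ha.1 y
  have := hc.triangle ha.1 ha'.1 y
  have := hc.triangle hm.1 ha.1 p
  have := distOn_comm (H := H) (S := S) a p
  have := distOn_comm (H := H) (S := S) m a
  have := ha.2
  have := ha'.2
  omega

theorem exists_hyperbolicOn_of_guessesGeodesics (h : ℕ) : ∃ δ, ∀ {U : Type u} {H : SimpleGraph U}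
    {S : Set U} {L : U → U → Set U}, ConnectedOn H S → GuessesGeodesics H S L h →
      HyperbolicOn H S δ := by
  obtain ⟨T, hT⟩ := exists_guess_close.{u} h
  refine ⟨4 * (3 * (T + h) + 1 + h + T) + 4, fun {U H S L} hc hL => SlimOn.hyperbolicOn ⟨hc, ?_⟩⟩
  intro x hx y hy z hz m hm
  have close := hT hL hc
  obtain ⟨p, hp, hmp⟩ := hL.exists_near hc close hx hy hm
  obtain ⟨q, hq, hpq⟩ := hL.slim x hx y hy z hz p hp
  have hmq := hc.triangle hm.1 (hL.subset x hx y hy hp) q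
  rcases hq with hq | hq
  · obtain ⟨a, ha, had⟩ := close x hx z hz q hq
    have := hc.triangle hm.1 (hL.subset x hx z hz hq) a
    exact ⟨a, Or.inl ha, by omega⟩
  · obtain ⟨a, ha, had⟩ := close z hz y hy q hq
    have := hc.triangle hm.1 (hL.subset z hz y hy hq) a
    exact ⟨a, Or.inr ha, by omega⟩

end Guessing

/-! ## Entry points at a cone vertex -/

section Entry

variable {U : Type u} {H : SimpleGraph U} {S : Set U} {b x y m u v : U} {δ M R : ℕ}

/-- `u` is an entry point of `x` at `b`: the last vertex before `b` on a geodesic from `x` to `b`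
in the subgraph induced on `S`. -/
structure IsEntry (H : SimpleGraph U) (S : Set U) (b x u : U) : Prop where
  mem : u ∈ S
  adj : H.Adj u b
  dist_add_one : distOn H S x u + 1 = distOn H S x b

theorem ConnectedOn.exists_isEntry (hc : ConnectedOn H S) (hb : b ∈ S) (hx : x ∈ S \ {b}) :
    ∃ u, IsEntry H S b x u := by
  have hxb : distOn H S x b ≠ 0 := fun h => hx.2 (hc.eq_of_distOn_eq_zero hx.1 hb h)
  obtain ⟨u, hu, hxu, hub⟩ :=
    hc.exists_onGeodesic hx.1 hb (k := distOn H S x b - 1) (by omega)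
  exact ⟨u, hu, adj_of_distOn_eq_one (hub.trans (by omega)), by omega⟩

/-- A choice of an entry point of `x` at `b`, with the junk value `x` if there is none. -/
noncomputable def entry (H : SimpleGraph U) (S : Set U) (b x : U) : U :=
  open Classical in if h : ∃ u, IsEntry H S b x u then h.choose else x

theorem ConnectedOn.isEntry_entry (hc : ConnectedOn H S) (hb : b ∈ S) (hx : x ∈ S \ {b}) :
    IsEntry H S b x (entry H S b x) := by
  have h := hc.exists_isEntry hb hx
  rw [entry, dif_pos h]
  exact h.choose_spec

theorem IsEntry.mem_diff (h : IsEntry H S b x u) : u ∈ S \ {b} := ⟨h.mem, h.adj.ne⟩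

theorem IsEntry.distOn_diff_lt (h : IsEntry H S b x u) (hc : ConnectedOn H S) (hb : b ∈ S)
    (hx : x ∈ S) : distOn H (S \ {b}) x u < distOn H S x b := by
  have hbu := distOn_eq_one hb h.mem h.adj.symm
  have hxu := h.dist_add_one
  have := (hc.joinedWithin_diff_singleton hx h.mem (b := b) (by omega)).2
  omega

theorem IsEntry.exists_at_dist (h : IsEntry H S b x u) (hc : ConnectedOn H S) (hb : b ∈ S)
    (hx : x ∈ S) (hR : 0 < R) (hxR : R ≤ distOn H S x b) :
    ∃ p ∈ S \ {b}, distOn H S x p + R = distOn H S x b ∧ distOn H S p b = R ∧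
      distOn H (S \ {b}) p u < R := by
  have hxu := h.dist_add_one
  obtain ⟨p, hp, hxp, hpu⟩ := hc.exists_onGeodesic hx h.mem (k := distOn H S x b - R) (by omega)
  have hpb : distOn H S p b = R := by
    have := hc.triangle hp h.mem b
    have := hc.triangle hx hp b
    have := distOn_eq_one h.mem hb h.adj
    omega
  have hpE : IsEntry H S b p u := ⟨h.mem, h.adj, by omega⟩
  refine ⟨p, ⟨hp, ?_⟩, by omega, hpb, hpb ▸ hpE.distOn_diff_lt hc hb hp⟩
  rintro rfl
  exact hR.ne (by rw [← hpb, distOn_self])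

-- The hypothesis `hxy` says that the Gromov product of `x` and `y` at `b` is at least `R`, so the
-- points of the two geodesics at the distance `R` from `b` are close.
theorem HyperbolicOn.entry_close_of_product (h : HyperbolicOn H S δ) (hb : b ∈ S)
    (hc : ConnectedOn H (S \ {b})) (hx : x ∈ S) (hy : y ∈ S) (hR : δ < R)
    (hxy : 2 * R + distOn H S x y ≤ distOn H S x b + distOn H S y b)
    (hu : IsEntry H S b x u) (hv : IsEntry H S b y v) :
    distOn H (S \ {b}) u v ≤ 2 * R + 2 * δ := by
  have := h.conn.triangle hx hy b
  have := h.conn.triangle hy hx b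
  have hyx := distOn_comm (H := H) (S := S) y x
  obtain ⟨p, hp, hxp, hpb, hpu⟩ := hu.exists_at_dist h.conn hb hx (R := R) (by omega) (by omega)
  obtain ⟨q, hq, hyq, hqb, hqv⟩ := hv.exists_at_dist h.conn hb hy (R := R) (by omega) (by omega)
  have hpq : distOn H S p q ≤ 2 * δ := by
    have := h.four_point p hp.1 x hx y hy b hb
    have := h.four_point p hp.1 y hy q hq.1 b hb
    have := distOn_comm (H := H) (S := S) p x
    have := distOn_comm (H := H) (S := S) b q
    omega
  have hbq := distOn_comm (H := H) (S := S) b q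
  have := (h.conn.joinedWithin_diff_singleton hp.1 hq.1 (b := b) (by omega)).2
  have := hc.triangle hu.mem_diff hp v
  have := hc.triangle hp hq v
  have := distOn_comm (H := H) (S := S \ {b}) u p
  omega

-- If `x` is far from `m`, the point `y` at a bounded distance from `m` on the geodesic towards `x`
-- has a large Gromov product with `x` at `b`.
theorem HyperbolicOn.entry_close_of_near (h : HyperbolicOn H S δ) (hb : b ∈ S)
    (hc : ConnectedOn H (S \ {b})) (hx : x ∈ S \ {b}) (hm : m ∈ S \ {b})
    (hxm : distOn H (S \ {b}) x m ≤ distOn H S x m) (hM : distOn H S m b ≤ M)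
    (hu : IsEntry H S b x u) (hv : IsEntry H S b m v) :
    distOn H (S \ {b}) u v ≤ 6 * δ + 4 * M + 6 := by
  have hmv := hv.distOn_diff_lt h.conn hb hm.1
  by_cases hfar : distOn H S x m ≤ δ + 1 + M
  · have := hu.distOn_diff_lt h.conn hb hx.1
    have := h.conn.triangle hx.1 hm.1 b
    have := hc.triangle hu.mem_diff hx v
    have := hc.triangle hx hm v
    have := distOn_comm (H := H) (S := S \ {b}) u x
    omega
  have anti {a c} := hc.distOn_anti (x := a) (y := c) Set.sdiff_subset
  have := anti hx hm
  obtain ⟨y, hy, hxy, hym⟩ :=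
    hc.exists_onGeodesic hx hm (k := distOn H (S \ {b}) x m - (δ + 1 + M)) (by omega)
  obtain ⟨w, hw⟩ := h.conn.exists_isEntry hb hy
  have huw : distOn H (S \ {b}) u w ≤ 2 * (δ + 1) + 2 * δ := by
    refine h.entry_close_of_product hb hc hx.1 hy.1 (by omega) ?_ hu hw
    have := anti hx hy
    have := anti hy hm
    have := h.conn.triangle hx.1 hy.1 m
    have := h.conn.triangle hx.1 hb m
    have := h.conn.triangle hy.1 hb m
    have := distOn_comm (H := H) (S := S) b m
    omega
  have := hw.distOn_diff_lt h.conn hb hy.1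
  have := h.conn.triangle hy.1 hm.1 b
  have := anti hy hm
  have := hc.triangle hu.mem_diff hw.mem_diff v
  have := hc.triangle hw.mem_diff hy v
  have := hc.triangle hy hm v
  have := distOn_comm (H := H) (S := S \ {b}) w y
  omega

-- If the Gromov product of `x` and `y` at `b` is small, a geodesic between them passes close to
-- `b`.
theorem HyperbolicOn.entry_close (h : HyperbolicOn H S δ) (hb : b ∈ S)
    (hc : ConnectedOn H (S \ {b})) (hx : x ∈ S \ {b}) (hy : y ∈ S \ {b})
    (hxy : distOn H (S \ {b}) x y ≤ distOn H S x y)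
    (hu : IsEntry H S b x u) (hv : IsEntry H S b y v) :
    distOn H (S \ {b}) u v ≤ 36 * δ + 28 := by
  by_cases hprod : 2 * (δ + 1) + distOn H S x y ≤ distOn H S x b + distOn H S y b
  · exact (h.entry_close_of_product hb hc hx.1 hy.1 (by omega) hprod hu hv).trans (by omega)
  have anti {a c} := hc.distOn_anti (x := a) (y := c) Set.sdiff_subset
  obtain ⟨m, hm, hxm, hmy⟩ := hc.exists_onGeodesic hx hy
    (k := min (distOn H S x b) (distOn H (S \ {b}) x y)) (min_le_right _ _)
  have := anti hx hm
  have := anti hm hy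
  have := anti hx hy
  have := h.conn.triangle hx.1 hm.1 y
  have hmb : distOn H S m b ≤ 3 * δ + 2 := by
    have := h.four_point m hm.1 x hx.1 b hb y hy.1
    have := distOn_comm (H := H) (S := S) m x
    have := distOn_comm (H := H) (S := S) b y
    omega
  obtain ⟨w, hw⟩ := h.conn.exists_isEntry hb hm
  have huw := h.entry_close_of_near hb hc hx hm (by omega) hmb hu hw
  have hvw := h.entry_close_of_near hb hc hy hm
    (by rw [distOn_comm y m, distOn_comm y m]; omega) hmb hv hw
  have := hc.triangle hu.mem_diff hw.mem_diff v
  have := distOn_comm (H := H) (S := S \ {b}) w v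
  omega

end Entry

/-! ## Removing cone vertices -/

section Coned

variable {U : Type u} {H : SimpleGraph U} {S B : Set U} {C : U → Set U} {δ K : ℕ}

/-- The subgraph of `H` induced on `S` is hyperbolic and contains an independent set `B` of cone
vertices, the neighbours of `b ∈ B` lying in a hyperbolic subgraph `C b` that is quasi-isometrically
embedded in the complement of `b`. -/
structure IsConed (H : SimpleGraph U) (S B : Set U) (C : U → Set U) (δ K : ℕ) : Prop where
  hyperbolic : HyperbolicOn H S δ
  subset : B ⊆ S
  indep : ∀ b ∈ B, ∀ b' ∈ B, ¬ H.Adj b b'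
  conn : ConnectedOn H (S \ B)
  conn_diff : ∀ b ∈ B, ConnectedOn H (S \ {b})
  base_subset : ∀ b ∈ B, C b ⊆ S \ B
  mem_base : ∀ b ∈ B, ∀ u ∈ S, H.Adj u b → u ∈ C b
  base_hyperbolic : ∀ b ∈ B, HyperbolicOn H (C b) δ
  qi : ∀ b ∈ B, ∀ u ∈ C b, ∀ v ∈ C b, distOn H (C b) u v ≤ K * distOn H (S \ {b}) u v + K

/-- The distance in the base `C b` of a cone between entry points at `b` that
`HyperbolicOn.entry_close` leads to. -/
def entryBound (δ K : ℕ) : ℕ := K * (36 * δ + 28) + K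

theorem mem_diff_singleton_of_mem {b x : U} (hb : b ∈ B) (hx : x ∈ S \ B) : x ∈ S \ {b} :=
  ⟨hx.1, fun e => hx.2 (e ▸ hb)⟩

namespace IsConed

variable {b x y u v : U}

theorem base_conn (h : IsConed H S B C δ K) (hb : b ∈ B) : ConnectedOn H (C b) :=
  (h.base_hyperbolic b hb).conn

theorem entry_mem_base (h : IsConed H S B C δ K) (hb : b ∈ B) (hu : IsEntry H S b x u) : u ∈ C b :=
  h.mem_base b hb u hu.mem hu.adj

theorem distOn_le_base (h : IsConed H S B C δ K) (hb : b ∈ B) (hx : x ∈ C b) (hy : y ∈ C b) :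
    distOn H (S \ B) x y ≤ distOn H (C b) x y :=
  (h.base_conn hb).distOn_anti (h.base_subset b hb) hx hy

theorem isEntry (h : IsConed H S B C δ K) (hb : b ∈ B) (hx : x ∈ S \ B) :
    IsEntry H S b x (entry H S b x) :=
  h.hyperbolic.conn.isEntry_entry (h.subset hb) (mem_diff_singleton_of_mem hb hx)

theorem entry_mem (h : IsConed H S B C δ K) (hb : b ∈ B) (hx : x ∈ S \ B) : entry H S b x ∈ C b :=
  h.entry_mem_base hb (h.isEntry hb hx)

theorem entry_close (h : IsConed H S B C δ K) (hb : b ∈ B) (hx : x ∈ S \ B) (hy : y ∈ S \ B)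
    (hxy : distOn H (S \ {b}) x y ≤ distOn H S x y)
    (hu : IsEntry H S b x u) (hv : IsEntry H S b y v) : distOn H (C b) u v ≤ entryBound δ K :=
  (h.qi b hb u (h.entry_mem_base hb hu) v (h.entry_mem_base hb hv)).trans <|
    Nat.add_le_add_right (Nat.mul_le_mul_left K <|
      h.hyperbolic.entry_close (h.subset hb) (h.conn_diff b hb) (mem_diff_singleton_of_mem hb hx)
        (mem_diff_singleton_of_mem hb hy) hxy hu hv) K

theorem entry_close_self (h : IsConed H S B C δ K) (hb : b ∈ B) (hx : x ∈ S \ B)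
    (hu : IsEntry H S b x u) (hv : IsEntry H S b x v) : distOn H (C b) u v ≤ entryBound δ K :=
  h.entry_close hb hx hx (by rw [distOn_self, distOn_self]) hu hv

theorem entry_close_of_not_onGeodesic (h : IsConed H S B C δ K) (hb : b ∈ B) (hx : x ∈ S \ B)
    (hy : y ∈ S \ B) (hxy : ¬ OnGeodesic H S x b y)
    (hu : IsEntry H S b x u) (hv : IsEntry H S b y v) : distOn H (C b) u v ≤ entryBound δ K :=
  h.entry_close hb hx hy
    (h.hyperbolic.conn.joinedWithin_diff_singleton hx.1 hy.1 <|
      (h.hyperbolic.conn.triangle hx.1 (h.subset hb) y).lt_of_ne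
        fun e => hxy ⟨h.subset hb, e.symm⟩).2 hu hv

theorem entry_lipschitz (h : IsConed H S B C δ K) (hb : b ∈ B) (hx : x ∈ S \ B) (hy : y ∈ S \ B) :
    distOn H (C b) (entry H S b x) (entry H S b y) ≤ entryBound δ K * distOn H (S \ B) x y := by
  refine h.conn.le_mul_distOn (f := fun x y => distOn H (C b) (entry H S b x) (entry H S b y))
    (fun x _ => distOn_self _) ?_ ?_ hx hy
  · exact fun x hx y hy z _ => (h.base_conn hb).triangle (h.entry_mem hb hx) (h.entry_mem hb hy) _
  · intro x hx y hy hxy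
    refine h.entry_close hb hx hy ?_ (h.isEntry hb hx) (h.isEntry hb hy)
    rw [distOn_eq_one (mem_diff_singleton_of_mem hb hx) (mem_diff_singleton_of_mem hb hy) hxy,
      distOn_eq_one hx.1 hy.1 hxy]

/-- Outside of the cone vertices, `p` is within `r` of its entry point at some `b ∈ B`, at which
`p` and `q` have entry points at a distance greater than `M`. -/
def HasDistantEntries (H : SimpleGraph U) (S B : Set U) (C : U → Set U) (M r : ℕ) (p q : U) :
    Prop :=
  ∃ b ∈ B, M < distOn H (C b) (entry H S b p) (entry H S b q) ∧
    distOn H (S \ B) p (entry H S b p) ≤ r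

-- The next vertex of a geodesic from `p` to `q` outside of the cone vertices is at most two steps
-- away from `p`; two steps pass through a cone vertex from one entry point to another.
theorem exists_next_or_hasDistantEntries (h : IsConed H S B C δ K) (M : ℕ) {k : ℕ} {p q : U}
    (hp : p ∈ S \ B) (hq : q ∈ S \ B) (hne : distOn H S p q ≠ 0) (hk : distOn H S p q ≤ k + 1) :
    (∃ m ∈ S \ B, distOn H (S \ B) p m ≤ M + 2 * entryBound δ K + 1 ∧ distOn H S m q ≤ k) ∨
      HasDistantEntries H S B C M (entryBound δ K) p q := by
  have hc := h.hyperbolic.conn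
  obtain ⟨m, hm, hpm, hmq⟩ := hc.exists_onGeodesic hp.1 hq.1 (k := 1) (by omega)
  have hadj := adj_of_distOn_eq_one hpm
  by_cases hmB : m ∈ B
  · have hmq0 : distOn H S m q ≠ 0 := fun e =>
      hq.2 (hc.eq_of_distOn_eq_zero hm hq.1 e ▸ hmB)
    obtain ⟨w, hw, hmw, hwq⟩ := hc.exists_onGeodesic hm hq.1 (k := 1) (by omega)
    have hadj' := adj_of_distOn_eq_one hmw
    have ep : IsEntry H S m p p := ⟨hp.1, hadj, by rw [distOn_self, hpm]⟩
    have eq : IsEntry H S m q w := ⟨hw, hadj'.symm, by rw [distOn_comm q w, distOn_comm q m]; omega⟩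
    have hpp := h.entry_close_self hmB hp ep (h.isEntry hmB hp)
    have hqw := h.entry_close_self hmB hq (h.isEntry hmB hq) eq
    have hpC := h.entry_mem_base hmB ep
    by_cases hM : M < distOn H (C m) (entry H S m p) (entry H S m q)
    · exact Or.inr ⟨m, hmB, hM, (h.distOn_le_base hmB hpC (h.entry_mem hmB hp)).trans hpp⟩
    · refine Or.inl ⟨w, ⟨hw, fun e => h.indep m hmB w e hadj'⟩, ?_, by omega⟩
      have := h.distOn_le_base hmB hpC (h.entry_mem_base hmB eq)
      have := (h.base_conn hmB).triangle hpC (h.entry_mem hmB hp) w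
      have := (h.base_conn hmB).triangle (h.entry_mem hmB hp) (h.entry_mem hmB hq) w
      omega
  · exact Or.inl ⟨m, ⟨hm, hmB⟩, by rw [distOn_eq_one hp ⟨hm, hmB⟩ hadj]; omega, by omega⟩

theorem hasDistantEntries_of_near (h : IsConed H S B C δ K) {M r s : ℕ} {p m q : U}
    (hp : p ∈ S \ B) (hm : m ∈ S \ B) (hpm : distOn H (S \ B) p m ≤ s)
    (hmq : HasDistantEntries H S B C (M + entryBound δ K * s) r m q) :
    HasDistantEntries H S B C M (s + r + entryBound δ K * s) p q := by
  obtain ⟨b, hb, hM, hr⟩ := hmq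
  have hlip := (h.entry_lipschitz hb hp hm).trans (Nat.mul_le_mul_left _ hpm)
  refine ⟨b, hb, ?_, ?_⟩
  · have := (h.base_conn hb).triangle (h.entry_mem hb hm) (h.entry_mem hb hp) (entry H S b q)
    have := distOn_comm (H := H) (S := C b) (entry H S b m) (entry H S b p)
    omega
  · have := h.conn.triangle hp hm (entry H S b p)
    have := h.conn.triangle hm (h.base_subset b hb (h.entry_mem hb hm)) (entry H S b p)
    have := h.distOn_le_base hb (h.entry_mem hb hm) (h.entry_mem hb hp)
    have := distOn_comm (H := H) (S := C b) (entry H S b m) (entry H S b p)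
    omega

theorem exists_close_or_hasDistantEntries (δ K k : ℕ) : ∀ M, ∃ g, ∀ {U : Type u}
    {H : SimpleGraph U} {S B : Set U} {C : U → Set U}, IsConed H S B C δ K →
      ∀ p ∈ S \ B, ∀ q ∈ S \ B, distOn H S p q ≤ k →
        distOn H (S \ B) p q ≤ g ∨ HasDistantEntries H S B C M g p q := by
  induction k with
  | zero =>
    refine fun M => ⟨0, fun {U H S B C} h p hp q hq hd => Or.inl ?_⟩
    rw [h.hyperbolic.conn.eq_of_distOn_eq_zero hp.1 hq.1 (by omega), distOn_self]
  | succ k ih =>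
    intro M
    set E := entryBound δ K
    set s := M + 2 * E + 1
    obtain ⟨g, hg⟩ := ih (M + E * s)
    refine ⟨s + g + E * s, fun {U H S B C} h p hp q hq hd => ?_⟩
    by_cases hpq : distOn H S p q = 0
    · rw [h.hyperbolic.conn.eq_of_distOn_eq_zero hp.1 hq.1 hpq, distOn_self]
      exact Or.inl (Nat.zero_le _)
    rcases h.exists_next_or_hasDistantEntries M hp hq hpq hd with
      ⟨m, hm, hpm, hmq⟩ | ⟨b, hb, hM, hr⟩
    · refine (hg h m hm q hq hmq).imp (fun hclose => ?_) (h.hasDistantEntries_of_near hp hm hpm)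
      have := h.conn.triangle hp hm q
      omega
    · exact Or.inr ⟨b, hb, hM, by omega⟩

end IsConed

end Coned

section Decone

variable {U : Type u} {H : SimpleGraph U} {S B : Set U} {C : U → Set U} {δ K g : ℕ}
  {b p q u v x y z : U}

/-- The geodesics from `x` to `y` in the subgraph induced on `S`, with their passages through cone
vertices `b ∈ B` replaced by geodesics in the bases `C b` of the cones. -/
def deElectrified (H : SimpleGraph U) (S B : Set U) (C : U → Set U) (x y : U) : Set U :=
  {p | (p ∉ B ∧ OnGeodesic H S x p y) ∨ ∃ b ∈ B, OnGeodesic H S x b y ∧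
    ∃ u v, IsEntry H S b x u ∧ IsEntry H S b y v ∧ OnGeodesic H (C b) u p v}

theorem deElectrified_symm (h : p ∈ deElectrified H S B C x y) :
    p ∈ deElectrified H S B C y x := by
  rcases h with ⟨hpB, hp⟩ | ⟨b, hb, hxy, u, v, hu, hv, hp⟩
  · exact Or.inl ⟨hpB, hp.symm⟩
  · exact Or.inr ⟨b, hb, hxy.symm, v, u, hv, hu, hp.symm⟩

theorem IsEntry.onGeodesic (h : IsEntry H S b x u) (hb : b ∈ S) : OnGeodesic H S x u b :=
  ⟨h.mem, by rw [distOn_eq_one h.mem hb h.adj, h.dist_add_one]⟩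

namespace IsConed

theorem deElectrified_subset (h : IsConed H S B C δ K) (x y : U) :
    deElectrified H S B C x y ⊆ S \ B := by
  rintro p (⟨hpB, hp⟩ | ⟨b, hb, -, u, v, -, -, hp⟩)
  · exact ⟨hp.1, hpB⟩
  · exact h.base_subset b hb hp.1

theorem deElectrified_near (h : IsConed H S B C δ K) (hx : x ∈ S \ B) (hy : y ∈ S \ B)
    (hxy : distOn H (S \ B) x y ≤ 1) (hp : p ∈ deElectrified H S B C x y) :
    distOn H (S \ B) x p ≤ 1 := by
  have hc := h.hyperbolic.conn
  have hxyS := h.conn.distOn_anti Set.sdiff_subset hx hy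
  have eq_or_eq : ∀ q, OnGeodesic H S x q y → q = x ∨ q = y := by
    intro q hq
    have hsum := hq.2
    rcases Nat.eq_zero_or_pos (distOn H S x q) with hxq | hxq
    · exact Or.inl (hc.eq_of_distOn_eq_zero hx.1 hq.1 hxq).symm
    · exact Or.inr (hc.eq_of_distOn_eq_zero hq.1 hy.1 (by omega))
  rcases hp with ⟨-, hp⟩ | ⟨b, hb, hp, -⟩
  · rcases eq_or_eq p hp with rfl | rfl
    · simp only [distOn_self, zero_le]
    · exact hxy
  · rcases eq_or_eq b hp with rfl | rfl
    · exact absurd hb hx.2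
    · exact absurd hb hy.2

theorem reachable_entries (h : IsConed H S B C δ K) (hb : b ∈ B) (hxy : OnGeodesic H S x b y)
    (hu : IsEntry H S b x u) (hv : IsEntry H S b y v) :
    (H.induce (deElectrified H S B C x y)).spanningCoe.Reachable u v := by
  obtain ⟨η, hη⟩ := (h.base_conn hb).exists_isGeodesic (h.entry_mem_base hb hu)
    (h.entry_mem_base hb hv)
  exact (hη.joinedWithin fun i hi => Or.inr ⟨b, hb, hxy, u, v, hu, hv, hη.onGeodesic hi⟩).1

theorem reachable_deElectrified (h : IsConed H S B C δ K) (hx : x ∈ S \ B) (hy : y ∈ S \ B) :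
    (H.induce (deElectrified H S B C x y)).spanningCoe.Reachable x y := by
  obtain ⟨γ, hγ⟩ := h.hyperbolic.conn.exists_isGeodesic hx.1 hy.1
  suffices ∀ i ≤ distOn H S x y, γ i ∉ B →
      (H.induce (deElectrified H S B C x y)).spanningCoe.Reachable x (γ i) by
    simpa only [hγ.target] using this _ le_rfl (hγ.target.symm ▸ hy.2)
  intro i
  induction i using Nat.strong_induction_on with
  | _ i ih =>
  intro hi hiB
  match i with
  | 0 => exact hγ.source ▸ .rfl
  | i + 1 =>
    have hadj := hγ.adj hi
    by_cases hb : γ i ∈ B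
    · match i with
      | 0 => exact absurd (hγ.source ▸ hb) hx.2
      | j + 1 =>
        have hadj' := hγ.adj (i := j) (by omega)
        have hu : IsEntry H S (γ (j + 1)) x (γ j) :=
          ⟨hγ.mem j, hadj', by rw [hγ.dist_source (by omega), hγ.dist_source (by omega)]⟩
        have hv : IsEntry H S (γ (j + 1)) y (γ (j + 1 + 1)) := by
          refine ⟨hγ.mem _, hadj.symm, ?_⟩
          rw [distOn_comm y, distOn_comm y, hγ.dist_target hi, hγ.dist_target (by omega)]
          omega
        exact (ih j (by omega) (by omega) fun hj => h.indep _ hj _ hb hadj').trans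
          (h.reachable_entries hb (hγ.onGeodesic (by omega)) hu hv)
    · have hi' : γ i ∈ deElectrified H S B C x y := Or.inl ⟨hb, hγ.onGeodesic (by omega)⟩
      have hi'' : γ (i + 1) ∈ deElectrified H S B C x y := Or.inl ⟨hiB, hγ.onGeodesic hi⟩
      exact (ih i (by omega) (by omega) hb).trans
        (spanningCoe_induce_adj.2 ⟨hi', hi'', hadj⟩).reachable

theorem deElectrified_crosses (h : IsConed H S B C δ K) (hx : x ∈ S \ B) (hy : y ∈ S \ B)
    {A : Set U} (hxA : x ∈ A) (hyA : y ∉ A) :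
    ∃ p ∈ deElectrified H S B C x y, ∃ q ∈ deElectrified H S B C x y,
      p ∈ A ∧ q ∉ A ∧ distOn H (S \ B) p q ≤ 1 := by
  obtain ⟨w⟩ := h.reachable_deElectrified hx hy
  obtain ⟨d, -, hp, hq⟩ := w.exists_boundary_dart A hxA hyA
  obtain ⟨hpL, hqL, hadj⟩ := spanningCoe_induce_adj.1 d.adj
  exact ⟨d.fst, hpL, d.snd, hqL, hp, hq,
    (distOn_eq_one (h.deElectrified_subset x y hpL) (h.deElectrified_subset x y hqL) hadj).le⟩

theorem entry_near_endpoint (h : IsConed H S B C δ K) (hb : b ∈ B) (hx : x ∈ S \ B)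
    (hy : y ∈ S \ B) (hp : p ∈ S \ B) (hxy : OnGeodesic H S x p y) :
    distOn H (C b) (entry H S b x) (entry H S b p) ≤ entryBound δ K ∨
      distOn H (C b) (entry H S b y) (entry H S b p) ≤ entryBound δ K := by
  by_cases hxb : OnGeodesic H S x b p
  · refine Or.inr (h.entry_close_of_not_onGeodesic hb hy hp (fun hyb => ?_) (h.isEntry hb hy)
      (h.isEntry hb hp))
    have hbp : distOn H S b p = 0 := by
      have := hxb.2
      have := hyb.symm.2
      have := hxy.2
      have := h.hyperbolic.conn.triangle hx.1 hxb.1 y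
      have := distOn_comm (H := H) (S := S) b p
      omega
    exact hp.2 (h.hyperbolic.conn.eq_of_distOn_eq_zero hxb.1 hp.1 hbp ▸ hb)
  · exact Or.inl (h.entry_close_of_not_onGeodesic hb hx hp hxb (h.isEntry hb hx) (h.isEntry hb hp))

-- As `p` enters near `y` and `q` does not, `b` lies on a geodesic from `z` to `y` or on one from
-- `x` to `z`, and an endpoint of its base is close to the entry point of `p`.
theorem exists_entry_near (h : IsConed H S B C δ K) (hb : b ∈ B)
    (hx : x ∈ S \ B) (hy : y ∈ S \ B) (hz : z ∈ S \ B) (hp : p ∈ S \ B)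
    (hpb : distOn H (S \ B) p (entry H S b p) ≤ g)
    (hpy : distOn H (C b) (entry H S b p) (entry H S b y) ≤ entryBound δ K)
    (hpq : 4 * entryBound δ K < distOn H (C b) (entry H S b p) (entry H S b q))
    (hq : ∃ t ∈ ({x, y, z} : Set U),
      distOn H (C b) (entry H S b t) (entry H S b q) ≤ entryBound δ K) :
    ∃ r ∈ deElectrified H S B C x z ∪ deElectrified H S B C z y,
      distOn H (S \ B) p r ≤ g + 2 * entryBound δ K := by
  have hC := h.base_conn hb
  have mp := h.entry_mem hb hp
  have mx := h.entry_mem hb hx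
  have my := h.entry_mem hb hy
  have mz := h.entry_mem hb hz
  have hpr (r : U) := h.conn.triangle hp (h.base_subset b hb mp) r
  by_cases hzy : OnGeodesic H S z b y
  · refine ⟨entry H S b y, Or.inr (Or.inr ⟨b, hb, hzy, _, _, h.isEntry hb hz, h.isEntry hb hy,
      .right _ my⟩), ?_⟩
    have := hpr (entry H S b y)
    have := h.distOn_le_base hb mp my
    omega
  · have hyz := h.entry_close_of_not_onGeodesic hb hy hz (fun e => hzy e.symm) (h.isEntry hb hy)
      (h.isEntry hb hz)
    have hpz := hC.triangle mp my (entry H S b z)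
    have hxz : OnGeodesic H S x b z := by
      by_contra hxz
      have hzx := h.entry_close_of_not_onGeodesic hb hz hx (fun e => hxz e.symm) (h.isEntry hb hz)
        (h.isEntry hb hx)
      have := hC.triangle mp mz (entry H S b x)
      obtain ⟨t, rfl | rfl | rfl, ht⟩ := hq
      · have := hC.triangle mp mx (entry H S b q)
        omega
      · have := hC.triangle mp my (entry H S b q)
        omega
      · have := hC.triangle mp mz (entry H S b q)
        omega
    refine ⟨entry H S b z, Or.inl (Or.inr ⟨b, hb, hxz, _, _, h.isEntry hb hx, h.isEntry hb hz,
      .right _ mz⟩), ?_⟩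
    have := hpr (entry H S b z)
    have := h.distOn_le_base hb mp mz
    omega

theorem exists_notMem_near (h : IsConed H S B C δ K) (hx : x ∈ S \ B)
    (hq : OnGeodesic H S x q z) : ∃ q' ∉ B, OnGeodesic H S x q' z ∧ distOn H S q q' ≤ 1 := by
  by_cases hqB : q ∈ B
  · have hu := h.isEntry hqB hx
    exact ⟨_, fun huB => h.indep _ huB _ hqB hu.adj,
      hq.trans_left h.hyperbolic.conn hx.1 (hu.onGeodesic hq.1),
      (distOn_eq_one hq.1 hu.mem hu.adj.symm).le⟩
  · exact ⟨q, hqB, hq, by simp only [distOn_self, zero_le]⟩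

theorem exists_near_other_side (h : IsConed H S B C δ K) (hx : x ∈ S \ B) (hy : y ∈ S \ B)
    (hz : z ∈ S \ B) (hp : OnGeodesic H S x p y) :
    ∃ q ∈ S \ B, (OnGeodesic H S x q z ∨ OnGeodesic H S z q y) ∧ distOn H S p q ≤ 2 * δ + 1 := by
  obtain ⟨q, hq, hpq⟩ := h.hyperbolic.slimOn.slim x hx.1 y hy.1 z hz.1 p hp
  rcases hq with hq | hq
  · obtain ⟨q', hq'B, hq', hqq'⟩ := h.exists_notMem_near hx hq
    have := h.hyperbolic.conn.triangle hp.1 hq.1 q'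
    exact ⟨q', ⟨hq'.1, hq'B⟩, Or.inl hq', by omega⟩
  · obtain ⟨q', hq'B, hq', hqq'⟩ := h.exists_notMem_near hz hq
    have := h.hyperbolic.conn.triangle hp.1 hq.1 q'
    exact ⟨q', ⟨hq'.1, hq'B⟩, Or.inr hq', by omega⟩

theorem base_near_other_side (h : IsConed H S B C δ K) (hb : b ∈ B) (hx : x ∈ S \ B)
    (hy : y ∈ S \ B) (hz : z ∈ S \ B) (hu : IsEntry H S b x u) (hv : IsEntry H S b y v)
    (hp : OnGeodesic H (C b) u p v) :
    (∃ q ∈ deElectrified H S B C x z ∪ deElectrified H S B C z y,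
      distOn H (S \ B) p q ≤ 2 * δ) ∨
    ∃ w, (IsEntry H S b x w ∨ IsEntry H S b y w) ∧
      distOn H (C b) p w ≤ 2 * δ + entryBound δ K := by
  have hC := h.base_conn hb
  have hw := h.isEntry hb hz
  obtain ⟨q, hq, hpq⟩ := (h.base_hyperbolic b hb).slimOn.slim u (h.entry_mem_base hb hu) v
    (h.entry_mem_base hb hv) _ (h.entry_mem hb hz) p hp
  rcases hq with hq | hq
  · by_cases hxz : OnGeodesic H S x b z
    · exact Or.inl ⟨q, Or.inl (Or.inr ⟨b, hb, hxz, _, _, hu, hw, hq⟩),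
        (h.distOn_le_base hb hp.1 hq.1).trans hpq⟩
    · have := h.entry_close_of_not_onGeodesic hb hx hz hxz hu hw
      have := hC.triangle hp.1 hq.1 u
      have := hq.symm.2
      have := distOn_comm (H := H) (S := C b) u (entry H S b z)
      exact Or.inr ⟨u, Or.inl hu, by omega⟩
  · by_cases hzy : OnGeodesic H S z b y
    · exact Or.inl ⟨q, Or.inr (Or.inr ⟨b, hb, hzy, _, _, hw, hv, hq⟩),
        (h.distOn_le_base hb hp.1 hq.1).trans hpq⟩
    · have := h.entry_close_of_not_onGeodesic hb hz hy hzy hw hv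
      have := hC.triangle hp.1 hq.1 v
      have := hq.2
      exact Or.inr ⟨v, Or.inr hv, by omega⟩

end IsConed

theorem exists_onGeodesic_slim (δ K : ℕ) : ∃ g, ∀ {U : Type u} {H : SimpleGraph U} {S B : Set U}
    {C : U → Set U}, IsConed H S B C δ K → ∀ x ∈ S \ B, ∀ y ∈ S \ B, ∀ z ∈ S \ B,
      ∀ p ∉ B, OnGeodesic H S x p y →
        ∃ q ∈ deElectrified H S B C x z ∪ deElectrified H S B C z y,
          distOn H (S \ B) p q ≤ g := by
  set E := entryBound δ K
  obtain ⟨g, hg⟩ := IsConed.exists_close_or_hasDistantEntries δ K (2 * δ + 1) (4 * E)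
  refine ⟨g + 2 * E, fun {U H S B C} h x hx y hy z hz p hpB hp => ?_⟩
  have hpS : p ∈ S \ B := ⟨hp.1, hpB⟩
  obtain ⟨q, hqS, hq, hpq⟩ := h.exists_near_other_side hx hy hz hp
  rcases hg h p hpS q hqS hpq with hclose | ⟨b, hb, hfar, hpb⟩
  · exact ⟨q, hq.imp (fun e => Or.inl ⟨hqS.2, e⟩) (fun e => Or.inl ⟨hqS.2, e⟩), by omega⟩
  have hq_near : ∃ t ∈ ({x, y, z} : Set U),
      distOn H (C b) (entry H S b t) (entry H S b q) ≤ E := by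
    rcases hq with hq | hq
    · rcases h.entry_near_endpoint hb hx hz hqS hq with e | e
      exacts [⟨x, by simp, e⟩, ⟨z, by simp, e⟩]
    · rcases h.entry_near_endpoint hb hz hy hqS hq with e | e
      exacts [⟨z, by simp, e⟩, ⟨y, by simp, e⟩]
  rcases h.entry_near_endpoint hb hx hy hpS hp with hpx | hpy
  · rw [distOn_comm] at hpx
    obtain ⟨r, hr, hpr⟩ := h.exists_entry_near hb hy hx hz hpS hpb hpx hfar
      (Set.insert_comm x y {z} ▸ hq_near)
    exact ⟨r, hr.symm.imp deElectrified_symm deElectrified_symm, hpr⟩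
  · rw [distOn_comm] at hpy
    exact h.exists_entry_near hb hx hy hz hpS hpb hpy hfar hq_near

theorem exists_deElectrified_slim (δ K : ℕ) : ∃ h, ∀ {U : Type u} {H : SimpleGraph U} {S B : Set U}
    {C : U → Set U}, IsConed H S B C δ K → ∀ x ∈ S \ B, ∀ y ∈ S \ B, ∀ z ∈ S \ B,
      ∀ p ∈ deElectrified H S B C x y,
        ∃ q ∈ deElectrified H S B C x z ∪ deElectrified H S B C z y,
          distOn H (S \ B) p q ≤ h := by
  obtain ⟨g, hg⟩ := exists_onGeodesic_slim δ K
  refine ⟨2 * δ + entryBound δ K + g, fun {U H S B C} h x hx y hy z hz p hp => ?_⟩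
  rcases hp with ⟨hpB, hp⟩ | ⟨b, hb, hxy, u, v, hu, hv, hp⟩
  · obtain ⟨q, hq, hpq⟩ := hg h x hx y hy z hz p hpB hp
    exact ⟨q, hq, by omega⟩
  rcases h.base_near_other_side hb hx hy hz hu hv hp with ⟨q, hq, hpq⟩ | ⟨w, hw, hpw⟩
  · exact ⟨q, hq, by omega⟩
  have hwC : w ∈ C b := hw.elim (h.entry_mem_base hb) (h.entry_mem_base hb)
  have hwS := h.base_subset b hb hwC
  have hwxy : OnGeodesic H S x w y := by
    rcases hw with hw | hw
    · exact hxy.trans_left h.hyperbolic.conn hx.1 (hw.onGeodesic hxy.1)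
    · exact (hxy.symm.trans_left h.hyperbolic.conn hy.1 (hw.onGeodesic hxy.1)).symm
  obtain ⟨q, hq, hwq⟩ := hg h x hx y hy z hz w hwS.2 hwxy
  have := h.conn.triangle (h.base_subset b hb hp.1) hwS q
  have := h.distOn_le_base hb hp.1 hwC
  exact ⟨q, hq, by omega⟩

theorem exists_hyperbolicOn_of_isConed (δ K : ℕ) : ∃ δ', ∀ {U : Type u} {H : SimpleGraph U}
    {S B : Set U} {C : U → Set U}, IsConed H S B C δ K → HyperbolicOn H (S \ B) δ' := by
  obtain ⟨h, hslim⟩ := exists_deElectrified_slim.{u} δ K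
  obtain ⟨δ', hδ'⟩ := exists_hyperbolicOn_of_guessesGeodesics.{u} (h + 1)
  refine ⟨δ', fun {U H S B C} hC => hδ' (L := deElectrified H S B C) hC.conn
    { subset := fun x _ y _ => hC.deElectrified_subset x y
      right_mem := fun x _ y hy => Or.inl ⟨hy.2, .right x hy.1⟩
      slim := fun x hx y hy z hz p hp => ?_
      near := fun x hx y hy hxy p hp => (hC.deElectrified_near hx hy hxy hp).trans (by omega)
      crosses := fun x hx y hy A => hC.deElectrified_crosses hx hy }⟩
  obtain ⟨q, hq, hpq⟩ := hslim hC x hx y hy z hz p hp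
  exact ⟨q, hq, by omega⟩

end Decone

/-! ## Realizations of graphs -/

section Realization

variable {U : Type u} {H : SimpleGraph U} {S T : Set U} {p q r : U → ℝ} {a c u v : U}

theorem vertexPoint_self (u : U) : vertexPoint u u = 1 := by
  classical exact Pi.single_eq_same u 1

theorem vertexPoint_of_ne (h : a ≠ u) : vertexPoint u a = 0 := by
  classical exact Pi.single_eq_of_ne h 1

theorem vertexPoint_self_ne_zero (u : U) : vertexPoint u u ≠ 0 :=
  (vertexPoint_self u).trans_ne one_ne_zero

theorem eq_of_vertexPoint_ne_zero (h : vertexPoint u a ≠ 0) : a = u :=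
  not_imp_comm.1 vertexPoint_of_ne h

theorem vertexPoint_nonneg (u a : U) : 0 ≤ vertexPoint u a := by
  by_cases h : a = u
  · exact h ▸ (vertexPoint_self a).ge.trans' zero_le_one
  · exact (vertexPoint_of_ne h).ge

theorem vertexPoint_mem (hu : u ∈ S) : vertexPoint u ∈ realization H S :=
  ⟨u, hu, u, hu, Or.inl rfl, 0, Set.left_mem_Icc.2 zero_le_one, by
    rw [sub_zero, one_smul, zero_smul, add_zero]⟩

theorem realization_mono (h : S ⊆ T) : realization H S ⊆ realization H T := by
  rintro p ⟨u, hu, v, hv, huv⟩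
  exact ⟨u, h hu, v, h hv, huv⟩

/-- `p` consists of the barycentric coordinates of a point of the closed edge with the endpoints `u`
and `v`, or of the vertex `u = v`. -/
structure LiesOnEdge (H : SimpleGraph U) (S : Set U) (p : U → ℝ) (u v : U) : Prop where
  left_mem : u ∈ S
  right_mem : v ∈ S
  eq_or_adj : u = v ∨ H.Adj u v
  nonneg : ∀ a, 0 ≤ p a
  eq_or_eq : ∀ a, p a ≠ 0 → a = u ∨ a = v
  eq_one : u = v → p u = 1
  add_eq_one : u ≠ v → p u + p v = 1

theorem exists_liesOnEdge (hp : p ∈ realization H S) : ∃ u v, LiesOnEdge H S p u v := by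
  obtain ⟨u, hu, v, hv, huv, t, ⟨ht0, ht1⟩, rfl⟩ := hp
  have hval (a : U) : ((1 - t) • vertexPoint u + t • vertexPoint v) a =
    (1 - t) * vertexPoint u a + t * vertexPoint v a := rfl
  refine ⟨u, v, hu, hv, huv, fun a => ?_, fun a ha => ?_, ?_, fun hne => ?_⟩
  · exact add_nonneg (mul_nonneg (by linarith) (vertexPoint_nonneg u a))
      (mul_nonneg ht0 (vertexPoint_nonneg v a))
  · by_contra! hne
    rw [hval, vertexPoint_of_ne hne.1, vertexPoint_of_ne hne.2] at ha
    exact ha (by ring)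
  · rintro rfl
    rw [hval, vertexPoint_self]
    ring
  · rw [hval, hval, vertexPoint_self, vertexPoint_self, vertexPoint_of_ne hne,
      vertexPoint_of_ne hne.symm]
    ring

theorem coord_nonneg (hp : p ∈ realization H S) (a : U) : 0 ≤ p a := by
  obtain ⟨u, v, h⟩ := exists_liesOnEdge hp
  exact h.nonneg a

theorem coord_le_one (hp : p ∈ realization H S) (a : U) : p a ≤ 1 := by
  obtain ⟨u, v, h⟩ := exists_liesOnEdge hp
  have hu := h.nonneg u
  have hv := h.nonneg v
  by_cases huv : u = v
  · grind [h.eq_one huv, h.eq_or_eq a]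
  · grind [h.add_eq_one huv, h.eq_or_eq a]

theorem coord_add_eq_one (hp : p ∈ realization H S) (ha : p a ≠ 0) (hc : p c ≠ 0) (hac : a ≠ c) :
    p a + p c = 1 := by
  obtain ⟨u, v, h⟩ := exists_liesOnEdge hp
  rcases h.eq_or_eq a ha with rfl | rfl <;> rcases h.eq_or_eq c hc with rfl | rfl
  exacts [absurd rfl hac, h.add_eq_one hac, add_comm (p a) _ ▸ h.add_eq_one hac.symm,
    absurd rfl hac]

theorem coord_add_le_one (hp : p ∈ realization H S) (hac : a ≠ c) : p a + p c ≤ 1 := by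
  by_cases ha : p a = 0
  · rw [ha, zero_add]
    exact coord_le_one hp c
  by_cases hc : p c = 0
  · rw [hc, add_zero]
    exact coord_le_one hp a
  exact (coord_add_eq_one hp ha hc hac).le

theorem exists_coord_ne_zero (hp : p ∈ realization H S) : ∃ a, p a ≠ 0 := by
  obtain ⟨u, v, h⟩ := exists_liesOnEdge hp
  by_contra! h0
  by_cases huv : u = v
  · grind [h.eq_one huv]
  · grind [h.add_eq_one huv]

theorem mem_of_coord_ne_zero (hp : p ∈ realization H S) (ha : p a ≠ 0) : a ∈ S := by
  obtain ⟨u, v, h⟩ := exists_liesOnEdge hp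
  rcases h.eq_or_eq a ha with rfl | rfl
  exacts [h.left_mem, h.right_mem]

theorem coord_eq_or_adj (hp : p ∈ realization H S) (ha : p a ≠ 0) (hc : p c ≠ 0) :
    a = c ∨ H.Adj a c := by
  obtain ⟨u, v, h⟩ := exists_liesOnEdge hp
  grind [h.eq_or_adj, h.eq_or_eq a ha, h.eq_or_eq c hc, SimpleGraph.adj_comm]

theorem coord_eq_one_or (hp : p ∈ realization H S) (ha : p a ≠ 0) :
    p a = 1 ∨ ∃ c, c ≠ a ∧ p c ≠ 0 := by
  obtain ⟨u, v, h⟩ := exists_liesOnEdge hp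
  by_contra! h0
  by_cases huv : u = v
  · grind [h.eq_one huv, h.eq_or_eq a ha]
  · grind [h.add_eq_one huv, h.eq_or_eq a ha]

theorem eq_vertexPoint_of_coord_eq_one (hp : p ∈ realization H S) (ha : p a = 1) :
    p = vertexPoint a := by
  funext c
  by_cases hc : c = a
  · rw [hc, ha, vertexPoint_self]
  · rw [vertexPoint_of_ne hc]
    linarith [coord_nonneg hp c, coord_add_le_one hp hc]

theorem mem_realization_of_coord_ne_zero (hp : p ∈ realization H S) (h : ∀ a, p a ≠ 0 → a ∈ T) :
    p ∈ realization H T := by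
  obtain ⟨u, -, v, -, huv, t, ht, rfl⟩ := hp
  have hval (a : U) : ((1 - t) • vertexPoint u + t • vertexPoint v) a =
    (1 - t) * vertexPoint u a + t * vertexPoint v a := rfl
  rcases eq_or_ne u v with rfl | hne
  · rw [← add_smul, sub_add_cancel, one_smul] at h ⊢
    exact vertexPoint_mem (h u (vertexPoint_self_ne_zero u))
  simp only [hval] at h
  have hu := h u
  have hv := h v
  rw [vertexPoint_self, vertexPoint_of_ne hne, mul_one, mul_zero, add_zero] at hu
  rw [vertexPoint_self, vertexPoint_of_ne hne.symm, mul_one, mul_zero, zero_add] at hv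
  rcases eq_or_ne t 0 with rfl | ht0
  · rw [sub_zero, one_smul, zero_smul, add_zero]
    exact vertexPoint_mem (hu (by norm_num))
  rcases eq_or_ne t 1 with rfl | ht1
  · rw [sub_self, one_smul, zero_smul, zero_add]
    exact vertexPoint_mem (hv ht0)
  exact ⟨u, hu (sub_ne_zero.2 ht1.symm), v, hv ht0, huv, t, ht, rfl⟩

/-- `p` and `q` lie on a common closed edge of `H`. -/
def CommonEdge (H : SimpleGraph U) (p q : U → ℝ) : Prop :=
  ∃ u v, (u = v ∨ H.Adj u v) ∧ Function.support p ⊆ {u, v} ∧ Function.support q ⊆ {u, v}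

theorem CommonEdge.symm (h : CommonEdge H p q) : CommonEdge H q p := by
  obtain ⟨u, v, huv, hp, hq⟩ := h
  exact ⟨u, v, huv, hq, hp⟩

theorem CommonEdge.eq_or_adj (h : CommonEdge H p q) (ha : p a ≠ 0) (hc : q c ≠ 0) :
    a = c ∨ H.Adj a c := by
  obtain ⟨u, v, huv, hp, hq⟩ := h
  have hau : a = u ∨ a = v := hp ha
  have hcu : c = u ∨ c = v := hq hc
  grind [SimpleGraph.adj_comm]

theorem CommonEdge.eq_or_eq (h : CommonEdge H p q) (hu : q u ≠ 0) (hv : q v ≠ 0) (huv : u ≠ v)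
    (ha : p a ≠ 0) : a = u ∨ a = v := by
  obtain ⟨u', v', -, hp, hq⟩ := h
  have hau : a = u' ∨ a = v' := hp ha
  have huu : u = u' ∨ u = v' := hq hu
  have hvu : v = u' ∨ v = v' := hq hv
  grind

theorem commonEdge_self (hp : p ∈ realization H S) : CommonEdge H p p := by
  obtain ⟨u, v, h⟩ := exists_liesOnEdge hp
  exact ⟨u, v, h.eq_or_adj, h.eq_or_eq, h.eq_or_eq⟩

theorem realizationDist_of_commonEdge (h : CommonEdge H p q) :
    realizationDist H S p q = ⨆ u, |p u - q u| := if_pos h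

theorem abs_coord_sub_le_one (hp : p ∈ realization H S) (hq : q ∈ realization H T) (a : U) :
    |p a - q a| ≤ 1 :=
  abs_sub_le_of_nonneg_of_le (coord_nonneg hp a) (coord_le_one hp a) (coord_nonneg hq a)
    (coord_le_one hq a)

theorem abs_coord_sub_le_iSup (hp : p ∈ realization H S) (hq : q ∈ realization H T) (a : U) :
    |p a - q a| ≤ ⨆ u, |p u - q u| :=
  le_ciSup (f := fun u => |p u - q u|)
    ⟨1, Set.forall_mem_range.2 (abs_coord_sub_le_one hp hq)⟩ a

theorem realizationDist_eq_or (hp : p ∈ realization H S) (hq : q ∈ realization H S) :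
    (CommonEdge H p q ∧ realizationDist H S p q = ⨆ u, |p u - q u|) ∨
    ∃ a c, p a ≠ 0 ∧ q c ≠ 0 ∧
      realizationDist H S p q = (1 - p a) + (distOn H S a c : ℝ) + (1 - q c) := by
  by_cases h : CommonEdge H p q
  · exact Or.inl ⟨h, realizationDist_of_commonEdge h⟩
  have finite_support {p : U → ℝ} (hp : p ∈ realization H S) : Finite (Function.support p) := by
    obtain ⟨u, v, h⟩ := exists_liesOnEdge hp
    exact (Set.toFinite {u, v}).subset h.eq_or_eq
  have := finite_support hp
  have := finite_support hq
  have : Nonempty (Function.support p) := nonempty_subtype.2 (exists_coord_ne_zero hp)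
  have : Nonempty (Function.support q) := nonempty_subtype.2 (exists_coord_ne_zero hq)
  obtain ⟨⟨a, c⟩, hac⟩ := exists_eq_ciInf_of_finite
    (f := fun a : Function.support p × Function.support q =>
      (1 - p a.1) + (distOn H S a.1 a.2 : ℝ) + (1 - q a.2))
  exact Or.inr ⟨a, c, a.2, c.2, (if_neg h).trans hac.symm⟩

theorem realizationDist_le (hS : ConnectedOn H S) (hp : p ∈ realization H S)
    (hq : q ∈ realization H S) (ha : p a ≠ 0) (hc : q c ≠ 0) :
    realizationDist H S p q ≤ (1 - p a) + (distOn H S a c : ℝ) + (1 - q c) := by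
  by_cases h : CommonEdge H p q
  · rw [realizationDist_of_commonEdge h]
    have : Nonempty U := ⟨a⟩
    refine ciSup_le fun x => ?_
    by_cases hac : a = c
    · subst hac
      rw [distOn_self, Nat.cast_zero, abs_sub_le_iff]
      rcases eq_or_ne x a with rfl | hx
      · constructor <;> linarith [coord_le_one hp x, coord_le_one hq x]
      · constructor <;> linarith [coord_add_le_one hp hx, coord_add_le_one hq hx,
          coord_nonneg hp x, coord_nonneg hq x, coord_le_one hp a, coord_le_one hq a]
    · have hdist : (1 : ℝ) ≤ distOn H S a c := by
        exact_mod_cast Nat.one_le_iff_ne_zero.2 fun h0 => hac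
          (hS.eq_of_distOn_eq_zero (mem_of_coord_ne_zero hp ha) (mem_of_coord_ne_zero hq hc) h0)
      linarith [abs_coord_sub_le_one hp hq x, coord_le_one hp a, coord_le_one hq c]
  · have bddBelow : BddBelow (Set.range fun a : Function.support p × Function.support q =>
        (1 - p a.1) + (distOn H S a.1 a.2 : ℝ) + (1 - q a.2)) := by
      refine ⟨0, Set.forall_mem_range.2 fun a => ?_⟩
      linarith [coord_le_one hp a.1, coord_le_one hq a.2,
        Nat.cast_nonneg (α := ℝ) (distOn H S a.1 a.2)]
    exact (if_neg h).trans_le (ciInf_le bddBelow (⟨a, ha⟩, ⟨c, hc⟩))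

theorem exists_add_distOn_le_of_commonEdge (hp : p ∈ realization H S) (hq : q ∈ realization H S)
    (h : CommonEdge H p q) (hc : q c ≠ 0) :
    ∃ a, p a ≠ 0 ∧ (1 - p a) + (distOn H S a c : ℝ) ≤ realizationDist H S p q + (1 - q c) := by
  rw [realizationDist_of_commonEdge h]
  have hsup := (abs_sub_le_iff.1 (abs_coord_sub_le_iSup hp hq c)).2
  by_cases hpc : p c = 0
  · obtain ⟨a, ha⟩ := exists_coord_ne_zero hp
    have hac : a ≠ c := fun hac => ha (hac ▸ hpc)
    have hpa : p a = 1 := by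
      rcases coord_eq_one_or hp ha with hpa | ⟨d, hda, hd⟩
      · exact hpa
      rcases h.symm.eq_or_eq ha hd hda.symm hc with rfl | rfl
      exacts [absurd rfl hac, absurd hpc hd]
    have hdist : (distOn H S a c : ℝ) ≤ 1 := by
      exact_mod_cast distOn_le_one (mem_of_coord_ne_zero hp ha) (mem_of_coord_ne_zero hq hc)
        (h.eq_or_adj ha hc)
    exact ⟨a, ha, by linarith⟩
  · refine ⟨c, hpc, ?_⟩
    rw [distOn_self, Nat.cast_zero]
    linarith

-- If the shortest path from `p` enters `q` through `c' ≠ c`, then `q c + q c' = 1`, so that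
-- entering through `c` instead costs at most `2 * (1 - q c)`.
theorem exists_add_distOn_le (hS : ConnectedOn H S) (hp : p ∈ realization H S)
    (hq : q ∈ realization H S) (hc : q c ≠ 0) :
    ∃ a, p a ≠ 0 ∧ (1 - p a) + (distOn H S a c : ℝ) ≤ realizationDist H S p q + (1 - q c) := by
  rcases realizationDist_eq_or hp hq with ⟨h, -⟩ | ⟨a, c', ha, hc', hdist⟩
  · exact exists_add_distOn_le_of_commonEdge hp hq h hc
  refine ⟨a, ha, ?_⟩
  rw [hdist]
  rcases eq_or_ne c c' with rfl | hcc
  · linarith [coord_le_one hq c]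
  · have hmem := mem_of_coord_ne_zero hq hc
    have hmem' := mem_of_coord_ne_zero hq hc'
    have htri : (distOn H S a c : ℝ) ≤ distOn H S a c' + 1 := by
      exact_mod_cast (hS.triangle (mem_of_coord_ne_zero hp ha) hmem' c).trans
        (Nat.add_le_add_left (distOn_le_one hmem' hmem (coord_eq_or_adj hq hc' hc)) _)
    linarith [coord_add_eq_one hq hc hc' hcc]

theorem realizationDist_nonneg (hp : p ∈ realization H S) (hq : q ∈ realization H S) :
    0 ≤ realizationDist H S p q := by
  rcases realizationDist_eq_or hp hq with ⟨-, h⟩ | ⟨a, c, -, -, h⟩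
  · obtain ⟨a, -⟩ := exists_coord_ne_zero hp
    exact h ▸ (abs_nonneg _).trans (abs_coord_sub_le_iSup hp hq a)
  · linarith [coord_le_one hp a, coord_le_one hq c, Nat.cast_nonneg (α := ℝ) (distOn H S a c)]

theorem realizationDist_comm (hp : p ∈ realization H S) (hq : q ∈ realization H S)
    (hS : ConnectedOn H S) : realizationDist H S p q = realizationDist H S q p := by
  by_cases h : CommonEdge H p q
  · rw [realizationDist_of_commonEdge h, realizationDist_of_commonEdge h.symm]
    simp only [abs_sub_comm]
  have le {p q : U → ℝ} (hp : p ∈ realization H S) (hq : q ∈ realization H S)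
      (h : ¬ CommonEdge H p q) : realizationDist H S q p ≤ realizationDist H S p q := by
    obtain ⟨hpq, -⟩ | ⟨a, c, ha, hc, hdist⟩ := realizationDist_eq_or hp hq
    · exact absurd hpq h
    have hle := realizationDist_le hS hq hp hc ha
    rw [distOn_comm] at hle
    linarith
  exact (le hq hp (h ∘ CommonEdge.symm)).antisymm (le hp hq h)

theorem realizationDist_triangle_of_commonEdge (hS : ConnectedOn H S) (hp : p ∈ realization H S)
    (hq : q ∈ realization H S) (hr : r ∈ realization H S) (hpq : CommonEdge H p q)
    (hqr : CommonEdge H q r) :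
    realizationDist H S p r ≤ realizationDist H S p q + realizationDist H S q r := by
  obtain ⟨c, hc⟩ := exists_coord_ne_zero hq
  rcases coord_eq_one_or hq hc with hqc | ⟨d, hdc, hd⟩
  · obtain ⟨a, ha, hac⟩ := exists_add_distOn_le hS hp hq hc
    obtain ⟨e, he, hec⟩ := exists_add_distOn_le hS hr hq hc
    have htri : (distOn H S a e : ℝ) ≤ distOn H S a c + distOn H S e c := by
      exact_mod_cast distOn_comm (H := H) (S := S) e c ▸
        hS.triangle (mem_of_coord_ne_zero hp ha) (mem_of_coord_ne_zero hq hc) e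
    linarith [realizationDist_le hS hp hr ha he, realizationDist_comm hr hq hS]
  · have hpr : CommonEdge H p r := ⟨c, d, coord_eq_or_adj hq hc hd,
      fun _ => hpq.eq_or_eq hc hd hdc.symm, fun _ => hqr.symm.eq_or_eq hc hd hdc.symm⟩
    rw [realizationDist_of_commonEdge hpq, realizationDist_of_commonEdge hqr,
      realizationDist_of_commonEdge hpr]
    have : Nonempty U := ⟨c⟩
    exact ciSup_le fun x => (abs_sub_le _ (q x) _).trans
      (add_le_add (abs_coord_sub_le_iSup hp hq x) (abs_coord_sub_le_iSup hq hr x))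

theorem realizationDist_triangle_of_not_commonEdge (hS : ConnectedOn H S)
    (hp : p ∈ realization H S) (hq : q ∈ realization H S) (hr : r ∈ realization H S)
    (hqr : ¬ CommonEdge H q r) :
    realizationDist H S p r ≤ realizationDist H S p q + realizationDist H S q r := by
  obtain ⟨h, -⟩ | ⟨c, e, hc, he, hdist⟩ := realizationDist_eq_or hq hr
  · exact absurd h hqr
  obtain ⟨a, ha, hac⟩ := exists_add_distOn_le hS hp hq hc
  have htri : (distOn H S a e : ℝ) ≤ distOn H S a c + distOn H S c e := by
    exact_mod_cast hS.triangle (mem_of_coord_ne_zero hp ha) (mem_of_coord_ne_zero hq hc) e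
  linarith [realizationDist_le hS hp hr ha he]

theorem realizationDist_triangle (hS : ConnectedOn H S) (hp : p ∈ realization H S)
    (hq : q ∈ realization H S) (hr : r ∈ realization H S) :
    realizationDist H S p r ≤ realizationDist H S p q + realizationDist H S q r := by
  by_cases hqr : CommonEdge H q r
  · by_cases hpq : CommonEdge H p q
    · exact realizationDist_triangle_of_commonEdge hS hp hq hr hpq hqr
    · rw [realizationDist_comm hp hr hS, realizationDist_comm hp hq hS,
        realizationDist_comm hq hr hS, add_comm]
      exact realizationDist_triangle_of_not_commonEdge hS hr hq hp (hpq ∘ CommonEdge.symm)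
  · exact realizationDist_triangle_of_not_commonEdge hS hp hq hr hqr

theorem eq_of_realizationDist_eq_zero (hS : ConnectedOn H S) (hp : p ∈ realization H S)
    (hq : q ∈ realization H S) (h : realizationDist H S p q = 0) : p = q := by
  rcases realizationDist_eq_or hp hq with ⟨-, hsup⟩ | ⟨a, c, ha, hc, hdist⟩
  · funext x
    have hx := abs_coord_sub_le_iSup hp hq x
    rw [← hsup, h] at hx
    exact sub_eq_zero.1 (abs_nonpos_iff.1 hx)
  · have hpa := coord_le_one hp a
    have hqc := coord_le_one hq c
    have hnonneg : (0 : ℝ) ≤ distOn H S a c := Nat.cast_nonneg _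
    have hzero : (distOn H S a c : ℝ) = 0 := by linarith
    obtain rfl := hS.eq_of_distOn_eq_zero (mem_of_coord_ne_zero hp ha)
      (mem_of_coord_ne_zero hq hc) (Nat.cast_eq_zero.1 hzero)
    rw [eq_vertexPoint_of_coord_eq_one hp (a := a) (by linarith),
      eq_vertexPoint_of_coord_eq_one hq (a := a) (by linarith)]

theorem realizationDist_self (hp : p ∈ realization H S) : realizationDist H S p p = 0 := by
  simp only [realizationDist_of_commonEdge (commonEdge_self hp), sub_self, abs_zero,
    Real.iSup_const_zero]

theorem isMetric_realization (hS : ConnectedOn H S) :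
    IsMetric fun x y : realization H S => realizationDist H S x.1 y.1 where
  eq_zero_iff x y :=
    ⟨fun h => Subtype.ext (eq_of_realizationDist_eq_zero hS x.2 y.2 h),
      fun h => h ▸ realizationDist_self x.2⟩
  symm x y := realizationDist_comm x.2 y.2 hS
  triangle x y z := realizationDist_triangle hS x.2 y.2 z.2

theorem realizationDist_le_distOn_add_two (hS : ConnectedOn H S) (hp : p ∈ realization H S)
    (hq : q ∈ realization H S) (ha : p a ≠ 0) (hc : q c ≠ 0) :
    realizationDist H S p q ≤ distOn H S a c + 2 := by
  linarith [realizationDist_le hS hp hq ha hc, coord_nonneg hp a, coord_nonneg hq c]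

theorem distOn_le_realizationDist_add_two (hS : ConnectedOn H S) (hp : p ∈ realization H S)
    (hq : q ∈ realization H S) (ha : p a ≠ 0) (hc : q c ≠ 0) :
    distOn H S a c ≤ realizationDist H S p q + 2 := by
  obtain ⟨a', ha', hdist⟩ := exists_add_distOn_le hS hp hq hc
  have hmem := mem_of_coord_ne_zero hp ha
  have hmem' := mem_of_coord_ne_zero hp ha'
  have htri : (distOn H S a c : ℝ) ≤ 1 + distOn H S a' c := by
    exact_mod_cast (hS.triangle hmem hmem' c).trans
      (Nat.add_le_add_right (distOn_le_one hmem hmem' (coord_eq_or_adj hp ha ha')) _)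
  linarith [coord_le_one hp a', coord_nonneg hq c]

theorem realizationDist_vertexPoint (hu : u ∈ S) (hv : v ∈ S) :
    realizationDist H S (vertexPoint u) (vertexPoint v) = distOn H S u v := by
  have hpu := vertexPoint_mem (H := H) hu
  have hpv := vertexPoint_mem (H := H) hv
  rcases eq_or_ne u v with rfl | hne
  · rw [realizationDist_self hpu, distOn_self, Nat.cast_zero]
  rcases realizationDist_eq_or hpu hpv with ⟨huv, hdist⟩ | ⟨a, c, ha, hc, hdist⟩
  · have hadj := huv.eq_or_adj (vertexPoint_self_ne_zero u) (vertexPoint_self_ne_zero v)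
    rw [hdist, distOn_eq_one hu hv (hadj.resolve_left hne), Nat.cast_one]
    have : Nonempty U := ⟨u⟩
    refine (ciSup_le (abs_coord_sub_le_one hpu hpv)).antisymm ?_
    have hle := abs_coord_sub_le_iSup hpu hpv u
    rwa [vertexPoint_self, vertexPoint_of_ne hne, sub_zero, abs_one] at hle
  · obtain rfl := eq_of_vertexPoint_ne_zero ha
    obtain rfl := eq_of_vertexPoint_ne_zero hc
    rw [hdist, vertexPoint_self, vertexPoint_self, sub_self, zero_add, add_zero]

theorem connectedOn_of_isMetric
    (h : IsMetric fun x y : realization H S => realizationDist H S x.1 y.1) : ConnectedOn H S := by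
  intro u hu v hv
  by_contra hr
  have hdist : realizationDist H S (vertexPoint u) (vertexPoint v) = 0 := by
    rw [realizationDist_vertexPoint hu hv, distOn, SimpleGraph.dist_eq_zero_of_not_reachable hr,
      Nat.cast_zero]
  have heq : vertexPoint u = vertexPoint v := congrArg Subtype.val
    ((h.eq_zero_iff ⟨_, vertexPoint_mem hu⟩ ⟨_, vertexPoint_mem hv⟩).1 hdist)
  obtain rfl : u = v := eq_of_vertexPoint_ne_zero (heq ▸ vertexPoint_self_ne_zero u)
  exact hr (SimpleGraph.Reachable.refl u)

theorem IsGeodesic.distOn_eq_abs {γ : ℕ → U} (hγ : IsGeodesic H S γ u v) {i j : ℕ}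
    (hi : i ≤ distOn H S u v) (hj : j ≤ distOn H S u v) :
    (distOn H S (γ i) (γ j) : ℝ) = |(i : ℝ) - j| := by
  rcases le_total i j with hij | hij
  · rw [hγ.dist_eq hij hj, Nat.cast_sub hij, abs_sub_comm, abs_of_nonneg]
    exact sub_nonneg.2 (Nat.cast_le.2 hij)
  · rw [distOn_comm, hγ.dist_eq hij hi, Nat.cast_sub hij, abs_of_nonneg]
    exact sub_nonneg.2 (Nat.cast_le.2 hij)

-- `η` starts at `p`, ends at `q` and runs discretely along a geodesic `γ` of vertices between
-- them.
theorem exists_path_near_geodesic {γ : ℕ → U} {n : ℕ} (hp : p ∈ realization H S)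
    (hq : q ∈ realization H S) (hγ : ∀ i, γ i ∈ S) (h0 : p (γ 0) ≠ 0) (hn : q (γ n) ≠ 0) :
    ∃ η : ℝ → realization H S, η 0 = ⟨p, hp⟩ ∧ η (n + 1) = ⟨q, hq⟩ ∧
      ∀ s ∈ Set.Icc (0 : ℝ) (n + 1), ∃ i ≤ n, (η s).1 (γ i) ≠ 0 ∧ (i : ℝ) ≤ s ∧ s ≤ i + 1 := by
  classical
  refine ⟨fun s => if s ≤ 0 then ⟨p, hp⟩ else if n + 1 ≤ s then ⟨q, hq⟩ else
    ⟨vertexPoint (γ ⌊s⌋₊), vertexPoint_mem (hγ _)⟩, if_pos le_rfl, ?_, fun s hs => ?_⟩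
  · exact (if_neg (by positivity : (0 : ℝ) < n + 1).not_ge).trans (if_pos le_rfl)
  by_cases hs0 : s ≤ 0
  · refine ⟨0, n.zero_le, ?_, Nat.cast_zero.trans_le hs.1, hs0.trans (by positivity)⟩
    simpa only [if_pos hs0] using h0
  by_cases hsn : n + 1 ≤ s
  · refine ⟨n, le_rfl, ?_, (le_add_of_nonneg_right zero_le_one).trans hsn, hs.2⟩
    simpa only [if_neg hs0, if_pos hsn] using hn
  refine ⟨⌊s⌋₊, ?_, ?_, Nat.floor_le hs.1, (Nat.lt_floor_add_one s).le⟩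
  · refine Nat.lt_succ_iff.1 ((Nat.floor_lt hs.1).2 ?_)
    push_cast
    exact not_le.1 hsn
  · simp only [if_neg hs0, if_neg hsn, vertexPoint_self]
    exact one_ne_zero

theorem isQuasiGeodesicSpace_realization (hS : ConnectedOn H S) :
    IsQuasiGeodesicSpace fun x y : realization H S => realizationDist H S x.1 y.1 := by
  refine ⟨isMetric_realization hS, 7, by norm_num, ?_⟩
  rintro ⟨p, hp⟩ ⟨q, hq⟩
  obtain ⟨a, ha⟩ := exists_coord_ne_zero hp
  obtain ⟨c, hc⟩ := exists_coord_ne_zero hq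
  obtain ⟨γ, hγ⟩ := hS.exists_isGeodesic (mem_of_coord_ne_zero hp ha) (mem_of_coord_ne_zero hq hc)
  obtain ⟨η, hη0, hη1, hη⟩ := exists_path_near_geodesic (γ := γ) hp hq hγ.mem
    (hγ.source.symm ▸ ha) (hγ.target.symm ▸ hc)
  refine ⟨distOn H S a c + 1, η, by positivity, hη0, hη1, fun s hs t ht => ?_⟩
  obtain ⟨i, hi, hsi, his, his'⟩ := hη s hs
  obtain ⟨j, hj, htj, hjt, hjt'⟩ := hη t ht
  have hle := realizationDist_le_distOn_add_two hS (η s).2 (η t).2 hsi htj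
  have hge := distOn_le_realizationDist_add_two hS (η s).2 (η t).2 hsi htj
  rw [hγ.distOn_eq_abs hi hj] at hle hge
  have hij : |(i : ℝ) - j| ≤ |s - t| + 1 := by
    rw [abs_le]
    constructor <;> linarith [le_abs_self (s - t), neg_le_abs (s - t)]
  have hst : |s - t| ≤ |(i : ℝ) - j| + 1 := by
    rw [abs_le]
    constructor <;> linarith [le_abs_self ((i : ℝ) - j), neg_le_abs ((i : ℝ) - j)]
  constructor <;> linarith [abs_nonneg (s - t)]

end Realization

/-! ## Factor systems and links -/

section Removal

variable {U : Type u} {H : SimpleGraph U} {S A : Set U} {x y a f : U} {δ c : ℕ}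

theorem ConnectedOn.exists_joinedWithin_diff_of_mem (hS : ConnectedOn H S) (hx : x ∈ S \ A)
    (ha : a ∈ S ∩ A) :
    ∃ s ∈ S \ A, (∃ a ∈ S ∩ A, H.Adj s a) ∧ JoinedWithin H (S \ A) (distOn H S x a) x s := by
  classical
  obtain ⟨γ, hγ⟩ := hS.exists_isGeodesic hx.1 ha.1
  have hend : γ (distOn H S x a) ∈ A := by
    rw [hγ.target]
    exact ha.2
  have hexists : ∃ i, γ i ∈ A := ⟨_, hend⟩
  obtain ⟨k, hk⟩ : ∃ k, Nat.find hexists = k + 1 := by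
    refine Nat.exists_eq_succ_of_ne_zero fun h0 => hx.2 ?_
    exact hγ.source ▸ (Nat.find_eq_zero _).1 h0
  have hle : k + 1 ≤ distOn H S x a := hk ▸ Nat.find_min' hexists hend
  have hmem : ∀ i ≤ k, γ i ∈ S \ A := fun i hi =>
    ⟨hγ.mem i, Nat.find_min hexists (by omega)⟩
  refine ⟨γ k, hmem k le_rfl, ⟨γ (k + 1), ⟨hγ.mem _, hk ▸ Nat.find_spec hexists⟩,
    hγ.adj hle⟩, ?_⟩
  have hpath := joinedWithin_of_path hmem fun i hi => Or.inr (hγ.adj (by omega))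
  rw [hγ.source] at hpath
  exact hpath.mono (by omega)

theorem ConnectedOn.joinedWithin_diff (hS : ConnectedOn H S)
    (h : ∀ s ∈ S \ A, ∀ a ∈ S ∩ A, H.Adj s a → JoinedWithin H (S \ A) c s f) (hx : x ∈ S \ A)
    (hy : y ∈ S \ A) : JoinedWithin H (S \ A) (distOn H S x y + 2 * c) x y := by
  have detour {x a : U} (hx : x ∈ S \ A) (ha : a ∈ S ∩ A) :
      JoinedWithin H (S \ A) (distOn H S x a + c) x f := by
    obtain ⟨s, hs, ⟨a', ha', hsa⟩, hxs⟩ := hS.exists_joinedWithin_diff_of_mem hx ha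
    exact hxs.trans (h s hs a' ha' hsa)
  obtain ⟨γ, hγ⟩ := hS.exists_isGeodesic hx.1 hy.1
  by_cases hA : ∃ k ≤ distOn H S x y, γ k ∈ A
  · obtain ⟨k, hk, hkA⟩ := hA
    have hk' : γ k ∈ S ∩ A := ⟨hγ.mem k, hkA⟩
    have hxy := (detour hx hk').trans (detour hy hk').symm
    rw [distOn_comm y, hγ.dist_source hk, hγ.dist_target hk] at hxy
    exact hxy.mono (by omega)
  · push Not at hA
    exact (hγ.joinedWithin (T := S \ A) fun i hi => ⟨hγ.mem i, hA i hi⟩).mono (by omega)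

theorem HyperbolicOn.diff (hS : HyperbolicOn H S δ)
    (h : ∀ s ∈ S \ A, ∀ a ∈ S ∩ A, H.Adj s a → JoinedWithin H (S \ A) c s f) :
    HyperbolicOn H (S \ A) (δ + 4 * c) := by
  have hc : ConnectedOn H (S \ A) := fun x hx y hy => (hS.conn.joinedWithin_diff h hx hy).1
  refine ⟨hc, fun x hx y hy z hz w hw => ?_⟩
  have hxz := (hS.conn.joinedWithin_diff h hx hz).2
  have hyw := (hS.conn.joinedWithin_diff h hy hw).2
  have hfour := hS.four_point x hx.1 y hy.1 z hz.1 w hw.1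
  have hxy := hc.distOn_anti Set.sdiff_subset hx hy
  have hzw := hc.distOn_anti Set.sdiff_subset hz hw
  have hyz := hc.distOn_anti Set.sdiff_subset hy hz
  have hxw := hc.distOn_anti Set.sdiff_subset hx hw
  omega

end Removal

section Cliques

variable {V : Type u} {G : SimpleGraph V} {A B F : Set V} {v : V}

theorem exists_maxClique_superset {s : Set V} (hs : s ⊆ A) (hc : G.IsClique s) :
    ∃ w : MaxClique G A, s ⊆ w.1 := by
  obtain ⟨m, hsm, hm⟩ := zorn_subset_nonempty {s | s ⊆ A ∧ G.IsClique s}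
    (fun c hc hchain _ => ⟨⋃₀ c, ⟨Set.sUnion_subset fun t ht => (hc ht).1,
      (Set.pairwise_sUnion hchain.directedOn).2 fun t ht => (hc ht).2⟩,
      fun t ht => Set.subset_sUnion_of_mem ht⟩) s ⟨hs, hc⟩
  exact ⟨⟨m, hm⟩, hsm⟩

theorem exists_maxClique_mem (hv : v ∈ A) : ∃ w : MaxClique G A, v ∈ w.1 := by
  obtain ⟨w, hw⟩ := exists_maxClique_superset (G := G) (Set.singleton_subset_iff.2 hv)
    (Set.pairwise_singleton v G.Adj)
  exact ⟨w, Set.singleton_subset_iff.1 hw⟩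

theorem MaxClique.subset (w : MaxClique G A) : w.1 ⊆ A := w.2.prop.1

theorem MaxClique.isClique (w : MaxClique G A) : G.IsClique w.1 := w.2.prop.2

theorem MaxClique.eq_of_subset {w w' : MaxClique G A} (h : w.1 ⊆ w'.1) : w = w' :=
  Subtype.ext (w.2.eq_of_subset w'.2.prop h)

theorem MaxClique.mem_of_adj (w : MaxClique G A) (hv : v ∈ A)
    (h : ∀ u ∈ w.1, u ≠ v → G.Adj v u) : v ∈ w.1 :=
  w.2.le_of_ge ⟨Set.insert_subset hv w.subset,
    SimpleGraph.isClique_insert.2 ⟨w.isClique, fun u hu huv => h u hu huv.symm⟩⟩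
    (Set.subset_insert _ _) (Set.mem_insert _ _)

theorem subset_link_comm : A ⊆ link G B ↔ B ⊆ link G A :=
  ⟨fun h b hb _ ha => (h ha b hb).symm, fun h a ha _ hb => (h hb a ha).symm⟩

theorem notMem_link_of_mem (hv : v ∈ A) : v ∉ link G A :=
  fun h => (h v hv).ne rfl

theorem MaxClique.exists_notMem_link (hFA : F ⊆ A) (hF : F.Nonempty) (w : MaxClique G A) :
    ∃ v ∈ w.1, v ∉ link G F := by
  by_contra! h
  obtain ⟨f, hf⟩ := hF
  exact notMem_link_of_mem hf (h f (w.mem_of_adj (hFA hf) fun u hu _ => h u hu f hf))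

end Cliques

section AugGraph

variable {V : Type u} {G : SimpleGraph V} {A K K' : Set V} {WA : SimpleGraph (MaxClique G A)}
  {v w : V} {x y : MaxClique G A}

theorem augGraph_adj_vert_vert : (augGraph G WA).Adj (.vert v) (.vert w) ↔
    v ≠ w ∧ (G.Adj v w ∨ ∃ x y : MaxClique G A, WA.Adj x y ∧ v ∈ x.1 ∧ w ∈ y.1) := by
  simp only [augGraph, SimpleGraph.fromRel_adj, ne_eq, AugVertex.vert.injEq]
  refine and_congr_right fun _ => ⟨?_, Or.inl⟩
  rintro (h | h | ⟨x, y, h, hx, hy⟩)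
  exacts [h, Or.inl h.symm, Or.inr ⟨y, x, h.symm, hy, hx⟩]

theorem augGraph_adj_vert_proj : (augGraph G WA).Adj (.vert v) (.proj K) ↔ v ∈ K := by
  simp [augGraph]

theorem augGraph_adj_proj_vert : (augGraph G WA).Adj (.proj K) (.vert v) ↔ v ∈ K := by
  rw [SimpleGraph.adj_comm, augGraph_adj_vert_proj]

theorem not_augGraph_adj_proj_proj : ¬ (augGraph G WA).Adj (.proj K) (.proj K') := by
  simp [augGraph]

theorem eq_or_augGraph_adj_of_mem (hv : v ∈ x.1) (hw : w ∈ x.1) :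
    AugVertex.vert v = .vert w ∨ (augGraph G WA).Adj (.vert v) (.vert w) :=
  (eq_or_ne v w).imp (congrArg _) fun h =>
    augGraph_adj_vert_vert.2 ⟨h, Or.inl (x.isClique hv hw h)⟩

theorem eq_or_augGraph_adj_of_adj (hxy : WA.Adj x y) (hv : v ∈ x.1) (hw : w ∈ y.1) :
    AugVertex.vert v = .vert w ∨ (augGraph G WA).Adj (.vert v) (.vert w) :=
  (eq_or_ne v w).imp (congrArg _) fun h =>
    augGraph_adj_vert_vert.2 ⟨h, Or.inr ⟨x, y, hxy, hv, hw⟩⟩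

end AugGraph

section Rank

variable {V : Type u} {G : SimpleGraph V} {𝔉 : Set (Set V)} {F F' : Set V} {n : ℕ}

/-- The height of a domain `F` in the poset `𝔉`, counted by the proper inclusions in a longest
chain below it; it is `0` when `F` is not a domain. -/
noncomputable def rank (𝔉 : Set (Set V)) (F : Set V) : ℕ :=
  open Classical in if hF : F ∈ 𝔉 then (Order.height (⟨F, hF⟩ : 𝔉)).toNat else 0

namespace IsFactorSystem

theorem height_lt (h : IsFactorSystem n G 𝔉) (F : 𝔉) : Order.height F < n := by
  obtain ⟨k, rfl⟩ := Nat.exists_eq_succ_of_ne_zero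
    (h.complexity 0 (Fin.elim0 ·) (fun i => i.elim0) fun i => i.elim0).ne'
  refine (Order.height_le fun p _ => ?_).trans_lt (Nat.cast_lt.2 k.lt_succ_self)
  exact_mod_cast Nat.le_of_lt_succ (p.length.lt_succ_self.trans
    (h.complexity _ (fun i => (p i).1) (fun _ _ hij => p.strictMono hij) fun i => (p i).2))

theorem cast_rank (h : IsFactorSystem n G 𝔉) (hF : F ∈ 𝔉) :
    (rank 𝔉 F : ℕ∞) = Order.height (⟨F, hF⟩ : 𝔉) := by
  rw [rank, dif_pos hF, ENat.natCast_toNat (h.height_lt _).ne_top]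

theorem rank_lt (h : IsFactorSystem n G 𝔉) (hF : F ∈ 𝔉) : rank 𝔉 F < n :=
  Nat.cast_lt.1 ((h.cast_rank hF).trans_lt (h.height_lt _))

theorem rank_lt_rank (h : IsFactorSystem n G 𝔉) (hF : F ∈ 𝔉) (hF' : F' ∈ 𝔉)
    (hFF : F ⊂ F') : rank 𝔉 F < rank 𝔉 F' := by
  rw [← Nat.cast_lt (α := ℕ∞), h.cast_rank hF, h.cast_rank hF']
  exact Order.height_strictMono (Subtype.mk_lt_mk.2 hFF)
    ((h.height_lt _).trans (ENat.natCast_lt_top n))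

theorem induction_on (h : IsFactorSystem n G 𝔉) {P : Set V → Prop}
    (ih : ∀ F ∈ 𝔉, (∀ F' ∈ 𝔉, F' ⊂ F → P F') → P F) (hF : F ∈ 𝔉) : P F := by
  induction hr : rank 𝔉 F using Nat.strong_induction_on generalizing F with
  | _ r ihr =>
    exact ih F hF fun F' hF' hFF => ihr _ (hr ▸ h.rank_lt_rank hF' hF hFF) hF' rfl

end IsFactorSystem

end Rank

section VertexSets

variable {V : Type u} {G : SimpleGraph V} {𝔉 : Set (Set V)} {F L : Set V} {v : V}
  {a : AugVertex V} {n : ℕ}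

/-- The set of vertices of `X` that a vertex of `CX` stands for: `{v}` for a vertex `v` of `X`, and
`L` for the projection vertex `b_L`. -/
def AugVertex.base : AugVertex V → Set V
  | .vert v => {v}
  | .proj L => L

/-- The vertices of `lk(F)` and the `b_L` with `L ⊆ lk(F)`. -/
def linkPart (G : SimpleGraph V) (F : Set V) : Set (AugVertex V) := {a | a.base ⊆ link G F}

theorem vert_mem_augVerts : AugVertex.vert v ∈ augVerts 𝔉 F ↔ v ∈ F := Iff.rfl

theorem proj_mem_augVerts : AugVertex.proj L ∈ augVerts 𝔉 F ↔ L ∈ 𝔉 ∧ L ⊂ F := Iff.rfl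

theorem vert_mem_linkPart : AugVertex.vert v ∈ linkPart G F ↔ v ∈ link G F :=
  Set.singleton_subset_iff

theorem proj_mem_linkPart : AugVertex.proj L ∈ linkPart G F ↔ L ⊆ link G F := Iff.rfl

theorem vert_mem_compVerts : AugVertex.vert v ∈ compVerts G 𝔉 F ↔ v ∉ link G F := by
  simp [compVerts, augVerts, projPart]

theorem proj_mem_compVerts : AugVertex.proj L ∈ compVerts G 𝔉 F ↔
    L ∈ 𝔉 ∧ L ≠ Set.univ ∧ ¬ L ⊆ link G F ∧ ¬ F ⊆ L := by
  simp only [compVerts, augVerts, projPart, Set.mem_sdiff, Set.mem_ofPred_eq, Set.ssubset_univ_iff]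
  tauto

theorem base_subset_of_mem_augVerts (ha : a ∈ augVerts 𝔉 F) : a.base ⊆ F := by
  rcases a with v | L
  exacts [Set.singleton_subset_iff.2 ha, ha.2.subset]

theorem eq_or_augGraph_adj_of_mem_base {A : Set V} {WA : SimpleGraph (MaxClique G A)}
    (hv : v ∈ a.base) : a = .vert v ∨ (augGraph G WA).Adj a (.vert v) := by
  rcases a with w | L
  exacts [Or.inl (congrArg _ (Set.mem_singleton_iff.1 hv).symm),
    Or.inr (augGraph_adj_proj_vert.2 hv)]

theorem not_subset_link_of_subset (hF : F.Nonempty) (hFL : F ⊆ L) : ¬ L ⊆ link G F := by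
  obtain ⟨f, hf⟩ := hF
  exact fun h => notMem_link_of_mem hf (h (hFL hf))

theorem IsFactorSystem.base_nonempty (h : IsFactorSystem n G 𝔉) (ha : a ∈ augVerts 𝔉 F) :
    a.base.Nonempty := by
  rcases a with v | L
  exacts [Set.singleton_nonempty v, h.nonempty L ha.1]

theorem IsFactorSystem.augVerts_subset_compVerts (h : IsFactorSystem n G 𝔉) (F : Set V) :
    augVerts 𝔉 F ⊆ compVerts G 𝔉 F := by
  rintro (v | L) ha
  · exact vert_mem_compVerts.2 (notMem_link_of_mem ha)
  · obtain ⟨hL, hLF⟩ := proj_mem_augVerts.1 ha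
    obtain ⟨v, hv⟩ := h.nonempty L hL
    exact proj_mem_compVerts.2 ⟨hL, (hLF.trans_subset (Set.subset_univ F)).ne,
      fun hlink => notMem_link_of_mem (hLF.subset hv) (hlink hv), hLF.not_subset⟩

theorem augVerts_mono (h : F ⊆ L) : augVerts 𝔉 F ⊆ augVerts 𝔉 L := by
  rintro (v | K) ha
  exacts [h ha, ⟨ha.1, ha.2.trans_subset h⟩]

theorem IsFactorSystem.compVerts_univ (h : IsFactorSystem n G 𝔉) :
    compVerts G 𝔉 Set.univ = augVerts 𝔉 Set.univ :=
  Set.sdiff_subset.antisymm (h.augVerts_subset_compVerts Set.univ)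

end VertexSets

section Hierarchy

variable {V : Type u} {G : SimpleGraph V} {W : SimpleGraph (MaxClique G Set.univ)}
  {𝔉 : Set (Set V)} {Wf : ∀ F : Set V, SimpleGraph (MaxClique G F)} {n : ℕ} {F F' : Set V}
  {a b : AugVertex V} {v : V} {x y : MaxClique G F}

/-- The `F`-graphs `Wf F` witness the hierarchy condition, apart from `Wf X = W`. -/
structure IsHierarchy (W : SimpleGraph (MaxClique G Set.univ)) (𝔉 : Set (Set V))
    (Wf : ∀ F : Set V, SimpleGraph (MaxClique G F)) : Prop where
  induce_eq : ∀ F ∈ 𝔉,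
    (augGraph G (Wf F)).induce (augVerts 𝔉 F) = (augGraph G W).induce (augVerts 𝔉 F)
  exists_hom : ∀ F ∈ 𝔉, ∀ F' ∈ 𝔉, F' ⊆ F → ∀ x : MaxClique G (link G F' ∩ F),
    ∃ f : Wf F' →g Wf F, ∀ w : MaxClique G F', x.1 ∪ w.1 ⊆ (f w).1

theorem HierarchyCondition.exists_isHierarchy (h : HierarchyCondition G W 𝔉) :
    ∃ Wf : ∀ F : Set V, SimpleGraph (MaxClique G F), Wf Set.univ = W ∧ IsHierarchy W 𝔉 Wf := by
  obtain ⟨Wf, hW, hWf⟩ := h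
  exact ⟨Wf, hW, fun F hF => (hWf F hF F hF subset_rfl).1,
    fun F hF F' hF' hFF => (hWf F hF F' hF' hFF).2⟩

namespace IsHierarchy

theorem adj_iff (h : IsHierarchy W 𝔉 Wf) (hF : F ∈ 𝔉) (ha : a ∈ augVerts 𝔉 F)
    (hb : b ∈ augVerts 𝔉 F) : (augGraph G (Wf F)).Adj a b ↔ (augGraph G W).Adj a b := by
  have hadj := congrArg (fun H => H.Adj ⟨a, ha⟩ ⟨b, hb⟩) (h.induce_eq F hF)
  exact iff_of_eq hadj

-- Maximal cliques of `F` through `v` are `v` joined to maximal cliques of `lk(v) ∩ F`.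
theorem reachable_of_mem (h : IsHierarchy W 𝔉 Wf) (hfs : IsFactorSystem n G 𝔉) (hF : F ∈ 𝔉)
    (hconn : ∀ F' ∈ 𝔉, F' ⊂ F → (Wf F').Preconnected) (hx : v ∈ x.1) (hy : v ∈ y.1) :
    (Wf F).Reachable x y := by
  have hvF : v ∈ F := x.subset hx
  have hrest {z : MaxClique G F} (hz : v ∈ z.1) : z.1 \ {v} ⊆ link G {v} ∩ F := by
    rintro u ⟨hu, huv⟩
    refine ⟨?_, z.subset hu⟩
    rintro _ rfl
    exact z.isClique hz hu (Ne.symm huv)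
  obtain hempty | hne := (link G {v} ∩ F).eq_empty_or_nonempty
  · have hxv : x.1 ⊆ {v} := Set.sdiff_eq_empty.1 (Set.subset_eq_empty (hrest hx) hempty)
    rw [MaxClique.eq_of_subset (hxv.trans (Set.singleton_subset_iff.2 hy))]
  have hF' : link G {v} ∩ F ∈ 𝔉 :=
    hfs.inter_mem _ (hfs.link_mem v (hne.mono Set.inter_subset_left)) _ hF hne
  have hss : link G {v} ∩ F ⊂ F :=
    ⟨Set.inter_subset_right, fun hsub => notMem_link_of_mem (Set.mem_singleton v) (hsub hvF).1⟩
  have hvlink : v ∈ link G (link G {v} ∩ F) ∩ F := ⟨fun u hu => (hu.1 v rfl).symm, hvF⟩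
  obtain ⟨c, hvc⟩ := exists_maxClique_mem (G := G) hvlink
  obtain ⟨f, hf⟩ := h.exists_hom F hF _ hF' hss.subset c
  have hsurj {z : MaxClique G F} (hz : v ∈ z.1) : ∃ w, f w = z := by
    obtain ⟨w, hw⟩ := exists_maxClique_superset (hrest hz) (z.isClique.subset Set.sdiff_subset)
    refine ⟨w, (MaxClique.eq_of_subset fun u hu => ?_).symm⟩
    by_cases huv : u = v
    · exact hf w (Or.inl (huv ▸ hvc))
    · exact hf w (Or.inr (hw ⟨hu, huv⟩))
  obtain ⟨w, rfl⟩ := hsurj hx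
  obtain ⟨w', rfl⟩ := hsurj hy
  exact (hconn _ hF' hss w w').map f

theorem reachable_of_mem_base (h : IsHierarchy W 𝔉 Wf) (hfs : IsFactorSystem n G 𝔉) (hF : F ∈ 𝔉)
    (hconn : ∀ F' ∈ 𝔉, F' ⊂ F → (Wf F').Preconnected) (ha : a ∈ augVerts 𝔉 F)
    (hx : (a.base ∩ x.1).Nonempty) (hy : (a.base ∩ y.1).Nonempty) : (Wf F).Reachable x y := by
  obtain ⟨v, hva, hvx⟩ := hx
  obtain ⟨w, hwa, hwy⟩ := hy
  rcases a with u | L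
  · obtain rfl := Set.mem_singleton_iff.1 hva
    obtain rfl := Set.mem_singleton_iff.1 hwa
    exact h.reachable_of_mem hfs hF hconn hvx hwy
  · obtain ⟨hL, hLF⟩ := proj_mem_augVerts.1 ha
    obtain ⟨c, -⟩ := exists_maxClique_superset (Set.empty_subset (link G L ∩ F))
      (Set.pairwise_empty G.Adj)
    obtain ⟨f, hf⟩ := h.exists_hom F hF L hL hLF.subset c
    obtain ⟨x', hx'⟩ := exists_maxClique_mem (G := G) hva
    obtain ⟨y', hy'⟩ := exists_maxClique_mem (G := G) hwa
    exact ((h.reachable_of_mem hfs hF hconn hvx (hf x' (Or.inr hx'))).trans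
      ((hconn L hL hLF x' y').map f)).trans
      (h.reachable_of_mem hfs hF hconn (hf y' (Or.inr hy')) hwy)

theorem exists_reachable_of_adj (h : IsHierarchy W 𝔉 Wf) (hF : F ∈ 𝔉) (ha : a ∈ augVerts 𝔉 F)
    (hb : b ∈ augVerts 𝔉 F) (hab : (augGraph G W).Adj a b) :
    ∃ x y : MaxClique G F, (a.base ∩ x.1).Nonempty ∧ (b.base ∩ y.1).Nonempty ∧
      (Wf F).Reachable x y := by
  have same {v w : V} (hva : v ∈ a.base) (hwb : w ∈ b.base) (hvw : G.IsClique {v, w}) :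
      ∃ x y : MaxClique G F, (a.base ∩ x.1).Nonempty ∧ (b.base ∩ y.1).Nonempty ∧
        (Wf F).Reachable x y := by
    obtain ⟨x, hx⟩ := exists_maxClique_superset (A := F) (Set.pair_subset
      (base_subset_of_mem_augVerts ha hva) (base_subset_of_mem_augVerts hb hwb)) hvw
    exact ⟨x, x, ⟨v, hva, hx (Set.mem_insert _ _)⟩,
      ⟨w, hwb, hx (Set.mem_insert_of_mem _ rfl)⟩, .rfl⟩
  rcases a with v | L <;> rcases b with w | M
  · obtain ⟨-, hvw | ⟨x, y, hxy, hx, hy⟩⟩ :=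
      augGraph_adj_vert_vert.1 ((h.adj_iff hF ha hb).2 hab)
    · exact same rfl rfl (SimpleGraph.isClique_pair.2 fun _ => hvw)
    · exact ⟨x, y, ⟨v, rfl, hx⟩, ⟨w, rfl, hy⟩, hxy.reachable⟩
  · exact same rfl (augGraph_adj_vert_proj.1 hab) (by simp)
  · exact same (augGraph_adj_proj_vert.1 hab) rfl (by simp)
  · exact absurd hab not_augGraph_adj_proj_proj

theorem reachable_of_walk (h : IsHierarchy W 𝔉 Wf) (hfs : IsFactorSystem n G 𝔉) (hF : F ∈ 𝔉)
    (hconn : ∀ F' ∈ 𝔉, F' ⊂ F → (Wf F').Preconnected)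
    (p : ((augGraph G W).induce (augVerts 𝔉 F)).spanningCoe.Walk a b) (ha : a ∈ augVerts 𝔉 F)
    (hx : (a.base ∩ x.1).Nonempty) (hy : (b.base ∩ y.1).Nonempty) : (Wf F).Reachable x y := by
  induction p generalizing x with
  | nil => exact h.reachable_of_mem_base hfs hF hconn ha hx hy
  | cons hab _ ih =>
    obtain ⟨-, hb, hab⟩ := spanningCoe_induce_adj.1 hab
    obtain ⟨x', z, hx', hz, hreach⟩ := h.exists_reachable_of_adj hF ha hb hab
    exact ((h.reachable_of_mem_base hfs hF hconn ha hx hx').trans hreach).trans (ih hb hz hy)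

theorem preconnected (h : IsHierarchy W 𝔉 Wf) (hfs : IsFactorSystem n G 𝔉)
    (hC : ∀ F ∈ 𝔉, ConnectedOn (augGraph G W) (augVerts 𝔉 F)) (hF : F ∈ 𝔉) :
    (Wf F).Preconnected := by
  refine hfs.induction_on (P := fun F => (Wf F).Preconnected) (fun F hF hconn x y => ?_) hF
  obtain ⟨u, hu, -⟩ := x.exists_notMem_link subset_rfl (hfs.nonempty F hF)
  obtain ⟨v, hv, -⟩ := y.exists_notMem_link subset_rfl (hfs.nonempty F hF)
  obtain ⟨p⟩ := hC F hF (.vert u) (x.subset hu) (.vert v) (y.subset hv)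
  exact h.reachable_of_walk hfs hF hconn p (x.subset hu) ⟨u, rfl, hu⟩ ⟨v, rfl, hv⟩

end IsHierarchy

end Hierarchy

section DiscreteCHHF

variable {V : Type u} {G : SimpleGraph V} {W : SimpleGraph (MaxClique G Set.univ)}
  {𝔉 : Set (Set V)} {n δ K k : ℕ} {F L : Set V} {f u v : V} {w w' : MaxClique G Set.univ}
  {s a : AugVertex V}

/-- A CHHF triple whose hyperbolicity condition is expressed by vertices and integral constants:
each `CF` is `δ`-hyperbolic and is distorted in `Y_F` by at most `t ↦ K * t + K`. -/
structure IsDiscreteCHHF (G : SimpleGraph V) (W : SimpleGraph (MaxClique G Set.univ))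
    (𝔉 : Set (Set V)) (n δ K : ℕ) : Prop where
  factorSystem : IsFactorSystem n G 𝔉
  hierarchy : HierarchyCondition G W 𝔉
  hyperbolic : ∀ F ∈ 𝔉, HyperbolicOn (augGraph G W) (augVerts 𝔉 F) δ
  qi : ∀ F ∈ 𝔉, ∀ x ∈ augVerts 𝔉 F, ∀ y ∈ augVerts 𝔉 F,
    distOn (augGraph G W) (augVerts 𝔉 F) x y ≤ K * distOn (augGraph G W) (compVerts G 𝔉 F) x y + K

namespace IsDiscreteCHHF

theorem connectedOn_cliques (h : IsDiscreteCHHF G W 𝔉 n δ K) : ConnectedOn W Set.univ := by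
  obtain ⟨Wf, rfl, hWf⟩ := h.hierarchy.exists_isHierarchy
  intro x _ y _
  rw [SimpleGraph.spanningCoe_induce_univ]
  exact hWf.preconnected h.factorSystem (fun F hF => (h.hyperbolic F hF).conn)
    h.factorSystem.univ_mem x y

theorem joinedWithin_of_distOn_cliques (h : IsDiscreteCHHF G W 𝔉 n δ K) (hF : F.Nonempty)
    {T : Set (AugVertex V)} (hT : ∀ v ∉ link G F, AugVertex.vert v ∈ T)
    (hk : distOn W Set.univ w w' = k) (hu : u ∈ w.1 \ link G F) (hv : v ∈ w'.1 \ link G F) :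
    JoinedWithin (augGraph G W) T (k + 1) (.vert u) (.vert v) := by
  induction k generalizing w' v with
  | zero =>
    obtain rfl := h.connectedOn_cliques.eq_of_distOn_eq_zero trivial trivial hk
    exact joinedWithin_one (hT u hu.2) (hT v hv.2) (eq_or_augGraph_adj_of_mem hu.1 hv.1)
  | succ k ih =>
    obtain ⟨m, -, hwm, hmw'⟩ := h.connectedOn_cliques.exists_onGeodesic (x := w) (y := w')
      (k := k) trivial trivial (by omega)
    obtain ⟨t, ht, htF⟩ := m.exists_notMem_link (Set.subset_univ F) hF
    have hadj : W.Adj m w' := adj_of_distOn_eq_one (S := Set.univ) (by omega)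
    exact (ih hwm ⟨ht, htF⟩).trans (joinedWithin_one (hT t htF) (hT v hv.2)
      (eq_or_augGraph_adj_of_adj hadj ht hv.1))

theorem connectedOn_of_disjoint_linkPart (h : IsDiscreteCHHF G W 𝔉 n δ K) (hF : F.Nonempty)
    {T : Set (AugVertex V)} (hT : ∀ v ∉ link G F, AugVertex.vert v ∈ T)
    (hT' : ∀ a ∈ T, a ∉ linkPart G F) : ConnectedOn (augGraph G W) T := by
  have hvert : ∀ a ∈ T, ∃ v ∉ link G F, JoinedWithin (augGraph G W) T 1 a (.vert v) := by
    intro a ha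
    obtain ⟨v, hva, hvF⟩ := Set.not_subset.1 (hT' a ha)
    exact ⟨v, hvF, joinedWithin_one ha (hT v hvF) (eq_or_augGraph_adj_of_mem_base hva)⟩
  intro a ha b hb
  obtain ⟨u, hu, hau⟩ := hvert a ha
  obtain ⟨v, hv, hbv⟩ := hvert b hb
  obtain ⟨x, hx⟩ := exists_maxClique_mem (G := G) (Set.mem_univ u)
  obtain ⟨y, hy⟩ := exists_maxClique_mem (G := G) (Set.mem_univ v)
  have huv := h.joinedWithin_of_distOn_cliques hF hT rfl ⟨hx, hu⟩ ⟨hy, hv⟩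
  exact ((hau.trans huv).trans hbv.symm).1

theorem connectedOn_compVerts (h : IsDiscreteCHHF G W 𝔉 n δ K) (hF : F.Nonempty) :
    ConnectedOn (augGraph G W) (compVerts G 𝔉 F) := by
  refine h.connectedOn_of_disjoint_linkPart hF (fun v hv => vert_mem_compVerts.2 hv) ?_
  rintro (v | L) ha
  exacts [mt vert_mem_linkPart.1 (vert_mem_compVerts.1 ha), (proj_mem_compVerts.1 ha).2.2.1]

theorem exists_adj_link (h : IsDiscreteCHHF G W 𝔉 n δ K) (hL : L ∈ 𝔉)
    (hmeet : (L ∩ link G F).Nonempty) (hnot : ¬ L ⊆ link G F) :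
    ∃ u ∈ L \ link G F, ∃ v ∈ L ∩ link G F, (augGraph G W).Adj (.vert u) (.vert v) := by
  revert hmeet hnot
  refine h.factorSystem.induction_on (P := fun L => (L ∩ link G F).Nonempty → ¬ L ⊆ link G F →
    ∃ u ∈ L \ link G F, ∃ v ∈ L ∩ link G F, (augGraph G W).Adj (.vert u) (.vert v))
    (fun L hL ih hmeet hnot => ?_) hL
  obtain ⟨v, hv, hvF⟩ := hmeet
  obtain ⟨u, hu, huF⟩ := Set.not_subset.1 hnot
  obtain ⟨γ, hγ⟩ := (h.hyperbolic L hL).conn.exists_isGeodesic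
    (vert_mem_augVerts.2 hv) (vert_mem_augVerts.2 hu)
  obtain ⟨i, hi, hin, hout⟩ := exists_and_not_succ (P := fun i => γ i ∈ linkPart G F)
    (hγ.source ▸ vert_mem_linkPart.2 hvF) (hγ.target ▸ mt vert_mem_linkPart.1 huF)
  have hadj := hγ.adj hi
  have hmem := hγ.mem i
  have hmem' := hγ.mem (i + 1)
  generalize γ i = a at hadj hmem hin
  generalize γ (i + 1) = b at hadj hmem' hout
  rcases a with v | M <;> rcases b with w | M'
  · exact ⟨w, ⟨hmem', mt vert_mem_linkPart.2 hout⟩, v, ⟨hmem, vert_mem_linkPart.1 hin⟩, hadj.symm⟩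
  · obtain ⟨hM', hss⟩ := proj_mem_augVerts.1 hmem'
    have hmeet : (M' ∩ link G F).Nonempty :=
      ⟨v, augGraph_adj_vert_proj.1 hadj, vert_mem_linkPart.1 hin⟩
    obtain ⟨s, hs, t, ht, hst⟩ := ih M' hM' hss hmeet hout
    exact ⟨s, ⟨hss.subset hs.1, hs.2⟩, t, ⟨hss.subset ht.1, ht.2⟩, hst⟩
  · exact absurd (vert_mem_linkPart.2 (hin (augGraph_adj_proj_vert.1 hadj))) hout
  · exact absurd hadj not_augGraph_adj_proj_proj

-- The path runs through the projection vertex of `lk(v) ∩ L`, which contains `F`.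
theorem joinedWithin_diff_linkPart_of_adj (h : IsDiscreteCHHF G W 𝔉 n δ K) (hL : L ∈ 𝔉)
    (hFL : F ⊆ L) (hf : f ∈ F) (hu : u ∈ L \ link G F) (hv : v ∈ L ∩ link G F) (huv : G.Adj u v) :
    JoinedWithin (augGraph G W) (augVerts 𝔉 L \ linkPart G F) 2 (.vert u) (.vert f) := by
  have hFv : F ⊆ link G {v} ∩ L :=
    Set.subset_inter (subset_link_comm.1 (Set.singleton_subset_iff.2 hv.2)) hFL
  have hne : (link G {v} ∩ L).Nonempty := ⟨f, hFv hf⟩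
  have hD : link G {v} ∩ L ∈ 𝔉 :=
    h.factorSystem.inter_mem _ (h.factorSystem.link_mem v (hne.mono Set.inter_subset_left)) _ hL hne
  have hss : link G {v} ∩ L ⊂ L :=
    ⟨Set.inter_subset_right, fun hsub => notMem_link_of_mem (Set.mem_singleton v) (hsub hv.1).1⟩
  have hbT : AugVertex.proj (link G {v} ∩ L) ∈ augVerts 𝔉 L \ linkPart G F :=
    ⟨⟨hD, hss⟩, not_subset_link_of_subset ⟨f, hf⟩ hFv⟩
  have hfT : AugVertex.vert f ∈ augVerts 𝔉 L \ linkPart G F :=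
    ⟨hFL hf, mt vert_mem_linkPart.1 (notMem_link_of_mem hf)⟩
  have huT : AugVertex.vert u ∈ augVerts 𝔉 L \ linkPart G F :=
    ⟨hu.1, mt vert_mem_linkPart.1 hu.2⟩
  have huL : u ∈ link G {v} ∩ L := ⟨fun _ hw => hw ▸ huv.symm, hu.1⟩
  exact (joinedWithin_one huT hbT (Or.inr (augGraph_adj_vert_proj.2 huL))).trans
    (joinedWithin_one hbT hfT (Or.inr (augGraph_adj_proj_vert.2 (hFv hf))))

theorem joinedWithin_diff_linkPart_of_augGraph_adj (h : IsDiscreteCHHF G W 𝔉 n δ K) (hL : L ∈ 𝔉)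
    (hFL : F ⊆ L) (hf : f ∈ F) (hu : u ∈ L \ link G F) (hv : v ∈ L ∩ link G F)
    (huv : (augGraph G W).Adj (.vert u) (.vert v)) :
    JoinedWithin (augGraph G W) (augVerts 𝔉 L \ linkPart G F) 3 (.vert u) (.vert f) := by
  obtain ⟨Wf, -, hWf⟩ := h.hierarchy.exists_isHierarchy
  have hvert {t : V} (ht : t ∈ L \ link G F) :
      AugVertex.vert t ∈ augVerts 𝔉 L \ linkPart G F := ⟨ht.1, mt vert_mem_linkPart.1 ht.2⟩
  obtain ⟨-, hG | ⟨x, y, hxy, hux, hvy⟩⟩ :=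
    augGraph_adj_vert_vert.1 ((hWf.adj_iff hL hu.1 hv.1).2 huv)
  · exact (h.joinedWithin_diff_linkPart_of_adj hL hFL hf hu hv hG).mono (by omega)
  · obtain ⟨t, hty, htF⟩ := y.exists_notMem_link hFL ⟨f, hf⟩
    have ht : t ∈ L \ link G F := ⟨y.subset hty, htF⟩
    have htv : G.Adj t v := y.isClique hty hvy fun htv => htF (htv ▸ hv.2)
    have hut : AugVertex.vert u = .vert t ∨ (augGraph G W).Adj (.vert u) (.vert t) :=
      (eq_or_augGraph_adj_of_adj hxy hux hty).imp id (hWf.adj_iff hL hu.1 ht.1).1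
    exact ((joinedWithin_one (hvert hu) (hvert ht) hut).trans
      (h.joinedWithin_diff_linkPart_of_adj hL hFL hf ht hv htv)).mono (by omega)

theorem joinedWithin_diff_linkPart (h : IsDiscreteCHHF G W 𝔉 n δ K) (hL : L ∈ 𝔉) (hFL : F ⊆ L)
    (hf : f ∈ F) (hs : s ∈ augVerts 𝔉 L \ linkPart G F) (ha : a ∈ augVerts 𝔉 L ∩ linkPart G F)
    (hsa : (augGraph G W).Adj s a) :
    JoinedWithin (augGraph G W) (augVerts 𝔉 L \ linkPart G F) 4 s (.vert f) := by
  rcases s with u | M <;> rcases a with v | M'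
  · exact (h.joinedWithin_diff_linkPart_of_augGraph_adj hL hFL hf
      ⟨hs.1, mt vert_mem_linkPart.2 hs.2⟩ ⟨ha.1, vert_mem_linkPart.1 ha.2⟩ hsa).mono (by omega)
  · exact absurd (vert_mem_linkPart.2 (ha.2 (augGraph_adj_vert_proj.1 hsa))) hs.2
  · obtain ⟨hM, hss⟩ := proj_mem_augVerts.1 hs.1
    obtain ⟨u, hu, v, hv, huv⟩ := h.exists_adj_link hM
      ⟨v, augGraph_adj_proj_vert.1 hsa, vert_mem_linkPart.1 ha.2⟩ hs.2
    have huL : u ∈ L \ link G F := ⟨hss.subset hu.1, hu.2⟩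
    have hMu : JoinedWithin (augGraph G W) (augVerts 𝔉 L \ linkPart G F) 1 (.proj M) (.vert u) :=
      joinedWithin_one hs ⟨huL.1, mt vert_mem_linkPart.1 huL.2⟩
        (Or.inr (augGraph_adj_proj_vert.2 hu.1))
    exact (hMu.trans (h.joinedWithin_diff_linkPart_of_augGraph_adj hL hFL hf huL
      ⟨hss.subset hv.1, hv.2⟩ huv)).mono (by omega)
  · exact absurd hsa not_augGraph_adj_proj_proj

theorem hyperbolicOn_diff_linkPart (h : IsDiscreteCHHF G W 𝔉 n δ K) (hF : F.Nonempty) (hL : L ∈ 𝔉)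
    (hFL : F ⊆ L) : HyperbolicOn (augGraph G W) (augVerts 𝔉 L \ linkPart G F) (δ + 16) := by
  obtain ⟨f, hf⟩ := hF
  exact (h.hyperbolic L hL).diff fun _ hs _ ha => h.joinedWithin_diff_linkPart hL hFL hf hs ha

theorem distOn_diff_linkPart_le (h : IsDiscreteCHHF G W 𝔉 n δ K) (hF : F.Nonempty) (hL : L ∈ 𝔉)
    (hFL : F ⊆ L) (hs : s ∈ augVerts 𝔉 L \ linkPart G F)
    (ha : a ∈ augVerts 𝔉 L \ linkPart G F) :
    distOn (augGraph G W) (augVerts 𝔉 L \ linkPart G F) s a ≤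
      distOn (augGraph G W) (augVerts 𝔉 L) s a + 8 := by
  obtain ⟨f, hf⟩ := hF
  exact ((h.hyperbolic L hL).conn.joinedWithin_diff
    (fun _ hs _ ha => h.joinedWithin_diff_linkPart hL hFL hf hs ha) hs ha).2

end IsDiscreteCHHF

end DiscreteCHHF

/-! ## The closest-point projection of a domain -/

section Layers

variable {V : Type u} {G : SimpleGraph V} {W : SimpleGraph (MaxClique G Set.univ)}
  {𝔉 : Set (Set V)} {n δ δ' K k : ℕ} {F L : Set V} {v : V}

/-- The vertices of `Y_F`, together with the `b_L` for the domains `L ≠ X` that contain `F` and have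
rank less than `k`. Decreasing `k` from the complexity of `𝔉`, one gets from `CX` without the link
part of `F` to `Y_F`. -/
def layer (G : SimpleGraph V) (𝔉 : Set (Set V)) (F : Set V) (k : ℕ) : Set (AugVertex V) :=
  {a | match a with
    | .vert v => v ∉ link G F
    | .proj L => L ∈ 𝔉 ∧ L ≠ Set.univ ∧ ¬ L ⊆ link G F ∧ (F ⊆ L → rank 𝔉 L < k)}

/-- The `b_L` for the domains `L ≠ X` of rank `k` that contain `F`. -/
def coneVerts (𝔉 : Set (Set V)) (F : Set V) (k : ℕ) : Set (AugVertex V) :=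
  {a | match a with
    | .vert _ => False
    | .proj L => L ∈ 𝔉 ∧ L ≠ Set.univ ∧ F ⊆ L ∧ rank 𝔉 L = k}

theorem vert_mem_layer : AugVertex.vert v ∈ layer G 𝔉 F k ↔ v ∉ link G F := Iff.rfl

theorem proj_mem_layer : AugVertex.proj L ∈ layer G 𝔉 F k ↔
    L ∈ 𝔉 ∧ L ≠ Set.univ ∧ ¬ L ⊆ link G F ∧ (F ⊆ L → rank 𝔉 L < k) := Iff.rfl

theorem vert_notMem_coneVerts : AugVertex.vert v ∉ coneVerts 𝔉 F k := id

theorem proj_mem_coneVerts : AugVertex.proj L ∈ coneVerts 𝔉 F k ↔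
    L ∈ 𝔉 ∧ L ≠ Set.univ ∧ F ⊆ L ∧ rank 𝔉 L = k := Iff.rfl

theorem layer_diff_coneVerts (k : ℕ) :
    layer G 𝔉 F (k + 1) \ coneVerts 𝔉 F k = layer G 𝔉 F k := by
  ext (v | L)
  · simp only [Set.mem_sdiff, vert_mem_layer, vert_notMem_coneVerts, not_false_eq_true, and_true]
  · simp only [Set.mem_sdiff, proj_mem_layer, proj_mem_coneVerts]
    grind

theorem coneVerts_subset_layer (hF : F.Nonempty) : coneVerts 𝔉 F k ⊆ layer G 𝔉 F (k + 1) := by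
  rintro (v | L) ha
  · exact absurd ha vert_notMem_coneVerts
  · obtain ⟨hL, hLu, hFL, hk⟩ := proj_mem_coneVerts.1 ha
    exact proj_mem_layer.2
      ⟨hL, hLu, not_subset_link_of_subset hF hFL, fun _ => hk ▸ Nat.lt_succ_self _⟩

theorem notMem_linkPart_of_mem_layer {a : AugVertex V} (ha : a ∈ layer G 𝔉 F k) :
    a ∉ linkPart G F := by
  rcases a with v | L
  exacts [mt vert_mem_linkPart.1 (vert_mem_layer.1 ha), (proj_mem_layer.1 ha).2.2.1]

theorem layer_of_le (h : IsFactorSystem n G 𝔉) (hk : n ≤ k) :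
    layer G 𝔉 F k = augVerts 𝔉 Set.univ \ linkPart G F := by
  ext (v | L)
  · simp only [vert_mem_layer, Set.mem_sdiff, vert_mem_augVerts, vert_mem_linkPart, Set.mem_univ,
      true_and]
  · simp only [proj_mem_layer, Set.mem_sdiff, proj_mem_augVerts, proj_mem_linkPart,
      Set.ssubset_univ_iff]
    have hrank : L ∈ 𝔉 → rank 𝔉 L < k := fun hL => (h.rank_lt hL).trans_le hk
    tauto

theorem augVerts_diff_linkPart_subset_layer (h : IsFactorSystem n G 𝔉) (hL : L ∈ 𝔉) :
    augVerts 𝔉 L \ linkPart G F ⊆ layer G 𝔉 F (rank 𝔉 L) := by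
  rintro (v | M) ⟨ha, haF⟩
  · exact vert_mem_layer.2 (mt vert_mem_linkPart.2 haF)
  · obtain ⟨hM, hML⟩ := proj_mem_augVerts.1 ha
    exact proj_mem_layer.2 ⟨hM, (hML.trans_subset (Set.subset_univ L)).ne, haF,
      fun _ => h.rank_lt_rank hM hL hML⟩

theorem layer_diff_singleton_subset_compVerts (h : IsFactorSystem n G 𝔉) (hL : L ∈ 𝔉)
    (hFL : F ⊆ L) : layer G 𝔉 F (rank 𝔉 L + 1) \ {.proj L} ⊆ compVerts G 𝔉 L := by
  have hlink : link G L ⊆ link G F := fun v hv f hf => hv f (hFL hf)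
  rintro (v | M) ⟨ha, haL⟩
  · exact vert_mem_compVerts.2 fun hv => vert_mem_layer.1 ha (hlink hv)
  · obtain ⟨hM, hMu, hMF, hrank⟩ := proj_mem_layer.1 ha
    refine proj_mem_compVerts.2 ⟨hM, hMu, fun hML => hMF (hML.trans hlink), fun hLM => ?_⟩
    have hne : L ≠ M := by
      rintro rfl
      exact haL rfl
    have hlt := h.rank_lt_rank hL hM (hLM.ssubset_of_ne hne)
    have hle := hrank (hFL.trans hLM)
    omega

theorem layer_rank_diff_singleton (h : IsFactorSystem n G 𝔉) (hF : F ∈ 𝔉) :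
    layer G 𝔉 F (rank 𝔉 F + 1) \ {.proj F} = compVerts G 𝔉 F := by
  refine (layer_diff_singleton_subset_compVerts h hF subset_rfl).antisymm ?_
  rintro (v | L) ha
  · exact ⟨vert_mem_layer.2 (vert_mem_compVerts.1 ha), by simp⟩
  · obtain ⟨hL, hLu, hLF, hFL⟩ := proj_mem_compVerts.1 ha
    refine ⟨proj_mem_layer.2 ⟨hL, hLu, hLF, fun h => absurd h hFL⟩, ?_⟩
    rintro ⟨⟩
    exact hFL subset_rfl

namespace IsDiscreteCHHF

theorem connectedOn_of_subset_layer (h : IsDiscreteCHHF G W 𝔉 n δ K) (hF : F.Nonempty)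
    {T : Set (AugVertex V)} (hT : ∀ v ∉ link G F, AugVertex.vert v ∈ T)
    (hT' : T ⊆ layer G 𝔉 F k) : ConnectedOn (augGraph G W) T :=
  h.connectedOn_of_disjoint_linkPart hF hT fun _ ha => notMem_linkPart_of_mem_layer (hT' ha)

theorem connectedOn_layer_diff_singleton (h : IsDiscreteCHHF G W 𝔉 n δ K) (hF : F.Nonempty)
    (L : Set V) (k : ℕ) : ConnectedOn (augGraph G W) (layer G 𝔉 F k \ {.proj L}) :=
  h.connectedOn_of_subset_layer hF
    (fun _ hv => ⟨vert_mem_layer.2 hv, by simp⟩) Set.sdiff_subset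

theorem distOn_diff_linkPart_le_layer (h : IsDiscreteCHHF G W 𝔉 n δ K) (hF : F.Nonempty)
    (hL : L ∈ 𝔉) (hFL : F ⊆ L) {x y : AugVertex V} (hx : x ∈ augVerts 𝔉 L \ linkPart G F)
    (hy : y ∈ augVerts 𝔉 L \ linkPart G F) :
    distOn (augGraph G W) (augVerts 𝔉 L \ linkPart G F) x y ≤
      (K + 8) * distOn (augGraph G W) (layer G 𝔉 F (rank 𝔉 L + 1) \ {.proj L}) x y + (K + 8) := by
  have hmem : augVerts 𝔉 L \ linkPart G F ⊆ layer G 𝔉 F (rank 𝔉 L + 1) \ {.proj L} := by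
    refine fun a ha => ⟨?_, ?_⟩
    · have hlayer := augVerts_diff_linkPart_subset_layer h.factorSystem hL ha
      rw [← layer_diff_coneVerts] at hlayer
      exact hlayer.1
    · rintro rfl
      exact ha.1.2.ne rfl
  have htrim := h.distOn_diff_linkPart_le hF hL hFL hx hy
  have hqi := h.qi L hL x hx.1 y hy.1
  have hanti := Nat.mul_le_mul_left K ((h.connectedOn_layer_diff_singleton hF L _).distOn_anti
    (layer_diff_singleton_subset_compVerts h.factorSystem hL hFL) (hmem hx) (hmem hy))
  rw [add_mul]
  omega

theorem isConed_layer (h : IsDiscreteCHHF G W 𝔉 n δ K) (hF : F.Nonempty)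
    (hyp : HyperbolicOn (augGraph G W) (layer G 𝔉 F (k + 1)) δ') :
    IsConed (augGraph G W) (layer G 𝔉 F (k + 1)) (coneVerts 𝔉 F k)
      (fun b => augVerts 𝔉 b.base \ linkPart G F) (max δ' (δ + 16)) (K + 8) where
  hyperbolic := hyp.mono (le_max_left _ _)
  subset := coneVerts_subset_layer hF
  indep := by
    rintro (v | L) hb (v' | L') hb'
    exacts [hb.elim, hb.elim, hb'.elim, not_augGraph_adj_proj_proj]
  conn := h.connectedOn_of_subset_layer hF
    (fun _ hv => ⟨vert_mem_layer.2 hv, vert_notMem_coneVerts⟩) Set.sdiff_subset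
  conn_diff := by
    rintro (v | L) hb
    exacts [hb.elim, h.connectedOn_layer_diff_singleton hF L (k + 1)]
  base_subset := by
    rintro (v | L) hb
    · exact hb.elim
    · obtain ⟨hL, -, -, rfl⟩ := proj_mem_coneVerts.1 hb
      rw [layer_diff_coneVerts]
      exact augVerts_diff_linkPart_subset_layer h.factorSystem hL
  mem_base := by
    rintro (v | L) hb (u | M) hu hadj
    · exact hb.elim
    · exact hb.elim
    · exact ⟨vert_mem_augVerts.2 (augGraph_adj_vert_proj.1 hadj), notMem_linkPart_of_mem_layer hu⟩
    · exact absurd hadj not_augGraph_adj_proj_proj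
  base_hyperbolic := by
    rintro (v | L) hb
    · exact hb.elim
    · obtain ⟨hL, -, hFL, -⟩ := proj_mem_coneVerts.1 hb
      exact (h.hyperbolicOn_diff_linkPart hF hL hFL).mono (le_max_right _ _)
  qi := by
    rintro (v | L) hb x hx y hy
    · exact hb.elim
    · obtain ⟨hL, -, hFL, rfl⟩ := proj_mem_coneVerts.1 hb
      exact h.distOn_diff_linkPart_le_layer hF hL hFL hx hy

end IsDiscreteCHHF

theorem exists_hyperbolicOn_layer (n δ K j : ℕ) : ∃ δ', ∀ {V : Type u} {G : SimpleGraph V}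
    {W : SimpleGraph (MaxClique G Set.univ)} {𝔉 : Set (Set V)}, IsDiscreteCHHF G W 𝔉 n δ K →
    ∀ F ∈ 𝔉, ∀ k, n ≤ k + j → HyperbolicOn (augGraph G W) (layer G 𝔉 F k) δ' := by
  induction j with
  | zero =>
    refine ⟨δ + 16, fun {V G W 𝔉} h F hF k hk => ?_⟩
    rw [layer_of_le h.factorSystem (by omega)]
    exact h.hyperbolicOn_diff_linkPart (h.factorSystem.nonempty F hF) h.factorSystem.univ_mem
      (Set.subset_univ F)
  | succ j ih =>
    obtain ⟨δ', hlayer⟩ := ih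
    obtain ⟨δ'', hdecone⟩ := exists_hyperbolicOn_of_isConed.{u} (max δ' (δ + 16)) (K + 8)
    refine ⟨δ'', fun {V G W 𝔉} h F hF k hk => ?_⟩
    rw [← layer_diff_coneVerts]
    exact hdecone (h.isConed_layer (h.factorSystem.nonempty F hF)
      (hlayer h F hF (k + 1) (by omega)))

end Layers

section ClosestPoint

variable {U : Type u} {H : SimpleGraph U} {S C : Set U} {b x y c d u a : U} {δ σ : ℕ}

/-- `c` is, up to an error of `3`, a vertex of `C` closest to `x` in the subgraph induced on `S`.
The error leaves room for the coarseness of `closestPoint` and for passing to nearby vertices. -/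
def AlmostClosest (H : SimpleGraph U) (S C : Set U) (x c : U) : Prop :=
  c ∈ C ∧ ∀ a ∈ C, distOn H S x c ≤ distOn H S x a + 3

theorem HyperbolicOn.entry_close_of_almost_closest (h : HyperbolicOn H S δ) (hb : b ∈ S)
    (hc : ConnectedOn H (S \ {b})) (hx : x ∈ S \ {b}) (hu : IsEntry H S b x u)
    (ha : a ∈ S) (hab : H.Adj a b)
    (hle : distOn H (S \ {b}) x a ≤ distOn H (S \ {b}) x u + σ) :
    distOn H (S \ {b}) a u ≤ 6 * δ + 2 * σ + 4 := by
  have haS : a ∈ S \ {b} := ⟨ha, hab.ne⟩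
  have hxu := hu.distOn_diff_lt h.conn hb hx.1
  have hab' := distOn_eq_one ha hb hab
  have hxab := h.conn.triangle hx.1 ha b
  have hxa := hc.distOn_anti Set.sdiff_subset hx haS
  by_cases hnear : distOn H (S \ {b}) x a ≤ δ + 1 + σ
  · have haxu := hc.triangle haS hx u
    rw [distOn_comm a x] at haxu
    omega
  -- The entry point from `p`, near the end of a geodesic from `x` to `a`, is close to both.
  obtain ⟨p, hp, hxp, hpa⟩ := hc.exists_onGeodesic hx haS
    (k := distOn H (S \ {b}) x a - (δ + 1 + σ)) (by omega)
  obtain ⟨w, hw⟩ := h.conn.exists_isEntry hb hp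
  have hpw := hw.distOn_diff_lt h.conn hb hp.1
  have hxp' := hc.distOn_anti Set.sdiff_subset hx hp
  have hpa' := hc.distOn_anti Set.sdiff_subset hp haS
  have hxpb := h.conn.triangle hx.1 hp.1 b
  have hpab := h.conn.triangle hp.1 ha b
  have huw := h.entry_close_of_product hb hc hx.1 hp.1 (R := δ + 1) (by omega) (by omega) hu hw
  have hapu := hc.triangle haS hp u
  have hpwu := hc.triangle hp hw.mem_diff u
  rw [distOn_comm a p] at hapu
  rw [distOn_comm w] at hpwu
  omega

theorem HyperbolicOn.entry_lipschitz (h : HyperbolicOn H S δ) (hb : b ∈ S)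
    (hc : ConnectedOn H (S \ {b})) (hx : x ∈ S \ {b}) (hy : y ∈ S \ {b}) :
    distOn H (S \ {b}) (entry H S b x) (entry H S b y) ≤
      (36 * δ + 28) * distOn H (S \ {b}) x y := by
  have hentry {x : U} (hx : x ∈ S \ {b}) := h.conn.isEntry_entry hb hx
  refine hc.le_mul_distOn (f := fun x y => distOn H (S \ {b}) (entry H S b x) (entry H S b y))
    (fun x _ => distOn_self _)
    (fun x hx y hy z _ => hc.triangle (hentry hx).mem_diff (hentry hy).mem_diff _)
    (fun x hx y hy hxy => h.entry_close hb hc hx hy ?_ (hentry hx) (hentry hy)) hx hy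
  rw [distOn_eq_one hx hy hxy, distOn_eq_one hx.1 hy.1 hxy]

theorem HyperbolicOn.almostClosest_entry_close (h : HyperbolicOn H S δ) (hb : b ∈ S)
    (hconn : ConnectedOn H (S \ {b})) (hC : C ⊆ S \ {b})
    (hCb : ∀ c ∈ C, ∃ a ∈ C, H.Adj a b ∧ (c = a ∨ H.Adj c a)) (hx : x ∈ S \ {b})
    (hu : IsEntry H S b x u) (huC : u ∈ C) (hc : AlmostClosest H (S \ {b}) C x c) :
    distOn H (S \ {b}) c u ≤ 6 * δ + 13 := by
  obtain ⟨hcC, hmin⟩ := hc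
  obtain ⟨a, ha, hab, hca⟩ := hCb c hcC
  have hca := distOn_le_one (hC hcC) (hC ha) hca
  have hxu := hmin u huC
  have hxca := hconn.triangle hx (hC hcC) a
  have hau := h.entry_close_of_almost_closest hb hconn (σ := 4) hx hu (hC ha).1 hab (by omega)
  have hcau := hconn.triangle (hC hcC) (hC ha) u
  omega

theorem HyperbolicOn.almostClosest_lipschitz (h : HyperbolicOn H S δ) (hb : b ∈ S)
    (hconn : ConnectedOn H (S \ {b})) (hC : C ⊆ S \ {b}) (hbC : ∀ u, H.Adj u b → u ∈ C)
    (hCb : ∀ c ∈ C, ∃ a ∈ C, H.Adj a b ∧ (c = a ∨ H.Adj c a)) (hx : x ∈ S \ {b})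
    (hy : y ∈ S \ {b}) (hc : AlmostClosest H (S \ {b}) C x c)
    (hd : AlmostClosest H (S \ {b}) C y d) :
    distOn H (S \ {b}) c d ≤ (36 * δ + 28) * distOn H (S \ {b}) x y + (12 * δ + 26) := by
  have hex := h.conn.isEntry_entry hb hx
  have hey := h.conn.isEntry_entry hb hy
  have hce := h.almostClosest_entry_close hb hconn hC hCb hx hex (hbC _ hex.adj) hc
  have hde := h.almostClosest_entry_close hb hconn hC hCb hy hey (hbC _ hey.adj) hd
  have hee := h.entry_lipschitz hb hconn hx hy
  have htri := hconn.triangle (hC hc.1) hex.mem_diff d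
  have htri' := hconn.triangle hex.mem_diff hey.mem_diff d
  rw [distOn_comm (entry H S b y) d] at htri'
  omega

end ClosestPoint

section DomainProjection

variable {V : Type u} {G : SimpleGraph V} {W : SimpleGraph (MaxClique G Set.univ)}
  {𝔉 : Set (Set V)} {n δ δ' K M : ℕ} {F : Set V}

/-- The closest-point projection from the vertices of `Y_F` to those of `CF`, in the coarse sense of
`AlmostClosest`, is coarsely Lipschitz with constant `M`. -/
def ClosestPointLipschitz (G : SimpleGraph V) (W : SimpleGraph (MaxClique G Set.univ))
    (𝔉 : Set (Set V)) (F : Set V) (M : ℕ) : Prop :=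
  ∀ x ∈ compVerts G 𝔉 F, ∀ y ∈ compVerts G 𝔉 F, ∀ c d,
    AlmostClosest (augGraph G W) (compVerts G 𝔉 F) (augVerts 𝔉 F) x c →
    AlmostClosest (augGraph G W) (compVerts G 𝔉 F) (augVerts 𝔉 F) y d →
    distOn (augGraph G W) (augVerts 𝔉 F) c d ≤
      M * distOn (augGraph G W) (compVerts G 𝔉 F) x y + M

namespace IsDiscreteCHHF

theorem closestPointLipschitz_univ (h : IsDiscreteCHHF G W 𝔉 n δ K) (hM : 6 ≤ M) :
    ClosestPointLipschitz G W 𝔉 Set.univ M := by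
  intro x hx y hy c d hc hd
  have hconn := (h.hyperbolic _ h.factorSystem.univ_mem).conn
  rw [h.factorSystem.compVerts_univ] at *
  have hxc := hc.2 x hx
  have hyd := hd.2 y hy
  rw [distOn_self] at hxc hyd
  have hcxd := hconn.triangle hc.1 hx d
  have hxyd := hconn.triangle hx hy d
  rw [distOn_comm c x] at hcxd
  have hmul := Nat.le_mul_of_pos_left
    (distOn (augGraph G W) (augVerts 𝔉 Set.univ) x y) (by omega : 0 < M)
  omega

theorem closestPointLipschitz_of_hyperbolicOn_layer (h : IsDiscreteCHHF G W 𝔉 n δ K) (hF : F ∈ 𝔉)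
    (hFu : F ≠ Set.univ) (hlayer : HyperbolicOn (augGraph G W) (layer G 𝔉 F (rank 𝔉 F + 1)) δ')
    (hM : K * (36 * δ' + 28) + K * (12 * δ' + 26) + K ≤ M) : ClosestPointLipschitz G W 𝔉 F M := by
  intro x hx y hy c d hc hd
  have hne := h.factorSystem.nonempty F hF
  have hconn := h.connectedOn_compVerts hne
  have hsub : augVerts 𝔉 F ⊆ compVerts G 𝔉 F := h.factorSystem.augVerts_subset_compVerts F
  have hb : AugVertex.proj F ∈ layer G 𝔉 F (rank 𝔉 F + 1) :=
    proj_mem_layer.2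
      ⟨hF, hFu, not_subset_link_of_subset hne subset_rfl, fun _ => Nat.lt_succ_self _⟩
  have hbC : ∀ u, (augGraph G W).Adj u (.proj F) → u ∈ augVerts 𝔉 F := by
    rintro (v | L) hadj
    exacts [vert_mem_augVerts.2 (augGraph_adj_vert_proj.1 hadj),
      absurd hadj not_augGraph_adj_proj_proj]
  have hCb : ∀ c ∈ augVerts 𝔉 F, ∃ a ∈ augVerts 𝔉 F, (augGraph G W).Adj a (.proj F) ∧
      (c = a ∨ (augGraph G W).Adj c a) := by
    intro c hc
    obtain ⟨v, hv⟩ := h.factorSystem.base_nonempty hc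
    have hvF := base_subset_of_mem_augVerts hc hv
    exact ⟨.vert v, hvF, augGraph_adj_vert_proj.2 hvF, eq_or_augGraph_adj_of_mem_base hv⟩
  have hqi := h.qi F hF c hc.1 d hd.1
  rw [← layer_rank_diff_singleton h.factorSystem hF] at *
  have hlip := Nat.mul_le_mul_left K
    (hlayer.almostClosest_lipschitz hb hconn hsub hbC hCb hx hy hc hd)
  rw [mul_add, ← mul_assoc] at hlip
  have hmul := Nat.mul_le_mul_right
    (distOn (augGraph G W) (layer G 𝔉 F (rank 𝔉 F + 1) \ {.proj F}) x y)
    (by omega : K * (36 * δ' + 28) ≤ M)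
  omega

end IsDiscreteCHHF

theorem exists_closestPointLipschitz (n δ K : ℕ) : ∃ M, ∀ {V : Type u} {G : SimpleGraph V}
    {W : SimpleGraph (MaxClique G Set.univ)} {𝔉 : Set (Set V)}, IsDiscreteCHHF G W 𝔉 n δ K →
    ∀ F ∈ 𝔉, ClosestPointLipschitz G W 𝔉 F M := by
  obtain ⟨δ', hlayer⟩ := exists_hyperbolicOn_layer.{u} n δ K n
  refine ⟨K * (36 * δ' + 28) + K * (12 * δ' + 26) + K + 6, fun {V G W 𝔉} h F hF => ?_⟩
  by_cases hFu : F = Set.univ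
  · subst hFu
    exact h.closestPointLipschitz_univ (by omega)
  · exact h.closestPointLipschitz_of_hyperbolicOn_layer hF hFu
      (hlayer h F hF (rank 𝔉 F + 1) (by omega)) (by omega)

end DomainProjection

/-! ## The proto-hierarchy structure -/

section Assembly

variable {V : Type u} {G : SimpleGraph V} {W : SimpleGraph (MaxClique G Set.univ)}
  {𝔉 : Set (Set V)} {n δ K M : ℕ} {F F' : Set V} {v : V} {w w' : MaxClique G Set.univ}
  {a a' c : AugVertex V}

theorem IsCHHF.isDiscreteCHHF {δ : ℝ} (h : IsCHHF G W 𝔉 n δ) :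
    IsDiscreteCHHF G W 𝔉 n ⌈2 * δ⌉₊ ⌈δ + δ ^ 2⌉₊ := by
  have hδ := h.hyperbolicity.pos
  refine ⟨h.factorSystem, h.hierarchy, fun F hF => ⟨?_, ?_⟩, ?_⟩
  · exact connectedOn_of_isMetric (h.hyperbolicity.hyperbolic F hF).isGeodesicSpace.isMetric
  · intro x hx y hy z hz w hw
    have hfour := (h.hyperbolicity.hyperbolic F hF).four_point ⟨_, vertexPoint_mem hx⟩
      ⟨_, vertexPoint_mem hy⟩ ⟨_, vertexPoint_mem hz⟩ ⟨_, vertexPoint_mem hw⟩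
    simp only [augDist, realizationDist_vertexPoint, hx, hy, hz, hw] at hfour
    exact_mod_cast hfour.trans (add_le_add_right (Nat.le_ceil (2 * δ)) _)
  · intro F hF x hx y hy
    have hsub := h.factorSystem.augVerts_subset_compVerts F
    have hqi := (h.hyperbolicity.qi_embedded F hF ⟨_, vertexPoint_mem hx⟩
      ⟨_, vertexPoint_mem hy⟩).1
    simp only [augDist, compDist, realizationDist_vertexPoint, hx, hy, hsub hx, hsub hy] at hqi
    rw [sub_le_iff_le_add, div_le_iff₀ hδ] at hqi
    have hδK : δ ≤ ⌈δ + δ ^ 2⌉₊ := (le_add_of_nonneg_right (sq_nonneg δ)).trans (Nat.le_ceil _)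
    have hδK' : δ ^ 2 ≤ ⌈δ + δ ^ 2⌉₊ := (le_add_of_nonneg_left hδ.le).trans (Nat.le_ceil _)
    have hmul := mul_le_mul_of_nonneg_right hδK
      (Nat.cast_nonneg (distOn (augGraph G W) (compVerts G 𝔉 F) x y))
    rw [← Nat.cast_le (α := ℝ)]
    push_cast
    linarith

theorem DiamLE.mono {C : Type*} {d : C → C → ℝ} {s : Set C} {r r' : ℝ} (h : DiamLE d s r)
    (hr : r ≤ r') : DiamLE d s r' :=
  fun x hx y hy => (h x hx y hy).trans hr

theorem closestPoint_nonempty (hF : F.Nonempty) (x : AugVertex V → ℝ) :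
    (closestPoint G W 𝔉 F x).Nonempty := by
  obtain ⟨f, hf⟩ := hF
  have : Nonempty (AugSpace G W 𝔉 F) := ⟨⟨_, vertexPoint_mem (vert_mem_augVerts.2 hf)⟩⟩
  obtain ⟨y, hy⟩ := exists_lt_of_ciInf_lt
    (lt_add_one (⨅ z : AugSpace G W 𝔉 F, compDist G W 𝔉 F x z.1))
  exact ⟨y, hy.le⟩

theorem IsFactorSystem.vertexPoint_mem_closestPoint (h : IsFactorSystem n G 𝔉)
    (ha : a ∈ augVerts 𝔉 F) : ⟨vertexPoint a, vertexPoint_mem ha⟩ ∈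
      closestPoint G W 𝔉 F (vertexPoint a) := by
  have hsub := h.augVerts_subset_compVerts F
  have haY : vertexPoint a ∈ realization (augGraph G W) (compVerts G 𝔉 F) :=
    vertexPoint_mem (hsub ha)
  refine (realizationDist_self haY).trans_le (add_nonneg (Real.iInf_nonneg fun z => ?_) zero_le_one)
  exact realizationDist_nonneg haY (realization_mono hsub z.2)

namespace IsDiscreteCHHF

theorem almostClosest_of_mem_closestPoint (h : IsDiscreteCHHF G W 𝔉 n δ K) (hF : F.Nonempty)
    (ha : a ∈ compVerts G 𝔉 F) {y : AugSpace G W 𝔉 F}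
    (hy : y ∈ closestPoint G W 𝔉 F (vertexPoint a)) (hc : y.1 c ≠ 0) :
    AlmostClosest (augGraph G W) (compVerts G 𝔉 F) (augVerts 𝔉 F) a c := by
  have hsub := h.factorSystem.augVerts_subset_compVerts F
  have haY : vertexPoint a ∈ realization (augGraph G W) (compVerts G 𝔉 F) := vertexPoint_mem ha
  refine ⟨mem_of_coord_ne_zero y.2 hc, fun d hd => ?_⟩
  have hclosest : compDist G W 𝔉 F (vertexPoint a) y.1 ≤
      distOn (augGraph G W) (compVerts G 𝔉 F) a d + 1 := by
    rw [← realizationDist_vertexPoint ha (hsub hd)]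
    refine (hy : compDist G W 𝔉 F (vertexPoint a) y.1 ≤ _).trans (add_le_add_left ?_ 1)
    refine ciInf_le (f := fun z : AugSpace G W 𝔉 F => compDist G W 𝔉 F (vertexPoint a) z.1)
      ⟨0, ?_⟩ ⟨vertexPoint d, vertexPoint_mem hd⟩
    rintro _ ⟨z, rfl⟩
    exact realizationDist_nonneg haY (realization_mono hsub z.2)
  have hnear := distOn_le_realizationDist_add_two (h.connectedOn_compVerts hF) haY
    (realization_mono hsub y.2) (vertexPoint_self_ne_zero a) hc
  rw [← Nat.cast_le (α := ℝ)]
  push_cast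
  exact hnear.trans ((add_le_add_left hclosest 2).trans (by linarith))

theorem augDist_closestPoint_le (h : IsDiscreteCHHF G W 𝔉 n δ K) (hF : F ∈ 𝔉)
    (hM : ClosestPointLipschitz G W 𝔉 F M) (ha : a ∈ compVerts G 𝔉 F)
    (ha' : a' ∈ compVerts G 𝔉 F) {y y' : AugSpace G W 𝔉 F}
    (hy : y ∈ closestPoint G W 𝔉 F (vertexPoint a))
    (hy' : y' ∈ closestPoint G W 𝔉 F (vertexPoint a')) :
    augDist G W 𝔉 F y y' ≤
      M * distOn (augGraph G W) (compVerts G 𝔉 F) a a' + M + 2 := by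
  have hne := h.factorSystem.nonempty F hF
  obtain ⟨c, hc⟩ := exists_coord_ne_zero y.2
  obtain ⟨c', hc'⟩ := exists_coord_ne_zero y'.2
  have hdist := hM a ha a' ha' c c' (h.almostClosest_of_mem_closestPoint hne ha hy hc)
    (h.almostClosest_of_mem_closestPoint hne ha' hy' hc')
  refine (realizationDist_le_distOn_add_two (h.hyperbolic F hF).conn y.2 y'.2 hc hc').trans ?_
  gcongr
  exact_mod_cast hdist

end IsDiscreteCHHF

theorem mem_closestPointVerts {A : Set (AugVertex V)} {y : AugSpace G W 𝔉 F} :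
    y ∈ closestPointVerts G W 𝔉 F A ↔ ∃ a ∈ A, y ∈ closestPoint G W 𝔉 F (vertexPoint a) :=
  Set.mem_iUnion₂.trans (by simp only [exists_prop])

-- The projection to `CX` fits the pattern of the others, as `v` is a closest point to itself.
theorem IsFactorSystem.exists_mem_closestPoint_of_mem_cliqueProj (h : IsFactorSystem n G 𝔉)
    {y : AugSpace G W 𝔉 F} (hy : y ∈ cliqueProj G W 𝔉 F w) :
    ∃ v ∈ w.1 \ link G F, y ∈ closestPoint G W 𝔉 F (vertexPoint (.vert v)) := by
  rcases hy with ⟨rfl, v, hv, hyv⟩ | ⟨-, hy⟩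
  · refine ⟨v, ⟨hv, notMem_link_of_mem (Set.mem_univ v)⟩, ?_⟩
    obtain rfl : y = ⟨_, vertexPoint_mem (vert_mem_augVerts.2 (Set.mem_univ v))⟩ :=
      Subtype.ext hyv
    exact h.vertexPoint_mem_closestPoint (vert_mem_augVerts.2 (Set.mem_univ v))
  · obtain ⟨_, ⟨⟨v, hv, rfl⟩, hvY⟩, hy⟩ := mem_closestPointVerts.1 hy
    exact ⟨v, ⟨hv, vert_mem_compVerts.1 hvY⟩, hy⟩

theorem IsFactorSystem.vertexPoint_mem_cliqueProj (h : IsFactorSystem n G 𝔉) (hv : v ∈ F)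
    (hvw : v ∈ w.1) : ⟨vertexPoint (.vert v), vertexPoint_mem (vert_mem_augVerts.2 hv)⟩ ∈
      cliqueProj G W 𝔉 F w := by
  by_cases hF : F = Set.univ
  · exact Or.inl ⟨hF, v, hvw, rfl⟩
  · refine Or.inr ⟨hF, mem_closestPointVerts.2 ⟨.vert v, ⟨⟨v, hvw, rfl⟩, ?_⟩, ?_⟩⟩
    · exact vert_mem_compVerts.2 (notMem_link_of_mem hv)
    · exact h.vertexPoint_mem_closestPoint (vert_mem_augVerts.2 hv)

theorem cliqueProj_nonempty (hF : F.Nonempty) (w : MaxClique G Set.univ) :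
    (cliqueProj G W 𝔉 F w).Nonempty := by
  obtain ⟨v, hvw, hv⟩ := w.exists_notMem_link (Set.subset_univ F) hF
  by_cases hFu : F = Set.univ
  · exact ⟨⟨_, vertexPoint_mem (vert_mem_augVerts.2 (hFu ▸ Set.mem_univ v))⟩,
      Or.inl ⟨hFu, v, hvw, rfl⟩⟩
  · obtain ⟨y, hy⟩ := closestPoint_nonempty (G := G) (W := W) (𝔉 := 𝔉) hF
      (vertexPoint (.vert v))
    exact ⟨y, Or.inr ⟨hFu, mem_closestPointVerts.2
      ⟨.vert v, ⟨⟨v, hvw, rfl⟩, vert_mem_compVerts.2 hv⟩, hy⟩⟩⟩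

theorem joinedWithin_of_mem_projPart {f : V} (hf : f ∈ F) (hfF' : f ∉ link G F')
    (ha : a ∈ projPart G 𝔉 F ∩ compVerts G 𝔉 F') :
    JoinedWithin (augGraph G W) (compVerts G 𝔉 F') 2 a (.vert f) := by
  have hfY : AugVertex.vert f ∈ compVerts G 𝔉 F' := vert_mem_compVerts.2 hfF'
  have link_joined : ∀ v ∈ link G F, v ∉ link G F' →
      JoinedWithin (augGraph G W) (compVerts G 𝔉 F') 1 (.vert v) (.vert f) := fun v hv hvF' =>
    joinedWithin_one (vert_mem_compVerts.2 hvF') hfY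
      (Or.inr (augGraph_adj_vert_vert.2 ⟨(hv f hf).ne', Or.inl (hv f hf).symm⟩))
  obtain ⟨haP, haY⟩ := ha
  rcases a with v | L
  · exact (link_joined v haP (vert_mem_compVerts.1 haY)).mono (by omega)
  · obtain ⟨-, hL | hL⟩ := haP
    · obtain ⟨v, hv, hvF'⟩ := Set.not_subset.1 (proj_mem_compVerts.1 haY).2.2.1
      exact (joinedWithin_one haY (vert_mem_compVerts.2 hvF')
        (Or.inr (augGraph_adj_proj_vert.2 hv))).trans (link_joined v (hL hv) hvF')
    · exact (joinedWithin_one haY hfY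
        (Or.inr (augGraph_adj_proj_vert.2 (hL.1 hf)))).mono (by omega)

theorem proj_mem_projPart_inter_compVerts (hF : F ∈ 𝔉) (hlink : ¬ F ⊆ link G F')
    (hsub : ¬ F' ⊆ F) : AugVertex.proj F ∈ projPart G 𝔉 F ∩ compVerts G 𝔉 F' := by
  have hne : F ≠ Set.univ := fun e => hsub (e ▸ Set.subset_univ _)
  exact ⟨⟨hF, Or.inr ⟨subset_rfl, hne⟩⟩, proj_mem_compVerts.2 ⟨hF, hne, hlink, hsub⟩⟩

end Assembly

section ProtoData

variable {V : Type u} {G : SimpleGraph V} {W : SimpleGraph (MaxClique G Set.univ)}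
  {𝔉 : Set (Set V)} {n δ K M : ℕ} {F F' : 𝔉} {E : ℝ}

namespace IsDiscreteCHHF

theorem proj_nonempty (h : IsDiscreteCHHF G W 𝔉 n δ K) (F : 𝔉) (p : realization W Set.univ) :
    ((protoData G W 𝔉).proj F p).Nonempty := by
  obtain ⟨w, hw⟩ := exists_coord_ne_zero p.2
  obtain ⟨y, hy⟩ := cliqueProj_nonempty (h.factorSystem.nonempty F.1 F.2) w
  exact ⟨y, Set.mem_iUnion₂.2 ⟨w, hw, hy⟩⟩

theorem dist_proj_le (h : IsDiscreteCHHF G W 𝔉 n δ K) (hM : ClosestPointLipschitz G W 𝔉 F M)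
    (p q : realization W Set.univ) :
    ∀ a ∈ (protoData G W 𝔉).proj F p, ∀ b ∈ (protoData G W 𝔉).proj F q,
      (protoData G W 𝔉).dC F a b ≤ M * (protoData G W 𝔉).dX p q + (4 * M + 2) := by
  intro a ha b hb
  obtain ⟨w, hw, ha⟩ := Set.mem_iUnion₂.1 ha
  obtain ⟨w', hw', hb⟩ := Set.mem_iUnion₂.1 hb
  obtain ⟨u, hu, ha⟩ := h.factorSystem.exists_mem_closestPoint_of_mem_cliqueProj ha
  obtain ⟨v, hv, hb⟩ := h.factorSystem.exists_mem_closestPoint_of_mem_cliqueProj hb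
  have hclosest := h.augDist_closestPoint_le F.2 hM (vert_mem_compVerts.2 hu.2)
    (vert_mem_compVerts.2 hv.2) ha hb
  have huv : (distOn (augGraph G W) (compVerts G 𝔉 F) (.vert u) (.vert v) : ℝ) ≤
      distOn W Set.univ w w' + 1 := by
    exact_mod_cast (h.joinedWithin_of_distOn_cliques (h.factorSystem.nonempty F.1 F.2)
      (fun v hv => vert_mem_compVerts.2 hv) rfl hu hv).2
  have hww' := distOn_le_realizationDist_add_two h.connectedOn_cliques p.2 q.2 hw hw'
  calc augDist G W 𝔉 F a b
    _ ≤ M * (distOn W Set.univ w w' + 1) + M + 2 := hclosest.trans (by gcongr)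
    _ ≤ M * (realizationDist W Set.univ p.1 q.1 + 2 + 1) + M + 2 := by gcongr
    _ = M * realizationDist W Set.univ p.1 q.1 + (4 * M + 2) := by ring

theorem diamLE_proj (h : IsDiscreteCHHF G W 𝔉 n δ K) (hM : ClosestPointLipschitz G W 𝔉 F M)
    (p : realization W Set.univ) :
    DiamLE ((protoData G W 𝔉).dC F) ((protoData G W 𝔉).proj F p) (4 * M + 2) := by
  intro a ha b hb
  have hdist := h.dist_proj_le hM p p a ha b hb
  rwa [show (protoData G W 𝔉).dX p p = 0 from realizationDist_self p.2, mul_zero, zero_add]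
    at hdist

theorem proj_coarsely_onto (h : IsDiscreteCHHF G W 𝔉 n δ K) (hE : 3 ≤ E) (F : 𝔉)
    (y : AugSpace G W 𝔉 F.1) :
    y ∈ nbhd ((protoData G W 𝔉).dC F) E (⋃ p, (protoData G W 𝔉).proj F p) := by
  obtain ⟨c, hc⟩ := exists_coord_ne_zero y.2
  have hcF := mem_of_coord_ne_zero y.2 hc
  obtain ⟨v, hv⟩ := h.factorSystem.base_nonempty hcF
  have hvF := base_subset_of_mem_augVerts hcF hv
  have hvm : AugVertex.vert v ∈ augVerts 𝔉 F.1 := vert_mem_augVerts.2 hvF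
  obtain ⟨w, hw⟩ := exists_maxClique_mem (G := G) (Set.mem_univ v)
  refine ⟨⟨vertexPoint (.vert v), vertexPoint_mem hvm⟩,
    Set.mem_iUnion.2 ⟨⟨vertexPoint w, vertexPoint_mem (Set.mem_univ w)⟩, Set.mem_iUnion₂.2
      ⟨w, vertexPoint_self_ne_zero w, h.factorSystem.vertexPoint_mem_cliqueProj hvF hw⟩⟩, ?_⟩
  have hdist := realizationDist_le_distOn_add_two (h.hyperbolic F.1 F.2).conn y.2
    (vertexPoint_mem hvm) hc (vertexPoint_self_ne_zero _)
  have hle : (distOn (augGraph G W) (augVerts 𝔉 F.1) c (.vert v) : ℝ) ≤ 1 := by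
    exact_mod_cast distOn_le_one hcF hvm (eq_or_augGraph_adj_of_mem_base hv)
  exact hdist.trans (by linarith)

theorem rel_nonempty (h : IsDiscreteCHHF G W 𝔉 n δ K) (hlink : ¬ F.1 ⊆ link G F'.1)
    (hsub : ¬ F'.1 ⊆ F.1) : ((protoData G W 𝔉).rel F F').Nonempty := by
  obtain ⟨y, hy⟩ := closestPoint_nonempty (h.factorSystem.nonempty F'.1 F'.2)
    (vertexPoint (.proj F.1))
  exact ⟨y, mem_closestPointVerts.2
    ⟨_, proj_mem_projPart_inter_compVerts F.2 hlink hsub, hy⟩⟩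

theorem diamLE_rel (h : IsDiscreteCHHF G W 𝔉 n δ K) (hM : ClosestPointLipschitz G W 𝔉 F' M)
    (hlink : ¬ F.1 ⊆ link G F'.1) :
    DiamLE ((protoData G W 𝔉).dC F') ((protoData G W 𝔉).rel F F') (5 * M + 2) := by
  intro y hy y' hy'
  obtain ⟨a, ha, hy⟩ := mem_closestPointVerts.1 hy
  obtain ⟨a', ha', hy'⟩ := mem_closestPointVerts.1 hy'
  obtain ⟨f, hf, hfF'⟩ := Set.not_subset.1 hlink
  have haa' : (distOn (augGraph G W) (compVerts G 𝔉 F'.1) a a' : ℝ) ≤ 4 := by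
    exact_mod_cast ((joinedWithin_of_mem_projPart hf hfF' ha).trans
      (joinedWithin_of_mem_projPart hf hfF' ha').symm).2
  calc augDist G W 𝔉 F' y y'
    _ ≤ M * distOn (augGraph G W) (compVerts G 𝔉 F'.1) a a' + M + 2 :=
      h.augDist_closestPoint_le F'.2 hM ha.2 ha'.2 hy hy'
    _ ≤ M * 4 + M + 2 := by gcongr
    _ = 5 * M + 2 := by ring

-- A point of `CF'` outside `Y_F` has a vertex of `PF` in its support, and that vertex is one of the
-- points of `ρ^F_F'`.
theorem relMap_nonempty (h : IsDiscreteCHHF G W 𝔉 n δ K) (hE : 2 ≤ E)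
    {x : AugSpace G W 𝔉 F'.1}
    (hx : x ∉ nbhd ((protoData G W 𝔉).dC F') E ((protoData G W 𝔉).rel F F')) :
    ((protoData G W 𝔉).relMap F' F x).Nonempty := by
  obtain ⟨y, hy⟩ := closestPoint_nonempty (h.factorSystem.nonempty F.1 F.2) x.1
  refine ⟨y, mem_realization_of_coord_ne_zero x.2 fun a ha => ?_, hy⟩
  have haF' := mem_of_coord_ne_zero x.2 ha
  refine ⟨augVerts_mono (Set.subset_univ _) haF', fun haP => hx ?_⟩
  refine ⟨⟨vertexPoint a, vertexPoint_mem haF'⟩, mem_closestPointVerts.2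
    ⟨a, ⟨haP, h.factorSystem.augVerts_subset_compVerts F'.1 haF'⟩,
      h.factorSystem.vertexPoint_mem_closestPoint haF'⟩, ?_⟩
  have hdist := realizationDist_le_distOn_add_two (h.hyperbolic F'.1 F'.2).conn x.2
    (vertexPoint_mem haF') ha (vertexPoint_self_ne_zero a)
  rw [distOn_self, Nat.cast_zero, zero_add] at hdist
  exact hdist.trans hE

theorem rel_nonempty_and_diamLE (h : IsDiscreteCHHF G W 𝔉 n δ K)
    (hM : ClosestPointLipschitz G W 𝔉 F' M) (hlink : ¬ F.1 ⊆ link G F'.1)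
    (hsub : ¬ F'.1 ⊆ F.1) : ((protoData G W 𝔉).rel F F').Nonempty ∧
      DiamLE ((protoData G W 𝔉).dC F') ((protoData G W 𝔉).rel F F') (5 * M + 3) :=
  ⟨h.rel_nonempty hlink hsub, (h.diamLE_rel hM hlink).mono (by linarith)⟩

theorem rel_nonempty_and_diamLE_of_pnest (h : IsDiscreteCHHF G W 𝔉 n δ K)
    (hM : ClosestPointLipschitz G W 𝔉 F' M) (hFF' : (protoData G W 𝔉).pnest F F') :
    ((protoData G W 𝔉).rel F F').Nonempty ∧
      DiamLE ((protoData G W 𝔉).dC F') ((protoData G W 𝔉).rel F F') (5 * M + 3) :=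
  h.rel_nonempty_and_diamLE hM
    (fun hlink => not_subset_link_of_subset (h.factorSystem.nonempty F.1 F.2) hFF'.1
      (subset_link_comm.1 hlink))
    fun hF'F => hFF'.2 (Subtype.ext (hFF'.1.antisymm hF'F))

theorem isProtoHierarchy (h : IsDiscreteCHHF G W 𝔉 n δ K)
    (hC : ∀ F ∈ 𝔉, IsGeodesicSpace (augDist G W 𝔉 F))
    (hM : ∀ F ∈ 𝔉, ClosestPointLipschitz G W 𝔉 F M) :
    IsProtoHierarchy (5 * M + 3 : ℝ) (protoData G W 𝔉) where
  E_pos := by positivity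
  quasiGeodesic := isQuasiGeodesicSpace_realization h.connectedOn_cliques
  geodesic F := hC F.1 F.2
  proj_nonempty := h.proj_nonempty
  proj_diam F p := (h.diamLE_proj (hM F.1 F.2) p).mono (by linarith)
  proj_lipschitz F p q a ha b hb := (h.dist_proj_le (hM F.1 F.2) p q a ha b hb).trans
    (add_le_add (mul_le_mul_of_nonneg_right (by linarith)
      (realizationDist_nonneg p.2 q.2)) (by linarith))
  proj_coarsely_onto := h.proj_coarsely_onto (by linarith)
  nest_refl F := subset_refl F.1
  nest_trans _ _ _ := Set.Subset.trans
  nest_antisymm _ _ hFF' hF'F := Subtype.ext (hFF'.antisymm hF'F)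
  maximal := Or.inr ⟨⟨Set.univ, h.factorSystem.univ_mem⟩,
    fun _ hF => Subtype.ext (Set.univ_subset_iff.1 hF),
    fun F hF => (hF ⟨Set.univ, h.factorSystem.univ_mem⟩ (Set.subset_univ F.1)).symm⟩
  rel_nest_nonempty _ F' hFF' := (h.rel_nonempty_and_diamLE_of_pnest (hM F'.1 F'.2) hFF').1
  rel_nest_diam _ F' hFF' := (h.rel_nonempty_and_diamLE_of_pnest (hM F'.1 F'.2) hFF').2
  relMap_nonempty _ _ _ _ := h.relMap_nonempty (by linarith)
  orth_symm _ _ := subset_link_comm.1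
  orth_irrefl F := not_subset_link_of_subset (h.factorSystem.nonempty F.1 F.2) subset_rfl
  orth_of_nest _ _ _ hFF' horth := horth.trans fun _ hv u hu => hv u (hFF' hu)
  orth_not_comparable F F' horth :=
    ⟨fun hFF' => not_subset_link_of_subset (h.factorSystem.nonempty F.1 F.2) hFF' horth,
      fun hF'F => not_subset_link_of_subset (h.factorSystem.nonempty F'.1 F'.2) hF'F
        (subset_link_comm.1 horth)⟩
  rel_trans F F' := fun ⟨horth, hFF', hF'F⟩ =>
    ⟨h.rel_nonempty_and_diamLE (hM F'.1 F'.2) (fun hlink => horth (subset_link_comm.1 hlink))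
      hF'F, h.rel_nonempty_and_diamLE (hM F.1 F.2) horth hFF'⟩

end IsDiscreteCHHF

end ProtoData

end CHHF

theorem lemma3p17 (n : ℕ) (δ : ℝ) :
    ∃ E : ℝ, ∀ (V : Type*) (G : SimpleGraph V) (W : SimpleGraph (CHHF.MaxClique G Set.univ))
      (𝔉 : Set (Set V)),
      CHHF.IsCHHF G W 𝔉 n δ → CHHF.IsProtoHierarchy E (CHHF.protoData G W 𝔉) := by
  obtain ⟨M, hM⟩ := CHHF.exists_closestPointLipschitz n ⌈2 * δ⌉₊ ⌈δ + δ ^ 2⌉₊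
  refine ⟨5 * M + 3, fun V G W 𝔉 h => h.isDiscreteCHHF.isProtoHierarchy (fun F hF => ?_)
    (hM h.isDiscreteCHHF)⟩
  exact (h.hyperbolicity.hyperbolic F hF).isGeodesicSpace
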